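/- Let $M$ be a smooth manifold and let $E$ be a smooth real vector bundle over $M$ endowed with a linear quaternionic structure $(A,\rho)$: $A$ is a bundle of associative algebras over $M$ with typical fibre the quaternions $\mathbb H$ (locally trivial by fibrewise algebra isomorphisms) and $\rho:A\to\mathrm{End}(E)$ is a smooth vector bundle morphism which is a morphism of unital associative algebras on each fibre. Let $Q=\rho(\mathrm{Im}\,A)\subseteq\mathrm{End}(E)$ and let $\pi:Z\to M$ be the sphere bundle of $Q$, so that each $J\in Z_x$ is a linear complex structure on $E_x$. Let $\iota:TM\to E$ be an injective morphism of vector bundles such that $(E,\iota)$ is an almost CR quaternionic structure on $M$, that is, $\iota(T_xM)+J(\iota(T_xM))=E_x$ for all $x\in M$ and all $J\in Z_x$. Suppose that $\mathrm{rank}\,E=4k$ and $\dim M=4k-l$, where $0\le l\le 2k-1$. Let $\nabla$ be a quaternionic connection on $(M,E,\iota)$, that is, a connection on $E$ such that the induced connection on $\mathrm{End}(E)$ preserves $Q$, and which is torsion-free: $\nabla_X(\iota Y)-\nabla_Y(\iota X)-\iota[X,Y]=0$ for all vector fields $X,Y$ on $M$. For $J\in Z_x$ let $E^J\subseteq E_x\otimes\mathbb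 C$ be the eigenspace of $J$ for the eigenvalue $-\mathrm i$, let $\mathcal B_J\subseteq T_J^{\mathbb C}Z$ be the horizontal lift, with respect to $\nabla$, of $\iota^{-1}(E^J)\subseteq T^{\mathbb C}_xM$, and let $$\mathcal C_J=\mathcal B_J\oplus(\ker d\pi)^{0,1}_J ,$$ where $(\ker d\pi)^{0,1}_J$ is the space of vectors of type $(0,1)$ with respect to the complex structure $q\mapsto Jq$ on $\ker d\pi_J=\{q\in Q_x : Jq+qJ=0\}$. If $2k-l\neq 2$, then the almost twistorial structure of $(M,E,\iota,\nabla)$ is integrable, that is, $\mathcal C$ is a CR structure on $Z$: it is a smooth complex vector subbundle of $T^{\mathbb C}Z$ with $\mathcal C\cap\overline{\mathcal C}=\{0\}$, and the space of its sections is closed under the bracket. -/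

import Mathlib

open Bundle Topology
open scoped Manifold ContDiff TensorProduct Quaternion

noncomputable section

/-! ### Complex distributions along a submanifold, and CR structures -/

section CR

/-- The element `u + i w` of the complexification `ℂ ⊗ V` of a real vector space. -/
def complexVector {V : Type*} [AddCommGroup V] [Module ℝ V] (u w : V) : ℂ ⊗[ℝ] V :=
  (1 : ℂ) ⊗ₜ[ℝ] u + Complex.I ⊗ₜ[ℝ] w

/-- Complex conjugation `u + i w ↦ u - i w` on `ℂ ⊗ V`. -/
def conjVector {V : Type*} [AddCommGroup V] [Module ℝ V] : ℂ ⊗[ℝ] V →ₗ[ℝ] ℂ ⊗[ℝ] V :=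
  LinearMap.rTensor V Complex.conjAe.toLinearMap

variable {B : Type*} [NormedAddCommGroup B] [NormedSpace ℝ B]
  {H : Type*} [TopologicalSpace H] (I : ModelWithCorners ℝ B H)
  {N : Type*} [TopologicalSpace N] [ChartedSpace H N]

/-- `X` is a smooth vector field on the subset `W` of `N` (its values outside of `W` are
irrelevant). -/
def IsSmoothFieldOn [IsManifold I 1 N] (W : Set N) (X : ∀ p : N, TangentSpace I p) : Prop :=
  ContMDiffOn I I.tangent ∞ (fun p => (⟨p, X p⟩ : TangentBundle I N)) W

/-- The tangent space at `p` of an embedded submanifold `S` of `N`, as a subspace of `T_p N`: the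
span of the velocities at `p` of the smooth curves of `N` that lie in `S`. -/
def submanifoldTangent (S : Set N) (p : N) : Submodule ℝ (TangentSpace I p) :=
  Submodule.span ℝ {w | ∃ γ : ℝ → N, ContMDiffAt 𝓘(ℝ, ℝ) I ∞ γ 0 ∧ (∀ᶠ t in 𝓝 (0 : ℝ), γ t ∈ S) ∧
    γ 0 = p ∧ w = mfderiv 𝓘(ℝ, ℝ) I γ 0 (1 : ℝ)}

/-- Let `S` be an embedded submanifold of `N`, and let `C p`, `p ∈ S`, be complex subspaces of
`ℂ ⊗ T_p N`. Then `C` is an *almost CR structure* on `S` if it is a smooth complex vector subbundle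
of `ℂ ⊗ TS` such that `C ∩ conj C = 0`. Smooth sections over the open subsets of `S` are, locally,
the restrictions of smooth complex vector fields `X₁ + i X₂` on open subsets of `N`; the smooth
subbundles are the families of constant rank that have smooth local sections through each of their
elements. -/
structure IsAlmostCRStructure [IsManifold I 1 N] (S : Set N)
    (C : ∀ p : N, Submodule ℂ (ℂ ⊗[ℝ] TangentSpace I p)) : Prop where
  le_tangent : ∀ p ∈ S, C p ≤ (submanifoldTangent I S p).baseChange ℂ
  inter_conj : ∀ p ∈ S, ∀ ξ ∈ C p, conjVector ξ ∈ C p → ξ = 0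
  constant_rank : ∃ r : ℕ, ∀ p ∈ S, Module.finrank ℂ (C p) = r
  smooth : ∀ p ∈ S, ∀ ξ ∈ C p, ∃ (W : Set N) (X₁ X₂ : ∀ q : N, TangentSpace I q),
    IsOpen W ∧ p ∈ W ∧ IsSmoothFieldOn I W X₁ ∧ IsSmoothFieldOn I W X₂ ∧
    (∀ q ∈ W ∩ S, complexVector (X₁ q) (X₂ q) ∈ C q) ∧ complexVector (X₁ p) (X₂ p) = ξ

/-- The space of (local) smooth sections of `C` is closed under the bracket, extended to complex
vector fields by complex bilinearity:
`[X₁ + i X₂, Y₁ + i Y₂] = [X₁, Y₁] - [X₂, Y₂] + i ([X₁, Y₂] + [X₂, Y₁])`.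
Sections over open subsets of `S` are represented by vector fields on open subsets `W` of `N`; along
`S`, the bracket of vector fields which are tangent to `S` is the bracket of their restrictions. -/
def IsBracketClosed [IsManifold I 1 N] (S : Set N)
    (C : ∀ p : N, Submodule ℂ (ℂ ⊗[ℝ] TangentSpace I p)) : Prop :=
  ∀ (W : Set N) (X₁ X₂ Y₁ Y₂ : ∀ p : N, TangentSpace I p), IsOpen W →
    IsSmoothFieldOn I W X₁ → IsSmoothFieldOn I W X₂ →
    IsSmoothFieldOn I W Y₁ → IsSmoothFieldOn I W Y₂ →
    (∀ p ∈ W ∩ S, complexVector (X₁ p) (X₂ p) ∈ C p) →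
    (∀ p ∈ W ∩ S, complexVector (Y₁ p) (Y₂ p) ∈ C p) →
    ∀ p ∈ W ∩ S,
      complexVector
        (VectorField.mlieBracket I X₁ Y₁ p - VectorField.mlieBracket I X₂ Y₂ p)
        (VectorField.mlieBracket I X₁ Y₂ p + VectorField.mlieBracket I X₂ Y₁ p) ∈ C p

/-- An (integrable almost) *CR structure* on `S`: an almost CR structure whose space of sections is
closed under the bracket. -/
structure IsCRStructure [IsManifold I 1 N] (S : Set N)
    (C : ∀ p : N, Submodule ℂ (ℂ ⊗[ℝ] TangentSpace I p)) : Prop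
    extends IsAlmostCRStructure I S C where
  bracket_closed : IsBracketClosed I S C

end CR

/-! ### Quaternionic vector bundles -/

/-- The imaginary part of an associative algebra isomorphic to the quaternions: the span of the
elements of square `-1` (for `ℍ` these are the imaginary quaternions of norm one). -/
def quaternionImaginaryPart (D : Type*) [Ring D] [Algebra ℝ D] : Submodule ℝ D :=
  Submodule.span ℝ {a : D | a * a = -1}

section Quaternionic

variable {V : Type*} [NormedAddCommGroup V] [NormedSpace ℝ V]
  {H : Type*} [TopologicalSpace H] (I : ModelWithCorners ℝ V H)
  {M : Type*} [TopologicalSpace M] [ChartedSpace H M]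

/-- `A` is a smooth bundle of associative algebras with typical fibre `ℍ`: near each point it has a
smooth local trivialization `U × ℍ ≃ A|_U` which is an isomorphism of algebras on each fibre. -/
def IsQuaternionAlgebraBundle (A : M → Type*) [∀ x, Ring (A x)] [∀ x, Algebra ℝ (A x)]
    [TopologicalSpace (TotalSpace ℍ[ℝ] A)] [∀ x, TopologicalSpace (A x)]
    [FiberBundle ℍ[ℝ] A] [VectorBundle ℝ ℍ[ℝ] A] : Prop :=
  ∀ x₀ : M, ∃ (U : Set M) (φ : ∀ x, ℍ[ℝ] ≃ₐ[ℝ] A x), IsOpen U ∧ x₀ ∈ U ∧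
    ∀ q : ℍ[ℝ], ContMDiffOn I (I.prod 𝓘(ℝ, ℍ[ℝ])) ∞
      (fun x => (⟨x, φ x q⟩ : TotalSpace ℍ[ℝ] A)) U

variable (F : Type*) [NormedAddCommGroup F] [NormedSpace ℝ F]
  (E : M → Type*) [TopologicalSpace (TotalSpace F E)]
  [∀ x, AddCommGroup (E x)] [∀ x, Module ℝ (E x)] [∀ x, TopologicalSpace (E x)]
  [∀ x, IsTopologicalAddGroup (E x)] [∀ x, ContinuousSMul ℝ (E x)]
  [FiberBundle F E] [VectorBundle ℝ F E]

/-- The total space of the vector bundle `End(E)`. -/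
abbrev EndTotal : Type _ := TotalSpace (F →L[ℝ] F) (fun x : M => E x →L[ℝ] E x)

/-- The model with corners of the manifold `EndTotal F E`. -/
abbrev endModel : ModelWithCorners ℝ (V × (F →L[ℝ] F)) (ModelProd H (F →L[ℝ] F)) :=
  I.prod 𝓘(ℝ, F →L[ℝ] F)

/-- `e` is a smooth (global) section of `E`. -/
def IsSmoothSection (e : ∀ x, E x) : Prop :=
  ContMDiff I (I.prod 𝓘(ℝ, F)) ∞ (fun x => (⟨x, e x⟩ : TotalSpace F E))

/-- `s` is a smooth (global) section of `End(E)`. -/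
def IsSmoothEndSection (s : ∀ x, E x →L[ℝ] E x) : Prop :=
  ContMDiff I (endModel I F) ∞ (fun x => (⟨x, s x⟩ : EndTotal F E))

variable (A : M → Type*) [∀ x, Ring (A x)] [∀ x, Algebra ℝ (A x)]
    [TopologicalSpace (TotalSpace ℍ[ℝ] A)] [∀ x, TopologicalSpace (A x)]
    [FiberBundle ℍ[ℝ] A] [VectorBundle ℝ ℍ[ℝ] A]

/-- `(A, ρ)` is a linear quaternionic structure on the vector bundle `E`: `A` is a bundle of
associative algebras with typical fibre `ℍ`, and `ρ : A → End(E)` is a (smooth) morphism of bundles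
of associative algebras. -/
structure IsLinearQuaternionicStructure (ρ : ∀ x, A x →ₐ[ℝ] (E x →L[ℝ] E x)) : Prop where
  algebra_bundle : IsQuaternionAlgebraBundle I A
  smooth : ContMDiff (I.prod 𝓘(ℝ, ℍ[ℝ])) (endModel I F) ∞
    (fun a : TotalSpace ℍ[ℝ] A => (⟨a.1, ρ a.1 a.2⟩ : EndTotal F E))

variable {A}

/-- The bundle `Q = ρ(Im A) ⊆ End(E)`. -/
def imaginaryBundle {E : M → Type*}
    [∀ x, AddCommGroup (E x)] [∀ x, Module ℝ (E x)] [∀ x, TopologicalSpace (E x)]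
    [∀ x, IsTopologicalAddGroup (E x)] [∀ x, ContinuousSMul ℝ (E x)]
    (ρ : ∀ x, A x →ₐ[ℝ] (E x →L[ℝ] E x)) (x : M) : Submodule ℝ (E x →L[ℝ] E x) :=
  (quaternionImaginaryPart (A x)).map (ρ x).toLinearMap

/-- The sphere bundle `Z` of `Q`, as a subset of the total space of `End(E)`; its points are the
admissible complex structures on the fibres of `E`. -/
def sphereBundle {E : M → Type*}
    [∀ x, AddCommGroup (E x)] [∀ x, Module ℝ (E x)] [∀ x, TopologicalSpace (E x)]
    [∀ x, IsTopologicalAddGroup (E x)] [∀ x, ContinuousSMul ℝ (E x)]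
    (ρ : ∀ x, A x →ₐ[ℝ] (E x →L[ℝ] E x)) : Set (EndTotal F E) :=
  {p | ∃ a : A p.1, a * a = -1 ∧ ρ p.1 a = p.2}

/-- `(E, ι)` is an almost CR quaternionic structure on `M`, with `E` quaternionic through `ρ`:
`ι : TM → E` is an injective morphism of vector bundles and, for any admissible complex structure
`J` on `E_x`, `(ι_x, J)` induces a linear CR structure on `T_x M`, that is,
`im ι_x + J (im ι_x) = E_x`. -/
structure IsAlmostCRQuaternionicStructure [IsManifold I 1 M] (ρ : ∀ x, A x →ₐ[ℝ] (E x →L[ℝ] E x))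
    (ι : ∀ x, TangentSpace I x →ₗ[ℝ] E x) : Prop where
  quaternionic : IsLinearQuaternionicStructure I F E A ρ
  smooth : ContMDiff I.tangent (I.prod 𝓘(ℝ, F)) ∞
    (fun v : TangentBundle I M => (⟨v.1, ι v.1 v.2⟩ : TotalSpace F E))
  injective : ∀ x, Function.Injective (ι x)
  generic : ∀ p ∈ sphereBundle F ρ,
    LinearMap.range (ι p.1) ⊔ (LinearMap.range (ι p.1)).map (p.2 : E p.1 →ₗ[ℝ] E p.1) = ⊤

/-! ### Quaternionic connections -/

variable {I F E}

/-- The connection on `End(E)` induced by `D` preserves `Q`: if `s` is a section of `Q` then the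
endomorphism `T = D_v s` of `E_x`, which is given by `T (e x) = D_v (s e) - s (D_v e)` for sections
`e` of `E`, is in `Q_x`. -/
def PreservesImaginaryBundle (ρ : ∀ x, A x →ₐ[ℝ] (E x →L[ℝ] E x))
    (D : CovariantDerivative I F E) : Prop :=
  ∀ s : ∀ x, E x →L[ℝ] E x, IsSmoothEndSection I F E s → (∀ x, s x ∈ imaginaryBundle ρ x) →
    ∀ (x : M) (v : TangentSpace I x), ∃ T ∈ imaginaryBundle ρ x,
      ∀ e : ∀ y, E y, IsSmoothSection I F E e →
        T (e x) = D (fun y => s y (e y)) x v - s x (D e x v)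

/-- An almost quaternionic connection: a smooth connection on `E` which preserves `Q`.
Here `D e x v` is the covariant derivative `(D_v e)(x)`. -/
structure IsAlmostQuaternionicConnection [IsManifold I 1 M]
    (ρ : ∀ x, A x →ₐ[ℝ] (E x →L[ℝ] E x)) (D : CovariantDerivative I F E) : Prop where
  smooth : D.ContMDiffCovariantDerivative ∞
  preserves : PreservesImaginaryBundle ρ D

/-- `D` is torsion-free with respect to `ι : TM → E`, that is, the `E`-valued two-form
`(X, Y) ↦ D_X (ι Y) - D_Y (ι X) - ι [X, Y]` is zero. -/
def IsTorsionFree [IsManifold I 1 M] (ι : ∀ x, TangentSpace I x →ₗ[ℝ] E x)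
    (D : CovariantDerivative I F E) : Prop :=
  ∀ X Y : ∀ x : M, TangentSpace I x,
    IsSmoothFieldOn I Set.univ X → IsSmoothFieldOn I Set.univ Y →
    ∀ x, D (fun y => ι y (Y y)) x (X x) - D (fun y => ι y (X y)) x (Y x)
      - ι x (VectorField.mlieBracket I X Y x) = 0

/-- A quaternionic connection: an almost quaternionic connection which is torsion-free. -/
structure IsQuaternionicConnection [IsManifold I 1 M] (ρ : ∀ x, A x →ₐ[ℝ] (E x →L[ℝ] E x))
    (ι : ∀ x, TangentSpace I x →ₗ[ℝ] E x) (D : CovariantDerivative I F E) : Prop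
    extends IsAlmostQuaternionicConnection ρ D where
  torsion_free : IsTorsionFree ι D

/-! ### The almost twistorial structure -/

/-- The horizontal subspace, at `p = (x, J)`, of the connection induced by `D` on `End(E)`: it is
formed of the vectors `ds_x(v)`, with `s` a section of `End(E)` such that `s(x) = J` and
`D_v s = 0`, that is, `D_v (s e) = J (D_v e)` for any section `e` of `E`. -/
def horizontalSpace (D : CovariantDerivative I F E) (p : EndTotal F E) :
    Submodule ℝ (TangentSpace (endModel I F) p) :=
  Submodule.span ℝ {w | ∃ (s : ∀ x, E x →L[ℝ] E x) (v : TangentSpace I p.1),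
    IsSmoothEndSection I F E s ∧ s p.1 = p.2 ∧
    (∀ e : ∀ y, E y, IsSmoothSection I F E e →
      D (fun y => s y (e y)) p.1 v = s p.1 (D e p.1 v)) ∧
    w = mfderiv I (endModel I F) (fun x => (⟨x, s x⟩ : EndTotal F E)) p.1 v}

variable (I) in
/-- The vertical tangent vector, at `p = (x, J)`, which corresponds to `T ∈ End(E_x)`: the velocity
at `0` of the curve `t ↦ J + t T` in the fibre. -/
def verticalLift (p : EndTotal F E) (T : E p.1 →L[ℝ] E p.1) : TangentSpace (endModel I F) p :=
  mfderiv 𝓘(ℝ, ℝ) (endModel I F) (fun t : ℝ => (⟨p.1, p.2 + t • T⟩ : EndTotal F E)) 0 (1 : ℝ)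

/-- The eigenspace `E^J` of `J`, corresponding to `-i`, in the complexification of `E_x`. -/
def eigenbundle {x : M} (J : E x →L[ℝ] E x) : Submodule ℂ (ℂ ⊗[ℝ] E x) :=
  Module.End.eigenspace ((J : E x →ₗ[ℝ] E x).baseChange ℂ) (-Complex.I)

/-- The space `B_J` : the horizontal lift, with respect to `D`, of `ι⁻¹(E^J)`. -/
def horizontalPart (ι : ∀ x, TangentSpace I x →ₗ[ℝ] E x) (D : CovariantDerivative I F E)
    (p : EndTotal F E) : Submodule ℂ (ℂ ⊗[ℝ] TangentSpace (endModel I F) p) :=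
  (horizontalSpace D p).baseChange ℂ ⊓
    ((eigenbundle p.2).comap ((ι p.1).baseChange ℂ)).comap
      (((mfderiv (endModel I F) I (fun q : EndTotal F E => q.1) p :
        TangentSpace (endModel I F) p →L[ℝ] TangentSpace I p.1) :
        TangentSpace (endModel I F) p →ₗ[ℝ] TangentSpace I p.1).baseChange ℂ)

variable (I) in
/-- The space `(ker dπ)^{0,1}` at `J ∈ Z_x`. The tangent space at `J` of the sphere `Z_x` is formed
of those `q ∈ Q_x` that are orthogonal to `J`, equivalently, `J q + q J = 0`; the complex structure
of the sphere `Z_x = ℂP¹` is `q ↦ J q`, and its `(0,1)`-vectors (the eigenspace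
corresponding to `-i`) are `q + i J q`. -/
def verticalPart (ρ : ∀ x, A x →ₐ[ℝ] (E x →L[ℝ] E x)) (p : EndTotal F E) :
    Submodule ℂ (ℂ ⊗[ℝ] TangentSpace (endModel I F) p) :=
  Submodule.span ℂ {ξ | ∃ q ∈ imaginaryBundle ρ p.1, p.2 * q + q * p.2 = 0 ∧
    ξ = complexVector (verticalLift I p q) (verticalLift I p (p.2 * q))}

/-- The distribution `C` on the sphere bundle `Z` that gives the almost twistorial structure of
`(M, E, ι, D)`: `C_J = B_J ⊕ (ker dπ)^{0,1}_J`. Only its values at the points of `Z` matter. -/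
def twistorDistribution (ρ : ∀ x, A x →ₐ[ℝ] (E x →L[ℝ] E x))
    (ι : ∀ x, TangentSpace I x →ₗ[ℝ] E x) (D : CovariantDerivative I F E) (p : EndTotal F E) :
    Submodule ℂ (ℂ ⊗[ℝ] TangentSpace (endModel I F) p) :=
  horizontalPart ι D p ⊔ verticalPart I ρ p

end Quaternionic

end

/-! ### Complexifications of real vector spaces -/

section Complexification

variable {V W : Type*} [AddCommGroup V] [Module ℝ V] [AddCommGroup W] [Module ℝ W]

/-! In real terms, X₁ + iX₂ at (x, J) belongs to 𝒞_J exactly when its horizontal components satisfy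
ιX₂ = J ιX₁ and its vertical components satisfy u₂ = J u₁, with u₁ in Q and anticommuting with J
(`IsTwistorPair`, `complexVector_mem_twistorDistribution`). Both equations have the form θ(X₂) =
m(J) θ(X₁), where θ is a vector-valued one-form on the total space of End(E) and m(J)² = -1.
Differentiating such an equation along the sphere bundle expresses the failure of the brackets to
satisfy it through dJ and dθ (`bracket_relation`). For the horizontal form dθ is controlled by the
torsion, and everything cancels. For the vertical form dθ produces the curvature R, and what remains
is B(X, Y) = [p, J] + J[q, J], where p + iq = R(X₁ + iX₂, Y₁ + iY₂) (`twistorObstruction`).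

The heart of the proof is that B vanishes (`twistorObstruction_eq_zero`). Since R preserves Q, B(X,
Y) lies in Q and anticommutes with J. If f = ιZ₁ and ζ = f + iJf is in E^J, then B(X, Y) f = Im(Rζ)
- J Re(Rζ), which measures how far Rζ is from E^J; the first Bianchi identity therefore gives B(X,
Y) ιZ₁ + B(Y, Z) ιX₁ + B(Z, X) ιY₁ = 0. Suppose B(X, Y) ≠ 0. Its square is a nonzero real scalar,
and the product of two elements of Q anticommuting with J lies in the span of 1 and J. Multiplying
the identity by B(X, Y) thus writes every Z as a complex combination of X and Y. But ι⁻¹(E^J) has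
complex dimension 2k - l ≥ 1, so 2k - l is 1 or 2. The value 2 is excluded, and for the value 1 the
vector Y is a complex multiple of X, so that R(X, Y) = 0, a contradiction.

The calculation takes place in local coordinates (`QuaternionicCoordinates`). Averaging over the
unit quaternions 1, i, j, k gives a frame of E in which the quaternionic structure is constant
(`AdaptedFrame.exists_frame`); then Q is a fixed subspace and Z is locally a product with a fixed
sphere. The hypotheses on the connection concern global sections, so they are tested on cut-off
local ones. Genericity of ι gives the constant rank and the smoothness of 𝒞, and its injectivity
gives 𝒞 ∩ conj 𝒞 = 0. -/

/-- The real part of an element of `ℂ ⊗ V`. -/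
noncomputable def realPartVector : ℂ ⊗[ℝ] V →ₗ[ℝ] V :=
  (TensorProduct.lid ℝ V).toLinearMap ∘ₗ LinearMap.rTensor V Complex.reLm

/-- The imaginary part of an element of `ℂ ⊗ V`. -/
noncomputable def imaginaryPartVector : ℂ ⊗[ℝ] V →ₗ[ℝ] V :=
  (TensorProduct.lid ℝ V).toLinearMap ∘ₗ LinearMap.rTensor V Complex.imLm

@[simp] lemma realPartVector_tmul (c : ℂ) (v : V) : realPartVector (c ⊗ₜ[ℝ] v) = c.re • v := by
  simp [realPartVector]

@[simp] lemma imaginaryPartVector_tmul (c : ℂ) (v : V) :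
    imaginaryPartVector (c ⊗ₜ[ℝ] v) = c.im • v := by
  simp [imaginaryPartVector]

@[simp] lemma realPartVector_complexVector (u w : V) : realPartVector (complexVector u w) = u := by
  simp [complexVector]

@[simp] lemma imaginaryPartVector_complexVector (u w : V) :
    imaginaryPartVector (complexVector u w) = w := by
  simp [complexVector]

lemma complexVector_add (u w u' w' : V) :
    complexVector (u + u') (w + w') = complexVector u w + complexVector u' w' := by
  simp only [complexVector, TensorProduct.tmul_add]; abel

lemma complexVector_re_im (ξ : ℂ ⊗[ℝ] V) :
    complexVector (realPartVector ξ) (imaginaryPartVector ξ) = ξ := by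
  induction ξ with
  | zero => simp [complexVector]
  | add x y hx hy => rw [map_add, map_add, complexVector_add, hx, hy]
  | tmul c v =>
    simp only [realPartVector_tmul, imaginaryPartVector_tmul, complexVector,
      ← TensorProduct.smul_tmul, ← TensorProduct.add_tmul]
    congr 1
    apply Complex.ext <;> simp

lemma complexVector_inj {u w u' w' : V} :
    complexVector u w = complexVector u' w' ↔ u = u' ∧ w = w' := by
  refine ⟨fun h => ⟨?_, ?_⟩, by rintro ⟨rfl, rfl⟩; rfl⟩
  · simpa using congrArg realPartVector h
  · simpa using congrArg imaginaryPartVector h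

lemma smul_complexVector (c : ℂ) (u w : V) :
    c • complexVector u w = complexVector (c.re • u - c.im • w) (c.im • u + c.re • w) := by
  have h : ∀ (a : ℂ) (v : V), a ⊗ₜ[ℝ] v = complexVector (a.re • v) (a.im • v) := fun a v => by
    rw [← complexVector_re_im (a ⊗ₜ[ℝ] v)]; simp
  conv_lhs => rw [complexVector]
  rw [smul_add, TensorProduct.smul_tmul', TensorProduct.smul_tmul', h, h, ← complexVector_add]
  simp [sub_eq_add_neg]

@[simp] lemma baseChange_complexVector (f : V →ₗ[ℝ] W) (u w : V) :
    f.baseChange ℂ (complexVector u w) = complexVector (f u) (f w) := by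
  simp [complexVector]

@[simp] lemma conjVector_complexVector (u w : V) :
    conjVector (complexVector u w) = complexVector u (-w) := by
  simp [conjVector, complexVector, TensorProduct.neg_tmul, TensorProduct.tmul_neg]

/-- The base change is spanned over ℂ by S, and multiplication by a complex number only mixes real
and imaginary parts linearly, so both stay in S. -/
lemma complexVector_mem_baseChange {S : Submodule ℝ V} {u w : V} :
    complexVector u w ∈ S.baseChange ℂ ↔ u ∈ S ∧ w ∈ S := by
  constructor
  · intro h
    have key : ∀ ξ ∈ S.baseChange ℂ, realPartVector ξ ∈ S ∧ imaginaryPartVector ξ ∈ S := by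
      intro ξ hξ
      rw [Submodule.baseChange_eq_span] at hξ
      induction hξ using Submodule.span_induction with
      | mem x hx =>
        obtain ⟨v, hv, rfl⟩ := hx
        simpa using hv
      | zero => simp
      | add x y _ _ hx hy =>
        exact ⟨by rw [map_add]; exact S.add_mem hx.1 hy.1,
          by rw [map_add]; exact S.add_mem hx.2 hy.2⟩
      | smul c x _ hx =>
        rw [← complexVector_re_im x, smul_complexVector]
        simp only [realPartVector_complexVector, imaginaryPartVector_complexVector]
        exact ⟨S.sub_mem (S.smul_mem _ hx.1) (S.smul_mem _ hx.2),
          S.add_mem (S.smul_mem _ hx.1) (S.smul_mem _ hx.2)⟩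
    simpa using key _ h
  · rintro ⟨hu, hw⟩
    exact Submodule.add_mem _ (Submodule.tmul_mem_baseChange_of_mem _ hu)
      (Submodule.tmul_mem_baseChange_of_mem _ hw)

end Complexification

/-! ### Imaginary quaternions and quaternionic representations -/

section Quaternions

/-- The imaginary part of a² is twice the real part of a times its imaginary part. If the real part
were nonzero, a would be a real square root of -1. -/
lemma Quaternion.re_eq_zero_of_mul_self {a : ℍ[ℝ]} (h : a * a = -1) : a.re = 0 := by
  have h0 := congrArg QuaternionAlgebra.re h
  have h1 := congrArg QuaternionAlgebra.imI h
  have h2 := congrArg QuaternionAlgebra.imJ h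
  have h3 := congrArg QuaternionAlgebra.imK h
  simp at h0 h1 h2 h3
  by_contra hne
  have e1 : a.imI = 0 := by
    have : a.re * a.imI = 0 := by linarith
    simpa [hne] using this
  have e2 : a.imJ = 0 := by
    have : a.re * a.imJ = 0 := by linarith
    simpa [hne] using this
  have e3 : a.imK = 0 := by
    have : a.re * a.imK = 0 := by linarith
    simpa [hne] using this
  rw [e1, e2, e3] at h0
  nlinarith [mul_self_nonneg a.re]

lemma Quaternion.mul_self_of_re_eq_zero {a : ℍ[ℝ]} (h : a.re = 0) :
    a * a = ((-Quaternion.normSq a : ℝ) : ℍ[ℝ]) := by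
  have h1 : star a = -a := by
    ext <;> simp [h]
  have := Quaternion.self_mul_star a
  rw [h1, mul_neg] at this
  rw [Quaternion.coe_neg, ← this, neg_neg]

lemma mem_quaternionImaginaryPart {a : ℍ[ℝ]} : a ∈ quaternionImaginaryPart ℍ[ℝ] ↔ a.re = 0 := by
  constructor
  · intro h
    induction h using Submodule.span_induction with
    | mem x hx => exact Quaternion.re_eq_zero_of_mul_self hx
    | zero => simp
    | add x y _ _ hx hy => simp [hx, hy]
    | smul c x _ hx => simp [hx]
  · intro h
    by_cases h0 : a = 0
    · rw [h0]; exact Submodule.zero_mem _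
    have hn : ‖a‖ ≠ 0 := norm_ne_zero_iff.mpr h0
    have : a = ‖a‖ • (‖a‖⁻¹ • a) := by rw [smul_smul, mul_inv_cancel₀ hn, one_smul]
    rw [this]
    refine Submodule.smul_mem _ _ (Submodule.subset_span ?_)
    show (‖a‖⁻¹ • a) * (‖a‖⁻¹ • a) = -1
    rw [smul_mul_smul_comm, Quaternion.mul_self_of_re_eq_zero h, Quaternion.normSq_eq_norm_mul_self]
    rw [← Quaternion.coe_smul, smul_eq_mul]
    have : ‖a‖⁻¹ * ‖a‖⁻¹ * -(‖a‖ * ‖a‖) = -1 := by field_simp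
    rw [this]; simp

lemma map_quaternionImaginaryPart {D D' : Type*} [Ring D] [Algebra ℝ D] [Ring D'] [Algebra ℝ D']
    (φ : D ≃ₐ[ℝ] D') :
    (quaternionImaginaryPart D).map φ.toAlgHom.toLinearMap = quaternionImaginaryPart D' := by
  rw [quaternionImaginaryPart, quaternionImaginaryPart, Submodule.map_span]
  congr 1
  ext b
  constructor
  · rintro ⟨a, ha, rfl⟩
    have ha : a * a = -1 := ha
    show φ a * φ a = -1
    rw [← map_mul, ha]; simp
  · intro hb
    have hb : b * b = -1 := hb
    refine ⟨φ.symm b, ?_, by simp⟩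
    show φ.symm b * φ.symm b = -1
    rw [← map_mul, hb]; simp

variable {D : Type*} [Ring D] [Algebra ℝ D]

/-- The image of the imaginary quaternions through a representation. -/
noncomputable def imaginaryImage (r : ℍ[ℝ] →ₐ[ℝ] D) : Submodule ℝ D :=
  (quaternionImaginaryPart ℍ[ℝ]).map r.toLinearMap

lemma mem_imaginaryImage {r : ℍ[ℝ] →ₐ[ℝ] D} {u : D} :
    u ∈ imaginaryImage r ↔ ∃ b : ℍ[ℝ], b.re = 0 ∧ r b = u := by
  simp [imaginaryImage, Submodule.mem_map, mem_quaternionImaginaryPart]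

lemma conj_mem_imaginaryImage {r : ℍ[ℝ] →ₐ[ℝ] D} {j : ℍ[ℝ]} (hj : j * j = -1) {u : D}
    (hu : u ∈ imaginaryImage r) : r j * u * r j ∈ imaginaryImage r := by
  obtain ⟨b, hb, rfl⟩ := mem_imaginaryImage.1 hu
  refine mem_imaginaryImage.2 ⟨j * b * j, ?_, by simp⟩
  have hj0 := Quaternion.re_eq_zero_of_mul_self hj
  simp [hj0, hb]; ring

/-- An imaginary quaternion b satisfies b² = -|b|². This makes a nonzero curvature obstruction
invertible. -/
lemma exists_mul_self_eq {r : ℍ[ℝ] →ₐ[ℝ] D} {u : D} (hu : u ∈ imaginaryImage r) (h0 : u ≠ 0) :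
    ∃ s : ℝ, s ≠ 0 ∧ u * u = s • 1 := by
  obtain ⟨b, hb, rfl⟩ := mem_imaginaryImage.1 hu
  refine ⟨-Quaternion.normSq b, ?_, ?_⟩
  · rw [neg_ne_zero, Quaternion.normSq_ne_zero]
    rintro rfl; simp at h0
  · have hs : star b = -b := by ext <;> simp [hb]
    have h1 := Quaternion.self_mul_star b
    rw [hs, mul_neg, neg_eq_iff_eq_neg] at h1
    rw [← map_mul, h1, ← mul_one ((Quaternion.normSq b : ℝ) : ℍ[ℝ]),
      Quaternion.coe_mul_eq_smul]
    simp

variable [Nontrivial D] {r : ℍ[ℝ] →ₐ[ℝ] D}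

/-- If j, b and jb are all imaginary, conjugating jb gives bj = -jb. This recovers tangency to the
sphere from membership in Q of u and Ju alone. -/
lemma anticomm_of_mul_mem_imaginaryImage {j : ℍ[ℝ]} (hj : j * j = -1) {u : D}
    (hu : u ∈ imaginaryImage r) (hju : r j * u ∈ imaginaryImage r) : r j * u + u * r j = 0 := by
  obtain ⟨b, hb, rfl⟩ := mem_imaginaryImage.1 hu
  obtain ⟨c, hc, h⟩ := mem_imaginaryImage.1 hju
  rw [← map_mul] at h
  have hinj : Function.Injective r := r.toRingHom.injective
  have h := hinj h
  have hj0 := Quaternion.re_eq_zero_of_mul_self hj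
  have h1 : star j = -j := by ext <;> simp [hj0]
  have h2 : star b = -b := by ext <;> simp [hb]
  have h3 : star c = -c := by ext <;> simp [hc]
  have : b * j = -(j * b) := by
    rw [← h, ← h3, h, star_mul, h1, h2]; simp
  rw [← map_mul, ← map_mul, ← map_add, this]; simp

lemma exists_anticomm_preimage {j : ℍ[ℝ]} {u : D}
    (hu : u ∈ imaginaryImage r) (h : r j * u + u * r j = 0) :
    ∃ b : ℍ[ℝ], b.re = 0 ∧ j * b + b * j = 0 ∧ r b = u := by
  obtain ⟨b, hb, rfl⟩ := mem_imaginaryImage.1 hu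
  have hinj : Function.Injective r := r.toRingHom.injective
  exact ⟨b, hb, hinj (by simpa using h), rfl⟩

lemma mul_mem_imaginaryImage {j : ℍ[ℝ]} {u : D}
    (hu : u ∈ imaginaryImage r) (h : r j * u + u * r j = 0) : r j * u ∈ imaginaryImage r := by
  obtain ⟨b, hb, hjb, rfl⟩ := exists_anticomm_preimage hu h
  refine mem_imaginaryImage.2 ⟨j * b, ?_, by simp⟩
  have h1 := congrArg QuaternionAlgebra.re hjb
  simp only [Quaternion.re_add, Quaternion.re_zero, Quaternion.re_mul] at h1 ⊢
  linarith

/-- The product of two quaternions that anticommute with j commutes with j, and the centralizer of j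
is the copy of ℂ spanned by 1 and j. -/
lemma exists_mul_eq_of_anticomm {j : ℍ[ℝ]} (hj : j * j = -1) {u u' : D}
    (hu : u ∈ imaginaryImage r) (h : r j * u + u * r j = 0)
    (hu' : u' ∈ imaginaryImage r) (h' : r j * u' + u' * r j = 0) :
    ∃ s t : ℝ, u * u' = s • 1 + t • r j := by
  obtain ⟨b, hb, hjb, rfl⟩ := exists_anticomm_preimage hu h
  obtain ⟨b', hb', hjb', rfl⟩ := exists_anticomm_preimage hu' h'
  have hj0 := Quaternion.re_eq_zero_of_mul_self hj
  have hjs : star j = -j := by ext <;> simp [hj0]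
  set c := b * b' with hc
  have hcomm : j * c = c * j := by
    have e1 : j * b = -(b * j) := eq_neg_of_add_eq_zero_left hjb
    have e2 : j * b' = -(b' * j) := eq_neg_of_add_eq_zero_left hjb'
    rw [hc, ← mul_assoc, e1, neg_mul, mul_assoc, e2]; simp [mul_assoc]
  set x : ℍ[ℝ] := c - (c.re : ℍ[ℝ]) with hx
  have hxs : star x = -x := by
    ext <;> simp [hx]
  have hxc : j * x = x * j := by
    rw [hx, mul_sub, sub_mul, hcomm, Quaternion.coe_commutes]
  -- The product of commuting imaginary quaternions is self-conjugate, hence real; so the imaginary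
  -- part x of c is a real multiple of j.
  have hre : star (j * x) = j * x := by
    rw [star_mul, hxs, hjs, neg_mul_neg, hxc]
  obtain ⟨t, ht⟩ : ∃ t : ℝ, j * x = t := ⟨(j * x).re, Quaternion.star_eq_self.1 hre⟩
  have hx' : x = (-t) • j := by
    have : j * (j * x) = -x := by rw [← mul_assoc, hj]; simp
    rw [ht] at this
    rw [← neg_neg x, ← this, ← Quaternion.coe_commutes, Quaternion.coe_mul_eq_smul]; simp
  refine ⟨c.re, -t, ?_⟩
  have : c = c.re • 1 + (-t) • j := by
    rw [← hx', hx]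
    have : c.re • (1 : ℍ[ℝ]) = (c.re : ℍ[ℝ]) := by
      rw [← Quaternion.coe_mul_eq_smul, mul_one]
    rw [this]; abel
  rw [← map_mul, ← hc]
  conv_lhs => rw [this]
  simp

/-- A great circle of the sphere of imaginary unit quaternions, with rational parametrization. -/
noncomputable def greatCircle (J β : D) (N t : ℝ) : D :=
  (1 + t ^ 2 * N)⁻¹ • ((1 - t ^ 2 * N) • J + (2 * t) • β)

/-- The half-angle parametrization with β = u/2 and N = |β|² starts at J with velocity 2β = u, and
is smooth for all t because N ≥ 0. The numerator squares to -(1 + t²N)² since J and β anticommute.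
-/
lemma exists_greatCircle {j : ℍ[ℝ]} (hj : j * j = -1) {u : D}
    (hu : u ∈ imaginaryImage r) (h : r j * u + u * r j = 0) :
    ∃ (β : D) (N : ℝ), 0 ≤ N ∧ (2 : ℝ) • β = u ∧
      ∀ t, ∃ a : ℍ[ℝ], a * a = -1 ∧ r a = greatCircle (r j) β N t := by
  obtain ⟨b, hb, hjb, rfl⟩ := exists_anticomm_preimage hu h
  set c : ℍ[ℝ] := (1 / 2 : ℝ) • b with hc
  refine ⟨r c, Quaternion.normSq c, Quaternion.normSq_nonneg, ?_, fun t => ?_⟩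
  · rw [← map_smul, hc, smul_smul]; norm_num
  set N := Quaternion.normSq c
  have hN : 0 ≤ N := Quaternion.normSq_nonneg
  have hcc : c * c = (-N) • (1 : ℍ[ℝ]) := by
    rw [Quaternion.mul_self_of_re_eq_zero (by simp [hc, hb]), ← Quaternion.coe_mul_eq_smul, mul_one]
  have hjc : c * j = -(j * c) := by
    have : b * j = - (j * b) := eq_neg_of_add_eq_zero_right hjb
    rw [hc, smul_mul_assoc, this]; simp
  refine ⟨(1 + t ^ 2 * N)⁻¹ • ((1 - t ^ 2 * N) • j + (2 * t) • c), ?_, by simp [greatCircle]⟩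
  have hpos : (1 + t ^ 2 * N) ≠ 0 := by positivity
  rw [smul_mul_smul_comm]
  simp only [add_mul, mul_add, smul_mul_smul_comm, hj, hcc, hjc]
  have : ((1 - t ^ 2 * N) * (1 - t ^ 2 * N)) • (-1 : ℍ[ℝ]) + (2 * t * (1 - t ^ 2 * N)) • -(j * c) +
      (((1 - t ^ 2 * N) * (2 * t)) • (j * c) + (2 * t * (2 * t)) • -N • (1 : ℍ[ℝ])) =
      (-(1 + t ^ 2 * N) ^ 2) • 1 := by module
  rw [this, smul_smul]
  have : (1 + t ^ 2 * N)⁻¹ * (1 + t ^ 2 * N)⁻¹ * -(1 + t ^ 2 * N) ^ 2 = -1 := by field_simp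
  rw [this]; simp

/-- The imaginary quaternions that anticommute with j are the orthogonal complement of the plane
spanned by 1 and j in ℍ, and the representation is injective. This is the real dimension of the
tangent plane of the twistor sphere. -/
lemma finrank_anticomm {j : ℍ[ℝ]} (hj : j * j = -1) :
    Module.finrank ℝ (imaginaryImage r ⊓
      LinearMap.ker (LinearMap.mulLeft ℝ (r j) + LinearMap.mulRight ℝ (r j)) : Submodule ℝ D) = 2 := by
  have hinj : Function.Injective r := r.toRingHom.injective
  have hj0 := Quaternion.re_eq_zero_of_mul_self hj
  have hn := congrArg QuaternionAlgebra.re hj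
  simp [hj0] at hn
  set K : Submodule ℝ ℍ[ℝ] := (Submodule.span ℝ (Set.range ![(1 : ℍ[ℝ]), j]))ᗮ with hK
  have hmem : ∀ b : ℍ[ℝ], b ∈ K ↔ b.re = 0 ∧ j * b + b * j = 0 := by
    intro b
    rw [hK, Submodule.mem_orthogonal]
    have h1 : (∀ u ∈ Submodule.span ℝ (Set.range ![(1 : ℍ[ℝ]), j]), inner ℝ u b = 0) ↔
        inner ℝ 1 b = 0 ∧ inner ℝ j b = 0 := by
      constructor
      · intro h
        exact ⟨h _ (Submodule.subset_span ⟨0, by simp⟩), h _ (Submodule.subset_span ⟨1, by simp⟩)⟩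
      · rintro ⟨ha, hb⟩ u hu
        induction hu using Submodule.span_induction with
        | mem x hx =>
          obtain ⟨i, rfl⟩ := hx
          fin_cases i
          · simpa using ha
          · simpa using hb
        | zero => simp
        | add x y _ _ hx hy => rw [inner_add_left, hx, hy, add_zero]
        | smul c x _ hx => rw [inner_smul_left, hx, mul_zero]
    rw [h1, Quaternion.inner_def, Quaternion.inner_def]
    simp only [one_mul, Quaternion.re_star]
    refine and_congr_right fun hb => ?_
    rw [Quaternion.ext_iff]
    simp [hj0, hb]
    constructor
    · intro h
      refine ⟨by linarith, by ring, by ring, by ring⟩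
    · rintro ⟨h, -⟩
      linarith
  have hmap : (imaginaryImage r ⊓
      LinearMap.ker (LinearMap.mulLeft ℝ (r j) + LinearMap.mulRight ℝ (r j)) : Submodule ℝ D) =
      K.map r.toLinearMap := by
    ext u
    simp only [Submodule.mem_inf, LinearMap.mem_ker, LinearMap.add_apply,
      LinearMap.mulLeft_apply, LinearMap.mulRight_apply, Submodule.mem_map, hmem]
    constructor
    · rintro ⟨hu, h⟩
      obtain ⟨b, h1, h2, h3⟩ := exists_anticomm_preimage hu h
      exact ⟨b, ⟨h1, h2⟩, h3⟩
    · rintro ⟨b, ⟨h1, h2⟩, rfl⟩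
      refine ⟨mem_imaginaryImage.2 ⟨b, h1, rfl⟩, ?_⟩
      simp only [AlgHom.toLinearMap_apply]
      rw [← map_mul, ← map_mul, ← map_add, h2, map_zero]
  rw [hmap, (Submodule.equivMapOfInjective r.toLinearMap hinj K).finrank_eq.symm]
  have hli : LinearIndependent ℝ ![(1 : ℍ[ℝ]), j] := by
    rw [LinearIndependent.pair_iff]
    intro s t hst
    have h0 := congrArg QuaternionAlgebra.re hst
    simp [hj0] at h0
    subst h0
    refine ⟨rfl, ?_⟩
    rw [zero_smul, zero_add, smul_eq_zero] at hst
    refine hst.resolve_right ?_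
    rintro rfl
    simp at hj
  have := Submodule.finrank_add_finrank_orthogonal (Submodule.span ℝ (Set.range ![(1 : ℍ[ℝ]), j]))
  rw [finrank_span_eq_card hli, Quaternion.finrank_eq_four, Fintype.card_fin, ← hK] at this
  omega

end Quaternions

/-! ### The algebraic part of the integrability condition -/

section Curvature

variable {V F : Type*} [AddCommGroup V] [Module ℝ V]
  [NormedAddCommGroup F] [NormedSpace ℝ F]

/-- The part of the curvature that obstructs the integrability of the almost twistorial structure,
evaluated on the complex vectors `X₁ + i X₂` and `Y₁ + i Y₂`. -/
noncomputable def twistorObstruction (R : V →ₗ[ℝ] V →ₗ[ℝ] (F →L[ℝ] F)) (J : F →L[ℝ] F)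
    (X₁ X₂ Y₁ Y₂ : V) : F →L[ℝ] F :=
  ((R X₁ Y₁ - R X₂ Y₂) * J - J * (R X₁ Y₁ - R X₂ Y₂)) +
    J * ((R X₁ Y₂ + R X₂ Y₁) * J - J * (R X₁ Y₂ + R X₂ Y₁))

variable {r : ℍ[ℝ] →ₐ[ℝ] (F →L[ℝ] F)} {j : ℍ[ℝ]} {R : V →ₗ[ℝ] V →ₗ[ℝ] (F →L[ℝ] F)}
  {i : V →ₗ[ℝ] F}

/-- Any commutator [p, J] anticommutes with J because J² = -1; here it is also in Q by hypothesis.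
The elements of Q that anticommute with J are stable under left multiplication by J, which handles
the second summand. -/
lemma twistorObstruction_mem [Nontrivial F] (hj : j * j = -1)
    (hR : ∀ x y, R x y * r j - r j * R x y ∈ imaginaryImage r) (X₁ X₂ Y₁ Y₂ : V) :
    twistorObstruction R (r j) X₁ X₂ Y₁ Y₂ ∈ imaginaryImage r ∧
    r j * twistorObstruction R (r j) X₁ X₂ Y₁ Y₂ + twistorObstruction R (r j) X₁ X₂ Y₁ Y₂ * r j = 0
    := by
  have hJ : r j * r j = -1 := by rw [← map_mul, hj]; simp
  have hJ' : ∀ x, r j * (r j * x) = -x := fun x => by rw [← mul_assoc, hJ]; simp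
  have anti : ∀ p : F →L[ℝ] F, r j * (p * r j - r j * p) + (p * r j - r j * p) * r j = 0 := by
    intro p
    simp only [mul_sub, sub_mul, mul_assoc, hJ, hJ', mul_neg, mul_one]; abel
  set p := R X₁ Y₁ - R X₂ Y₂ with hp
  set q := R X₁ Y₂ + R X₂ Y₁ with hq
  have hpm : p * r j - r j * p ∈ imaginaryImage r := by
    have : p * r j - r j * p =
        (R X₁ Y₁ * r j - r j * R X₁ Y₁) - (R X₂ Y₂ * r j - r j * R X₂ Y₂) := by
      rw [hp]; noncomm_ring
    rw [this]; exact Submodule.sub_mem _ (hR _ _) (hR _ _)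
  have hqm : q * r j - r j * q ∈ imaginaryImage r := by
    have : q * r j - r j * q =
        (R X₁ Y₂ * r j - r j * R X₁ Y₂) + (R X₂ Y₁ * r j - r j * R X₂ Y₁) := by
      rw [hq]; noncomm_ring
    rw [this]; exact Submodule.add_mem _ (hR _ _) (hR _ _)
  refine ⟨Submodule.add_mem _ hpm (mul_mem_imaginaryImage hqm (anti q)), ?_⟩
  simp only [twistorObstruction, ← hp, ← hq]
  simp only [mul_sub, sub_mul, mul_add, add_mul, mul_assoc, hJ, hJ', mul_neg, neg_mul, mul_one]; abel

/-- With p + iq the complexified curvature and ζ = f + iJf, the obstruction sends f to Im((p + iq)ζ)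
- J Re((p + iq)ζ). The identity is thus the complexified Bianchi identity, projected by Im - J Re;
the eight instances of `hB` below are its real components. -/
lemma twistorObstruction_cyclic (hj : j * j = -1)
    (hB : ∀ x y z, R x y (i z) + R y z (i x) + R z x (i y) = 0)
    {X₁ X₂ Y₁ Y₂ Z₁ Z₂ : V} (hX : i X₂ = r j (i X₁)) (hY : i Y₂ = r j (i Y₁))
    (hZ : i Z₂ = r j (i Z₁)) :
    twistorObstruction R (r j) X₁ X₂ Y₁ Y₂ (i Z₁) + twistorObstruction R (r j) Y₁ Y₂ Z₁ Z₂ (i X₁) +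
      twistorObstruction R (r j) Z₁ Z₂ X₁ X₂ (i Y₁) = 0 := by
  have hJ : ∀ f, r j (r j f) = -f := fun f => by
    rw [← mul_apply_eq_comp, ← map_mul, hj]; simp
  simp only [twistorObstruction, add_apply, sub_apply, mul_apply_eq_comp,
    map_add, map_sub, hJ, ← hX, ← hY, ← hZ]
  have b1 := congrArg (r j) (hB X₁ Y₁ Z₁)
  have b2 := congrArg (r j) (hB X₂ Y₂ Z₁)
  have b3 := congrArg (r j) (hB X₁ Y₂ Z₂)
  have b4 := congrArg (r j) (hB X₂ Y₁ Z₂)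
  simp only [map_add, map_zero] at b1 b2 b3 b4
  linear_combination (norm := module) hB X₁ Y₁ Z₂ + hB X₁ Y₂ Z₁ + hB X₂ Y₁ Z₁ - hB X₂ Y₂ Z₂ - b1 +
    b2 + b3 + b4

/-- As J is invertible with J⁻¹ = -J, the preimage of the image of i under J equals J(im i).
Genericity then gives the dimension of im i ∩ J(im i) from the formula for sums and intersections.
-/
lemma finrank_range_inf_comap [FiniteDimensional ℝ F] [FiniteDimensional ℝ V] {J : F →L[ℝ] F}
    (hJ : J * J = -1) (hi : Function.Injective i)
    (hg : LinearMap.range i ⊔ (LinearMap.range i).map (J : F →ₗ[ℝ] F) = ⊤) :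
    Module.finrank ℝ (LinearMap.range i ⊓ (LinearMap.range i).comap (J : F →ₗ[ℝ] F) :
      Submodule ℝ F) + Module.finrank ℝ F = 2 * Module.finrank ℝ V := by
  have hJ' : ∀ f, J (J f) = -f := fun f => by
    rw [← mul_apply_eq_comp, hJ]; simp
  have hcm : (LinearMap.range i).comap (J : F →ₗ[ℝ] F) =
      (LinearMap.range i).map (J : F →ₗ[ℝ] F) := by
    ext f
    simp only [Submodule.mem_comap, Submodule.mem_map]
    constructor
    · intro hf
      exact ⟨-J f, Submodule.neg_mem _ hf, by simp [hJ']⟩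
    · rintro ⟨g, hg, rfl⟩
      simpa [hJ'] using hg
  have hinj : Function.Injective (J : F →ₗ[ℝ] F) := by
    intro a b hab
    have := congrArg J hab
    simpa [hJ'] using this
  have h1 := Submodule.finrank_sup_add_finrank_inf_eq (LinearMap.range i)
    ((LinearMap.range i).map (J : F →ₗ[ℝ] F))
  rw [hg, finrank_top, (Submodule.equivMapOfInjective _ hinj _).symm.finrank_eq,
    LinearMap.finrank_range_of_inj hi] at h1
  rw [hcm]; omega

/-- The obstruction vanishes unless the space of vectors `X` with `i X`, `J (i X)` in the image of
`i` has real dimension four. -/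
theorem twistorObstruction_eq_zero [FiniteDimensional ℝ F] [FiniteDimensional ℝ V]
    {k l : ℕ} (hF : Module.finrank ℝ F = 4 * k) (hV : Module.finrank ℝ V + l = 4 * k)
    (hl : l < 2 * k) (hkl : 2 * k ≠ l + 2)
    (hj : j * j = -1) (hi : Function.Injective i)
    (hg : LinearMap.range i ⊔ (LinearMap.range i).map (r j : F →ₗ[ℝ] F) = ⊤)
    (halt : ∀ x y, R x y = -R y x)
    (hR : ∀ x y, R x y * r j - r j * R x y ∈ imaginaryImage r)
    (hB : ∀ x y z, R x y (i z) + R y z (i x) + R z x (i y) = 0)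
    {X₁ X₂ Y₁ Y₂ : V} (hX : i X₂ = r j (i X₁)) (hY : i Y₂ = r j (i Y₁)) :
    twistorObstruction R (r j) X₁ X₂ Y₁ Y₂ = 0 := by
  have : Nontrivial F := Module.nontrivial_of_finrank_pos (R := ℝ) (by omega)
  have hJ2 : r j * r j = -1 := by rw [← map_mul, hj]; simp
  have hJ : ∀ f, r j (r j f) = -f := fun f => by
    rw [← mul_apply_eq_comp, hJ2]; simp
  set W : Submodule ℝ F := LinearMap.range i ⊓ (LinearMap.range i).comap (r j : F →ₗ[ℝ] F) with hW
  have hWdim := finrank_range_inf_comap hJ2 hi hg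
  rw [← hW] at hWdim
  by_contra hne
  set B := twistorObstruction R (r j) X₁ X₂ Y₁ Y₂ with hBdef
  obtain ⟨hBm, hBa⟩ := twistorObstruction_mem hj hR X₁ X₂ Y₁ Y₂
  rw [← hBdef] at hBm hBa
  obtain ⟨c, hc, hBB⟩ := exists_mul_self_eq hBm hne
  -- W is ι⁻¹(E^J) seen through real parts. A nonzero obstruction forces it to be spanned over ℂ by
  -- X and Y.
  have hspan : W ≤ Submodule.span ℝ (Set.range ![i X₁, i X₂, i Y₁, i Y₂]) := by
    rintro f ⟨⟨Z₁, hZ₁⟩, Z₂, hZ₂⟩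
    have hZ : i Z₂ = r j (i Z₁) := by rw [hZ₂, hZ₁]; rfl
    have hcyc := twistorObstruction_cyclic hj hB hX hY hZ
    obtain ⟨h1, h1'⟩ := twistorObstruction_mem hj hR Y₁ Y₂ Z₁ Z₂
    obtain ⟨h2, h2'⟩ := twistorObstruction_mem hj hR Z₁ Z₂ X₁ X₂
    obtain ⟨s, t, hst⟩ := exists_mul_eq_of_anticomm hj hBm hBa h1 h1'
    obtain ⟨s', t', hst'⟩ := exists_mul_eq_of_anticomm hj hBm hBa h2 h2'
    -- Applying B turns the first term of the cyclic identity into c f, and the others into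
    -- combinations of 1 and J applied to i X₁ and i Y₁.
    have := congrArg B hcyc
    rw [map_add, map_add, map_zero, ← mul_apply_eq_comp,
      ← mul_apply_eq_comp, ← mul_apply_eq_comp,
      ← hBdef, hBB, hst, hst'] at this
    simp only [add_apply, smul_apply, one_apply_eq_self, ← hX, ← hY] at this
    have hf : f = (-c⁻¹ * s) • i X₁ + (-c⁻¹ * t) • i X₂ + (-c⁻¹ * s') • i Y₁ +
        (-c⁻¹ * t') • i Y₂ := by
      have h3 : c⁻¹ • c • f = f := by rw [smul_smul, inv_mul_cancel₀ hc, one_smul]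
      rw [← hZ₁] at h3 ⊢
      linear_combination (norm := module) -h3 + c⁻¹ • this
    rw [hf]
    have hm : ∀ m, ![i X₁, i X₂, i Y₁, i Y₂] m ∈
        Submodule.span ℝ (Set.range ![i X₁, i X₂, i Y₁, i Y₂]) :=
      fun m => Submodule.subset_span ⟨m, rfl⟩
    exact Submodule.add_mem _ (Submodule.add_mem _ (Submodule.add_mem _
      (Submodule.smul_mem _ _ (hm 0)) (Submodule.smul_mem _ _ (hm 1)))
      (Submodule.smul_mem _ _ (hm 2))) (Submodule.smul_mem _ _ (hm 3))
  have hle := (Submodule.finrank_mono hspan).trans (finrank_range_le_card _)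
  simp only [Fintype.card_fin] at hle
  -- Here dim W = 2(2k - l) is at most 4, is positive as l < 2k, and is not 4 as 2k ≠ l + 2.
  have hW2 : Module.finrank ℝ W = 2 := by omega
  have hXW : i X₁ ∈ W ∧ i X₂ ∈ W := ⟨⟨⟨_, rfl⟩, X₂, hX⟩, ⟨_, rfl⟩, -X₁, by simp [hX, hJ]⟩
  have hYW : i Y₁ ∈ W := ⟨⟨_, rfl⟩, Y₂, hY⟩
  have hX0 : i X₁ ≠ 0 := by
    intro h0
    have e1 : X₁ = 0 := hi (by simpa using h0)
    have e2 : X₂ = 0 := hi (by rw [hX, h0]; simp)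
    apply hne
    rw [hBdef, e1, e2]; simp [twistorObstruction]
  have hli : LinearIndependent ℝ ![i X₁, i X₂] := by
    rw [LinearIndependent.pair_iff]
    intro s t hst
    have h2 := congrArg (r j) hst
    simp only [map_add, map_smul, map_zero, hX, hJ] at h2
    have : (s ^ 2 + t ^ 2) • i X₁ = 0 := by
      rw [hX] at hst
      linear_combination (norm := module) s • hst - t • h2
    have := (smul_eq_zero.1 this).resolve_right hX0
    constructor <;> nlinarith
  have hWs : Submodule.span ℝ (Set.range ![i X₁, i X₂]) = W := by
    refine Submodule.eq_of_le_of_finrank_eq ?_ ?_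
    · rw [Submodule.span_le]
      rintro _ ⟨m, rfl⟩
      fin_cases m
      · exact hXW.1
      · exact hXW.2
    · rw [finrank_span_eq_card hli, hW2]; simp
  rw [← hWs, Matrix.range_cons, Matrix.range_cons, Matrix.range_empty, Set.union_empty,
    Set.singleton_union, Submodule.mem_span_pair] at hYW
  obtain ⟨a, b, hab⟩ := hYW
  -- W is now a complex line, so that Y₁ + iY₂ = (a - ib)(X₁ + iX₂); an alternating form vanishes on
  -- such a pair.
  have e1 : Y₁ = a • X₁ + b • X₂ := hi (by rw [map_add, map_smul, map_smul, hab])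
  have e2 : Y₂ = a • X₂ - b • X₁ := hi (by
    rw [hY, ← hab, map_sub, map_smul, map_smul, map_add, map_smul, map_smul, hX, hJ]; module)
  have hd : ∀ x, R x x = 0 := fun x => by
    have := halt x x
    have h2 : (2 : ℝ) • R x x = 0 := by rw [two_smul]; nth_rewrite 1 [this]; simp
    simpa using h2
  apply hne
  rw [hBdef, twistorObstruction, e1, e2]
  simp only [map_add, map_sub, map_smul, hd, halt X₂ X₁]
  simp

end Curvature

/-! ### Quaternionic connections in coordinates -/

section Calculus

variable {E G : Type*} [NormedAddCommGroup E] [NormedSpace ℝ E]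
  [NormedAddCommGroup G] [NormedSpace ℝ G]

/-- A vector outside Q is detected by a linear functional that kills Q; composed with g, this
functional vanishes near x. -/
lemma fderiv_mem_of_eventually_mem [FiniteDimensional ℝ G] {g : E → G} {x : E}
    {Q : Submodule ℝ G} (hg : DifferentiableAt ℝ g x) (h : ∀ᶠ y in 𝓝 x, g y ∈ Q) (v : E) :
    fderiv ℝ g x v ∈ Q := by
  by_contra hne
  obtain ⟨f, hf, hQ⟩ := Submodule.exists_le_ker_of_notMem hne
  have h1 : (fun y => LinearMap.toContinuousLinearMap f (g y)) =ᶠ[𝓝 x] fun _ => 0 := by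
    filter_upwards [h] with y hy using hQ hy
  have h2 := h1.fderiv_eq (𝕜 := ℝ)
  rw [fderiv_const_apply] at h2
  have h3 := ((LinearMap.toContinuousLinearMap f).hasFDerivAt.comp x hg.hasFDerivAt).fderiv
  have h4 : fderiv ℝ (fun y => LinearMap.toContinuousLinearMap f (g y)) x v =
      f (fderiv ℝ g x v) := by
    exact congrArg (fun L => L v) h3
  rw [h2] at h4
  exact hf h4.symm

lemma fderiv_clm_apply_const {θ : E → E →L[ℝ] G} {x : E} (hθ : DifferentiableAt ℝ θ x) (A B : E) :
    fderiv ℝ (fun y => θ y B) x A = fderiv ℝ θ x A B := by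
  rw [fderiv_clm_apply hθ (differentiableAt_const B)]
  simp

/-- This is dθ(A, B) = A θ(B) - B θ(A) - θ([A, B]), solved for the last term. -/
lemma apply_lieBracket {θ : E → E →L[ℝ] G} {A B : E → E} {x : E}
    (hθ : DifferentiableAt ℝ θ x) (hA : DifferentiableAt ℝ A x) (hB : DifferentiableAt ℝ B x) :
    θ x (VectorField.lieBracket ℝ A B x) =
      fderiv ℝ (fun y => θ y (B y)) x (A x) - fderiv ℝ (fun y => θ y (A y)) x (B x) -
        (fderiv ℝ θ x (A x) (B x) - fderiv ℝ θ x (B x) (A x)) := by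
  rw [fderiv_clm_apply hθ hA, fderiv_clm_apply hθ hB, VectorField.lieBracket]
  simp
  abel

end Calculus

section Coordinates

set_option maxSynthPendingDepth 3
set_option synthInstance.maxHeartbeats 200000

/-- The coordinate expression, on the open set `domain` of the vector space `V`, of an almost CR
quaternionic structure and a quaternionic connection, with respect to a local frame of `E` in which
the quaternionic structure is given by the fixed representation `rep`. -/
structure QuaternionicCoordinates (V F : Type*) [NormedAddCommGroup V] [NormedSpace ℝ V]
    [NormedAddCommGroup F] [NormedSpace ℝ F] where
  /-- The domain of the coordinates. -/
  domain : Set V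
  /-- The morphism `TM → E`. -/
  incl : V → V →L[ℝ] F
  /-- The connection form. -/
  conn : V → V →L[ℝ] F →L[ℝ] F
  /-- The quaternionic structure. -/
  rep : ℍ[ℝ] →ₐ[ℝ] (F →L[ℝ] F)
  isOpen_domain : IsOpen domain
  contDiffOn_incl : ContDiffOn ℝ ∞ incl domain
  contDiffOn_conn : ContDiffOn ℝ ∞ conn domain
  injective : ∀ y ∈ domain, Function.Injective (incl y)
  generic : ∀ y ∈ domain, ∀ j : ℍ[ℝ], j * j = -1 →
    LinearMap.range (incl y : V →ₗ[ℝ] F) ⊔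
      (LinearMap.range (incl y : V →ₗ[ℝ] F)).map (rep j : F →ₗ[ℝ] F) = ⊤
  torsion : ∀ y ∈ domain, ∀ v w, fderiv ℝ incl y v w - fderiv ℝ incl y w v +
    conn y v (incl y w) - conn y w (incl y v) = 0
  preserves : ∀ y ∈ domain, ∀ v, ∀ u ∈ imaginaryImage rep,
    conn y v * u - u * conn y v ∈ imaginaryImage rep

namespace QuaternionicCoordinates

variable {V F : Type*} [NormedAddCommGroup V] [NormedSpace ℝ V]
  [NormedAddCommGroup F] [NormedSpace ℝ F] (T : QuaternionicCoordinates V F)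

lemma contDiffAt_incl {y : V} (hy : y ∈ T.domain) : ContDiffAt ℝ ∞ T.incl y :=
  T.contDiffOn_incl.contDiffAt (T.isOpen_domain.mem_nhds hy)

lemma contDiffAt_conn {y : V} (hy : y ∈ T.domain) : ContDiffAt ℝ ∞ T.conn y :=
  T.contDiffOn_conn.contDiffAt (T.isOpen_domain.mem_nhds hy)

lemma differentiableAt_incl {y : V} (hy : y ∈ T.domain) : DifferentiableAt ℝ T.incl y :=
  (T.contDiffAt_incl hy).differentiableAt (by simp)

lemma differentiableAt_conn {y : V} (hy : y ∈ T.domain) : DifferentiableAt ℝ T.conn y :=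
  (T.contDiffAt_conn hy).differentiableAt (by simp)

/-- The curvature form of the connection. -/
noncomputable def curvature (y : V) : V →ₗ[ℝ] V →ₗ[ℝ] (F →L[ℝ] F) :=
  LinearMap.mk₂ ℝ (fun v w => fderiv ℝ T.conn y v w - fderiv ℝ T.conn y w v +
    (T.conn y v * T.conn y w - T.conn y w * T.conn y v))
    (fun a b c => by simp only [map_add, add_apply, add_mul, mul_add]; abel)
    (fun r a b => by simp only [map_smul, smul_apply, smul_mul_assoc, mul_smul_comm]; module)
    (fun a b c => by simp only [map_add, add_apply, add_mul, mul_add]; abel)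
    (fun r a b => by simp only [map_smul, smul_apply, smul_mul_assoc, mul_smul_comm]; module)

lemma curvature_apply (y v w : V) : T.curvature y v w =
    fderiv ℝ T.conn y v w - fderiv ℝ T.conn y w v +
      (T.conn y v * T.conn y w - T.conn y w * T.conn y v) := rfl

lemma curvature_swap (y v w : V) : T.curvature y v w = -T.curvature y w v := by
  rw [curvature_apply, curvature_apply]; abel

/-- The commutators of the connection form with u take values in the fixed subspace Q, hence so do
their derivatives; the quadratic part of the curvature is handled by the Jacobi identity. -/
lemma curvature_preserves [FiniteDimensional ℝ F] {y : V} (hy : y ∈ T.domain) (v w : V)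
    {u : F →L[ℝ] F} (hu : u ∈ imaginaryImage T.rep) :
    T.curvature y v w * u - u * T.curvature y v w ∈ imaginaryImage T.rep := by
  have hd : ∀ v w, fderiv ℝ T.conn y v w * u - u * fderiv ℝ T.conn y v w ∈
      imaginaryImage T.rep := by
    intro v w
    have h1 : HasFDerivAt (fun x => T.conn x w) ((ContinuousLinearMap.apply ℝ _ w).comp
        (fderiv ℝ T.conn y)) y :=
      (ContinuousLinearMap.apply ℝ (F →L[ℝ] F) w).hasFDerivAt.comp y
        (T.differentiableAt_conn hy).hasFDerivAt
    have h2 := (h1.mul_const' u).sub (h1.const_mul u)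
    have h3 := fderiv_mem_of_eventually_mem (Q := imaginaryImage T.rep) h2.differentiableAt
      (by filter_upwards [T.isOpen_domain.mem_nhds hy] with x hx using T.preserves x hx w u hu) v
    rw [h2.fderiv] at h3
    simpa using h3
  have hb : (T.conn y v * T.conn y w - T.conn y w * T.conn y v) * u -
      u * (T.conn y v * T.conn y w - T.conn y w * T.conn y v) ∈ imaginaryImage T.rep := by
    have h1 := T.preserves y hy v _ (T.preserves y hy w u hu)
    have h2 := T.preserves y hy w _ (T.preserves y hy v u hu)
    convert Submodule.sub_mem _ h1 h2 using 1
    noncomm_ring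
  rw [curvature_apply]
  convert Submodule.add_mem _ (Submodule.sub_mem _ (hd v w) (hd w v)) hb using 1
  noncomm_ring

/-- Differentiate the vanishing torsion and sum cyclically. Second derivatives of the inclusion
cancel by symmetry, and the first derivatives that remain inside the connection form are removed by
using the torsion equation once more. -/
lemma bianchi {y : V} (hy : y ∈ T.domain) (a b c : V) :
    T.curvature y a b (T.incl y c) + T.curvature y b c (T.incl y a) +
      T.curvature y c a (T.incl y b) = 0 := by
  have hi := T.differentiableAt_incl hy
  have hc := T.differentiableAt_conn hy
  have hi2 : DifferentiableAt ℝ (fderiv ℝ T.incl) y :=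
    ((T.contDiffAt_incl hy).fderiv_right (m := 1) (by norm_cast)).differentiableAt (by simp)
  have hsymm : IsSymmSndFDerivAt ℝ T.incl y :=
    (T.contDiffAt_incl hy).isSymmSndFDerivAt (by
      simpa using (WithTop.coe_le_coe.2 le_top : ((2 : ℕ∞) : WithTop ℕ∞) ≤ ((⊤ : ℕ∞) : WithTop ℕ∞)))
  -- This is the derivative, in the direction u, of the torsion equation evaluated on v and w.
  have key : ∀ u v w, fderiv ℝ (fderiv ℝ T.incl) y u v w - fderiv ℝ (fderiv ℝ T.incl) y u w v +
      (fderiv ℝ T.conn y u v (T.incl y w) + T.conn y v (fderiv ℝ T.incl y u w)) -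
      (fderiv ℝ T.conn y u w (T.incl y v) + T.conn y w (fderiv ℝ T.incl y u v)) = 0 := by
    intro u v w
    have h1 : ∀ v w, HasFDerivAt (fun x => fderiv ℝ T.incl x v w)
        ((ContinuousLinearMap.apply ℝ F w).comp ((ContinuousLinearMap.apply ℝ (V →L[ℝ] F) v).comp
        (fderiv ℝ (fderiv ℝ T.incl) y))) y := fun v w =>
      (ContinuousLinearMap.apply ℝ F w).hasFDerivAt.comp y
        ((ContinuousLinearMap.apply ℝ (V →L[ℝ] F) v).hasFDerivAt.comp y hi2.hasFDerivAt)
    have h2 : ∀ v w, HasFDerivAt (fun x => T.conn x v (T.incl x w))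
        ((T.conn y v).comp ((ContinuousLinearMap.apply ℝ F w).comp (fderiv ℝ T.incl y)) +
          ((ContinuousLinearMap.apply ℝ (F →L[ℝ] F) v).comp (fderiv ℝ T.conn y)).flip
            (T.incl y w)) y := fun v w =>
      ((ContinuousLinearMap.apply ℝ (F →L[ℝ] F) v).hasFDerivAt.comp y hc.hasFDerivAt).clm_apply
        ((ContinuousLinearMap.apply ℝ F w).hasFDerivAt.comp y hi.hasFDerivAt)
    have h3 := (((h1 v w).sub (h1 w v)).add (h2 v w)).sub (h2 w v)
    have h4 : (fun x => fderiv ℝ T.incl x v w - fderiv ℝ T.incl x w v +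
        T.conn x v (T.incl x w) - T.conn x w (T.incl x v)) =ᶠ[𝓝 y] fun _ => (0 : F) := by
      filter_upwards [T.isOpen_domain.mem_nhds hy] with x hx using T.torsion x hx v w
    have h5 := h3.unique ((hasFDerivAt_const (0 : F) y).congr_of_eventuallyEq h4)
    have h6 := congrArg (fun L => L u) h5
    simp at h6
    rw [← h6]; abel
  have s1 := congrArg (fun L => L c) (hsymm.eq a b)
  have s2 := congrArg (fun L => L a) (hsymm.eq b c)
  have s3 := congrArg (fun L => L b) (hsymm.eq c a)
  have t1 := congrArg (T.conn y c) (T.torsion y hy a b)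
  have t2 := congrArg (T.conn y a) (T.torsion y hy b c)
  have t3 := congrArg (T.conn y b) (T.torsion y hy c a)
  simp only [map_add, map_sub, map_zero] at s1 s2 s3 t1 t2 t3
  simp only [curvature_apply, add_apply, sub_apply, mul_apply_eq_comp]
  have k1 := key a b c
  have k2 := key b c a
  have k3 := key c a b
  linear_combination (norm := module) k1 + k2 + k3 + t1 + t2 + t3 - s1 - s2 - s3

/-- The vertical component, with respect to the induced connection on `End(E)`, of a tangent vector
of the total space of `End(E)`. -/
noncomputable def vert (z : V × (F →L[ℝ] F)) : V × (F →L[ℝ] F) →L[ℝ] (F →L[ℝ] F) :=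
  ContinuousLinearMap.snd ℝ V (F →L[ℝ] F) +
    ((ContinuousLinearMap.mul ℝ (F →L[ℝ] F)).flip z.2 -
      ContinuousLinearMap.mul ℝ (F →L[ℝ] F) z.2).comp
      ((T.conn z.1).comp (ContinuousLinearMap.fst ℝ V (F →L[ℝ] F)))

lemma vert_apply (z X : V × (F →L[ℝ] F)) :
    T.vert z X = X.2 + (T.conn z.1 X.1 * z.2 - z.2 * T.conn z.1 X.1) := by
  simp [vert]

/-- The horizontal component of a tangent vector of the total space of `End(E)`, viewed in `E`. -/
noncomputable def horiz (z : V × (F →L[ℝ] F)) : V × (F →L[ℝ] F) →L[ℝ] F :=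
  (T.incl z.1).comp (ContinuousLinearMap.fst ℝ V (F →L[ℝ] F))

lemma horiz_apply (z X : V × (F →L[ℝ] F)) : T.horiz z X = T.incl z.1 X.1 := rfl

/-- The points of the sphere bundle, in coordinates. -/
def sphere : Set (V × (F →L[ℝ] F)) := {z | ∃ j : ℍ[ℝ], j * j = -1 ∧ T.rep j = z.2}

/-- The pairs `(X₁, X₂)` such that `X₁ + i X₂` belongs to the twistor distribution at `z`. -/
structure IsTwistorPair (z X₁ X₂ : V × (F →L[ℝ] F)) : Prop where
  horiz_eq : T.horiz z X₂ = z.2 (T.horiz z X₁)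
  mem : T.vert z X₁ ∈ imaginaryImage T.rep
  anti : z.2 * T.vert z X₁ + T.vert z X₁ * z.2 = 0
  vert_eq : T.vert z X₂ = z.2 * T.vert z X₁

lemma differentiableAt_horiz {z : V × (F →L[ℝ] F)} (hz : z.1 ∈ T.domain) :
    DifferentiableAt ℝ T.horiz z := by
  have h1 : DifferentiableAt ℝ (fun x : V × (F →L[ℝ] F) => T.incl x.1) z :=
    (T.differentiableAt_incl hz).comp z differentiableAt_fst
  exact h1.clm_comp (differentiableAt_const _)

lemma differentiableAt_vert {z : V × (F →L[ℝ] F)} (hz : z.1 ∈ T.domain) :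
    DifferentiableAt ℝ T.vert z := by
  have h1 : DifferentiableAt ℝ (fun x : V × (F →L[ℝ] F) => T.conn x.1) z :=
    (T.differentiableAt_conn hz).comp z differentiableAt_fst
  have h2 : DifferentiableAt ℝ (fun x : V × (F →L[ℝ] F) =>
      (ContinuousLinearMap.mul ℝ (F →L[ℝ] F)).flip x.2 -
        ContinuousLinearMap.mul ℝ (F →L[ℝ] F) x.2) z :=
    ((ContinuousLinearMap.differentiableAt _).comp z differentiableAt_snd).sub
      ((ContinuousLinearMap.differentiableAt _).comp z differentiableAt_snd)
  exact (differentiableAt_const _).add (h2.clm_comp (h1.clm_comp (differentiableAt_const _)))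

lemma fderiv_horiz {z : V × (F →L[ℝ] F)} (hz : z.1 ∈ T.domain) (A B : V × (F →L[ℝ] F)) :
    fderiv ℝ T.horiz z A B = fderiv ℝ T.incl z.1 A.1 B.1 := by
  rw [← fderiv_clm_apply_const (T.differentiableAt_horiz hz)]
  have h1 : HasFDerivAt (fun x : V × (F →L[ℝ] F) => T.incl x.1 B.1)
      ((ContinuousLinearMap.apply ℝ F B.1).comp ((fderiv ℝ T.incl z.1).comp
        (ContinuousLinearMap.fst ℝ V (F →L[ℝ] F)))) z :=
    (ContinuousLinearMap.apply ℝ F B.1).hasFDerivAt.comp z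
      ((T.differentiableAt_incl hz).hasFDerivAt.comp z hasFDerivAt_fst)
  exact congrArg (fun L => L A) h1.fderiv

lemma fderiv_vert {z : V × (F →L[ℝ] F)} (hz : z.1 ∈ T.domain) (A B : V × (F →L[ℝ] F)) :
    fderiv ℝ T.vert z A B =
      (fderiv ℝ T.conn z.1 A.1 B.1 * z.2 - z.2 * fderiv ℝ T.conn z.1 A.1 B.1) +
      (T.conn z.1 B.1 * A.2 - A.2 * T.conn z.1 B.1) := by
  rw [← fderiv_clm_apply_const (T.differentiableAt_vert hz)]
  have h1 : HasFDerivAt (fun x : V × (F →L[ℝ] F) => T.conn x.1 B.1)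
      ((ContinuousLinearMap.apply ℝ (F →L[ℝ] F) B.1).comp ((fderiv ℝ T.conn z.1).comp
        (ContinuousLinearMap.fst ℝ V (F →L[ℝ] F)))) z :=
    (ContinuousLinearMap.apply ℝ (F →L[ℝ] F) B.1).hasFDerivAt.comp z
      ((T.differentiableAt_conn hz).hasFDerivAt.comp z hasFDerivAt_fst)
  have h2 : HasFDerivAt (fun x : V × (F →L[ℝ] F) => x.2)
    (ContinuousLinearMap.snd ℝ V (F →L[ℝ] F)) z := hasFDerivAt_snd
  have h3 := ((h1.mul' h2).sub (h2.mul' h1)).const_add B.2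
  have h4 : (fun x => T.vert x B) = fun x : V × (F →L[ℝ] F) => B.2 +
    ((T.conn x.1 B.1) * x.2 - x.2 * (T.conn x.1 B.1)) := by
    ext1 x; rw [vert_apply]
  rw [h4]
  refine (congrArg (fun L => L A) h3.fderiv).trans ?_
  simp
  abel

/-- The vectors tangent to the sphere bundle. -/
structure IsTangent (z A : V × (F →L[ℝ] F)) : Prop where
  mem : A.2 ∈ imaginaryImage T.rep
  anti : z.2 * A.2 + A.2 * z.2 = 0

variable {T}

/-- The vertical component differs from the second coordinate by [Γ(X), J], where Γ is the
connection form. This commutator is in Q as the connection preserves Q, and it anticommutes with J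
as J² = -1. -/
lemma IsTwistorPair.isTangent {z X₁ X₂ : V × (F →L[ℝ] F)} (hz : z.1 ∈ T.domain)
    (hs : z ∈ T.sphere) (h : T.IsTwistorPair z X₁ X₂) : T.IsTangent z X₁ := by
  obtain ⟨j, hj, hjz⟩ := hs
  have hJ : z.2 * z.2 = -1 := by rw [← hjz, ← map_mul, hj]; simp
  have hm := h.mem
  have ha := h.anti
  rw [vert_apply] at hm ha
  have hjm : z.2 ∈ imaginaryImage T.rep :=
    mem_imaginaryImage.2 ⟨j, Quaternion.re_eq_zero_of_mul_self hj, hjz⟩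
  constructor
  · simpa using Submodule.sub_mem _ hm (T.preserves z.1 hz X₁.1 _ hjm)
  · have : z.2 * (T.conn z.1 X₁.1 * z.2 - z.2 * T.conn z.1 X₁.1) +
        (T.conn z.1 X₁.1 * z.2 - z.2 * T.conn z.1 X₁.1) * z.2 = 0 := by
      have : z.2 * (T.conn z.1 X₁.1 * z.2 - z.2 * T.conn z.1 X₁.1) +
        (T.conn z.1 X₁.1 * z.2 - z.2 * T.conn z.1 X₁.1) * z.2 =
        T.conn z.1 X₁.1 * (z.2 * z.2) - (z.2 * z.2) * T.conn z.1 X₁.1 := by noncomm_ring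
      rw [this, hJ]; simp
    rw [mul_add, add_mul] at ha
    linear_combination (norm := abel) ha - this

/-- This is multiplication by -i; it carries properties of the real part over to the imaginary part.
-/
lemma IsTwistorPair.snd [Nontrivial F] {z X₁ X₂ : V × (F →L[ℝ] F)}
    (hs : z ∈ T.sphere) (h : T.IsTwistorPair z X₁ X₂) : T.IsTwistorPair z X₂ (-X₁) := by
  obtain ⟨j, hj, hjz⟩ := hs
  have hJ : z.2 * z.2 = -1 := by rw [← hjz, ← map_mul, hj]; simp
  have ha := h.anti
  refine ⟨?_, ?_, ?_, ?_⟩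
  · rw [h.horiz_eq, ← mul_apply_eq_comp, hJ]; simp
  · rw [h.vert_eq, ← hjz]; exact mul_mem_imaginaryImage h.mem (by rw [hjz]; exact ha)
  · rw [h.vert_eq, mul_assoc, ← mul_add, ha, mul_zero]
  · rw [h.vert_eq, ← mul_assoc, hJ]; simp

variable (T)

/-- A straight line in the base and a great circle in the fibre suffice, as the sphere does not
depend on the base point in an adapted frame. The curves serve both to differentiate along the
sphere bundle and to realize its tangent vectors. -/
lemma exists_curve [Nontrivial F] {z A : V × (F →L[ℝ] F)} (hs : z ∈ T.sphere)
    (hA : T.IsTangent z A) :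
    ∃ c : ℝ → V × (F →L[ℝ] F), ContDiff ℝ ∞ c ∧ c 0 = z ∧ HasDerivAt c A 0 ∧
      ∀ t, c t ∈ T.sphere := by
  obtain ⟨j, hj, hjz⟩ := hs
  obtain ⟨β, N, hN, hβ, hc⟩ := exists_greatCircle hj hA.mem (by rw [hjz]; exact hA.anti)
  have hne : ∀ t : ℝ, 1 + t ^ 2 * N ≠ 0 := fun t => by positivity
  have hsm : ContDiff ℝ ∞ (fun t : ℝ => (z.1 + t • A.1, greatCircle (T.rep j) β N t)) := by
    refine ContDiff.prodMk (by fun_prop) ?_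
    unfold greatCircle
    refine ContDiff.smul (ContDiff.inv (by fun_prop) hne) (by fun_prop)
  refine ⟨fun t => (z.1 + t • A.1, greatCircle (T.rep j) β N t), hsm, ?_, ?_, fun t => ?_⟩
  · ext1
    · simp
    · simp [greatCircle, hjz]
  · refine HasDerivAt.prodMk ?_ ?_
    · simpa using ((hasDerivAt_id (0 : ℝ)).smul_const A.1).const_add z.1
    · have h1 : HasDerivAt (fun t : ℝ => t ^ 2 * N) 0 0 := by
        simpa using ((hasDerivAt_id (0 : ℝ)).pow 2).mul_const N
      have h2 : HasDerivAt (fun t : ℝ => (1 + t ^ 2 * N)⁻¹) 0 0 := by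
        simpa using (h1.const_add 1).fun_inv (by simp)
      have h3 : HasDerivAt (fun t : ℝ => (1 - t ^ 2 * N) • T.rep j + (2 * t) • β) A.2 0 := by
        have h4 := ((h1.const_sub 1).smul_const (T.rep j)).add
          (((hasDerivAt_id (0 : ℝ)).const_mul 2).smul_const β)
        exact h4.congr_deriv (by simp [hβ])
      exact (h2.smul h3).congr_deriv (by simp)
  · obtain ⟨a, ha, hra⟩ := hc t
    exact ⟨a, ha, hra⟩

/-- The equations defining sections of 𝒞 hold only on the sphere bundle, so they can be
differentiated only along curves that stay in it. -/
lemma fderiv_eq_zero_of_isTangent [Nontrivial F] {G : Type*} [NormedAddCommGroup G]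
    [NormedSpace ℝ G] {z A : V × (F →L[ℝ] F)} (hs : z ∈ T.sphere) (hA : T.IsTangent z A)
    {g : V × (F →L[ℝ] F) → G} (hg : DifferentiableAt ℝ g z)
    (h0 : ∀ᶠ x in 𝓝 z, x ∈ T.sphere → g x = 0) : fderiv ℝ g z A = 0 := by
  obtain ⟨c, -, hc0, hcd, hcs⟩ := T.exists_curve hs hA
  have h1 : HasDerivAt (fun t => g (c t)) (fderiv ℝ g z A) 0 := by
    have := hg.hasFDerivAt
    rw [← hc0] at this
    exact (this.comp_hasDerivAt 0 hcd).congr_deriv (by simp [hc0])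
  have h2 : (fun t => g (c t)) =ᶠ[𝓝 0] fun _ => (0 : G) := by
    have : Filter.Tendsto c (𝓝 0) (𝓝 z) := by rw [← hc0]; exact hcd.continuousAt
    filter_upwards [this.eventually h0] with t ht using ht (hcs t)
  exact h1.unique ((hasDerivAt_const (0 : ℝ) (0 : G)).congr_of_eventuallyEq h2)

end QuaternionicCoordinates

end Coordinates

/-! ### Closure of the twistor distribution under the bracket -/

section Bracket

set_option maxSynthPendingDepth 3
set_option synthInstance.maxHeartbeats 200000

namespace QuaternionicCoordinates

variable {V F : Type*} [NormedAddCommGroup V] [NormedSpace ℝ V]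
  [NormedAddCommGroup F] [NormedSpace ℝ F] (T : QuaternionicCoordinates V F)

lemma fderiv_relation [Nontrivial F] {G : Type*} [NormedAddCommGroup G] [NormedSpace ℝ G]
    (m : (F →L[ℝ] F) →L[ℝ] G →L[ℝ] G)
    {θ : V × (F →L[ℝ] F) → V × (F →L[ℝ] F) →L[ℝ] G} {z A : V × (F →L[ℝ] F)}
    {X₁ X₂ : V × (F →L[ℝ] F) → V × (F →L[ℝ] F)}
    (hs : z ∈ T.sphere) (hA : T.IsTangent z A)
    (hθ : DifferentiableAt ℝ θ z) (hX₁ : DifferentiableAt ℝ X₁ z) (hX₂ : DifferentiableAt ℝ X₂ z)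
    (h : ∀ᶠ x in 𝓝 z, x ∈ T.sphere → θ x (X₂ x) = m x.2 (θ x (X₁ x))) :
    fderiv ℝ (fun x => θ x (X₂ x)) z A =
      m A.2 (θ z (X₁ z)) + m z.2 (fderiv ℝ (fun x => θ x (X₁ x)) z A) := by
  have d1 : HasFDerivAt (fun x => θ x (X₁ x)) _ z := (hθ.clm_apply hX₁).hasFDerivAt
  have d2 : HasFDerivAt (fun x => θ x (X₂ x)) _ z := (hθ.clm_apply hX₂).hasFDerivAt
  have d3 : HasFDerivAt (fun x : V × (F →L[ℝ] F) => m x.2) (m.comp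
      (ContinuousLinearMap.snd ℝ V (F →L[ℝ] F))) z := m.hasFDerivAt.comp z hasFDerivAt_snd
  have d4 := d2.sub (d3.clm_apply d1)
  have := T.fderiv_eq_zero_of_isTangent hs hA d4.differentiableAt (by
    filter_upwards [h] with x hx hxs using sub_eq_zero.2 (hx hxs))
  rw [d4.fderiv] at this
  simp at this
  rw [sub_eq_zero] at this
  rw [this]; abel

/-- Expand each bracket by `apply_lieBracket` and eliminate the derivatives of θ(X₂) and θ(Y₂) by
`fderiv_relation`. The derivatives of θ(X₁) and θ(Y₁) then cancel because m(J)² = -1, leaving only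
terms in dJ and dθ, which are pointwise in the fields. -/
lemma bracket_relation [Nontrivial F] {G : Type*} [NormedAddCommGroup G] [NormedSpace ℝ G]
    (m : (F →L[ℝ] F) →L[ℝ] G →L[ℝ] G)
    {θ : V × (F →L[ℝ] F) → V × (F →L[ℝ] F) →L[ℝ] G} {z : V × (F →L[ℝ] F)}
    {X₁ X₂ Y₁ Y₂ : V × (F →L[ℝ] F) → V × (F →L[ℝ] F)}
    (hs : z ∈ T.sphere) (hm : ∀ g, m z.2 (m z.2 g) = -g)
    (tX₁ : T.IsTangent z (X₁ z)) (tX₂ : T.IsTangent z (X₂ z))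
    (tY₁ : T.IsTangent z (Y₁ z)) (tY₂ : T.IsTangent z (Y₂ z))
    (hθ : DifferentiableAt ℝ θ z)
    (hX₁ : DifferentiableAt ℝ X₁ z) (hX₂ : DifferentiableAt ℝ X₂ z)
    (hY₁ : DifferentiableAt ℝ Y₁ z) (hY₂ : DifferentiableAt ℝ Y₂ z)
    (hX : ∀ᶠ x in 𝓝 z, x ∈ T.sphere → θ x (X₂ x) = m x.2 (θ x (X₁ x)))
    (hY : ∀ᶠ x in 𝓝 z, x ∈ T.sphere → θ x (Y₂ x) = m x.2 (θ x (Y₁ x))) :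
    θ z (VectorField.lieBracket ℝ X₁ Y₂ z + VectorField.lieBracket ℝ X₂ Y₁ z) -
      m z.2 (θ z (VectorField.lieBracket ℝ X₁ Y₁ z - VectorField.lieBracket ℝ X₂ Y₂ z)) =
    m (X₁ z).2 (θ z (Y₁ z)) + m z.2 (m (X₂ z).2 (θ z (Y₁ z))) -
      m (Y₁ z).2 (θ z (X₁ z)) - m z.2 (m (Y₂ z).2 (θ z (X₁ z))) -
      (fderiv ℝ θ z (X₁ z) (Y₂ z) - fderiv ℝ θ z (Y₂ z) (X₁ z)) -
      (fderiv ℝ θ z (X₂ z) (Y₁ z) - fderiv ℝ θ z (Y₁ z) (X₂ z)) +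
      m z.2 ((fderiv ℝ θ z (X₁ z) (Y₁ z) - fderiv ℝ θ z (Y₁ z) (X₁ z)) -
        (fderiv ℝ θ z (X₂ z) (Y₂ z) - fderiv ℝ θ z (Y₂ z) (X₂ z))) := by
  rw [map_add, map_sub, apply_lieBracket hθ hX₁ hY₂, apply_lieBracket hθ hX₂ hY₁,
    apply_lieBracket hθ hX₁ hY₁, apply_lieBracket hθ hX₂ hY₂,
    T.fderiv_relation m hs tX₁ hθ hY₁ hY₂ hY, T.fderiv_relation m hs tX₂ hθ hY₁ hY₂ hY,
    T.fderiv_relation m hs tY₁ hθ hX₁ hX₂ hX, T.fderiv_relation m hs tY₂ hθ hX₁ hX₂ hX]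
  simp only [map_sub, map_add, hm]
  abel

/-- Along the sphere bundle the second coordinate of a tangent field takes values in the fixed
subspace Q, hence so does its derivative in a tangent direction. Functionals that kill Q reduce this
to `fderiv_eq_zero_of_isTangent`. -/
lemma lieBracket_snd_mem [Nontrivial F] [FiniteDimensional ℝ F] {z : V × (F →L[ℝ] F)}
    {A B : V × (F →L[ℝ] F) → V × (F →L[ℝ] F)} (hs : z ∈ T.sphere)
    (hA : DifferentiableAt ℝ A z) (hB : DifferentiableAt ℝ B z)
    (tA : ∀ᶠ x in 𝓝 z, x ∈ T.sphere → T.IsTangent x (A x))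
    (tB : ∀ᶠ x in 𝓝 z, x ∈ T.sphere → T.IsTangent x (B x)) :
    (VectorField.lieBracket ℝ A B z).2 ∈ imaginaryImage T.rep := by
  have key : ∀ {A B : V × (F →L[ℝ] F) → V × (F →L[ℝ] F)}, DifferentiableAt ℝ B z →
      (∀ᶠ x in 𝓝 z, x ∈ T.sphere → T.IsTangent x (A x)) →
      (∀ᶠ x in 𝓝 z, x ∈ T.sphere → T.IsTangent x (B x)) →
      (fderiv ℝ B z (A z)).2 ∈ imaginaryImage T.rep := by
    intro A B hB tA tB
    by_contra hne
    obtain ⟨f, hf, hQ⟩ := Submodule.exists_le_ker_of_notMem hne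
    set L : V × (F →L[ℝ] F) →L[ℝ] ℝ := (LinearMap.toContinuousLinearMap f).comp
      (ContinuousLinearMap.snd ℝ V (F →L[ℝ] F)) with hL
    have h1 := L.hasFDerivAt.comp z hB.hasFDerivAt
    have h2 := T.fderiv_eq_zero_of_isTangent hs (tA.self_of_nhds hs) h1.differentiableAt (by
      filter_upwards [tB] with x hx hxs using hQ (hx hxs).mem)
    rw [h1.fderiv] at h2
    exact hf h2
  exact Submodule.sub_mem _ (key hB tA tB) (key hA tB tA)

/-- The twistor distribution is closed under the bracket, in coordinates. -/
theorem isTwistorPair_lieBracket [FiniteDimensional ℝ F] [FiniteDimensional ℝ V]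
    {k l : ℕ} (hF : Module.finrank ℝ F = 4 * k) (hV : Module.finrank ℝ V + l = 4 * k)
    (hl : l < 2 * k) (hkl : 2 * k ≠ l + 2) {z : V × (F →L[ℝ] F)}
    {X₁ X₂ Y₁ Y₂ : V × (F →L[ℝ] F) → V × (F →L[ℝ] F)}
    (hz : z.1 ∈ T.domain) (hs : z ∈ T.sphere)
    (dX₁ : DifferentiableAt ℝ X₁ z) (dX₂ : DifferentiableAt ℝ X₂ z)
    (dY₁ : DifferentiableAt ℝ Y₁ z) (dY₂ : DifferentiableAt ℝ Y₂ z)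
    (hX : ∀ᶠ x in 𝓝 z, x ∈ T.sphere → T.IsTwistorPair x (X₁ x) (X₂ x))
    (hY : ∀ᶠ x in 𝓝 z, x ∈ T.sphere → T.IsTwistorPair x (Y₁ x) (Y₂ x)) :
    T.IsTwistorPair z
      (VectorField.lieBracket ℝ X₁ Y₁ z - VectorField.lieBracket ℝ X₂ Y₂ z)
      (VectorField.lieBracket ℝ X₁ Y₂ z + VectorField.lieBracket ℝ X₂ Y₁ z) := by
  have : Nontrivial F := Module.nontrivial_of_finrank_pos (R := ℝ) (by omega)
  have hd : ∀ᶠ x : V × (F →L[ℝ] F) in 𝓝 z, x.1 ∈ T.domain :=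
    continuous_fst.continuousAt.eventually (T.isOpen_domain.mem_nhds hz)
  have tan : ∀ {X₁ X₂ : V × (F →L[ℝ] F) → V × (F →L[ℝ] F)},
      (∀ᶠ x in 𝓝 z, x ∈ T.sphere → T.IsTwistorPair x (X₁ x) (X₂ x)) →
      (∀ᶠ x in 𝓝 z, x ∈ T.sphere → T.IsTangent x (X₁ x)) ∧
      (∀ᶠ x in 𝓝 z, x ∈ T.sphere → T.IsTangent x (X₂ x)) := by
    intro X₁ X₂ h
    constructor
    · filter_upwards [h, hd] with x hx hxd hxs using (hx hxs).isTangent hxd hxs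
    · filter_upwards [h, hd] with x hx hxd hxs using ((hx hxs).snd hxs).isTangent hxd hxs
  obtain ⟨tX₁, tX₂⟩ := tan hX
  obtain ⟨tY₁, tY₂⟩ := tan hY
  have pX := hX.self_of_nhds hs
  have pY := hY.self_of_nhds hs
  obtain ⟨j, hj, hjz⟩ := id hs
  have hJ : z.2 * z.2 = -1 := by rw [← hjz, ← map_mul, hj]; simp
  have hJ' : ∀ x, z.2 * (z.2 * x) = -x := fun x => by rw [← mul_assoc, hJ]; simp
  have hjm : z.2 ∈ imaginaryImage T.rep :=
    mem_imaginaryImage.2 ⟨j, Quaternion.re_eq_zero_of_mul_self hj, hjz⟩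
  have hB : twistorObstruction (T.curvature z.1) z.2 (X₁ z).1 (X₂ z).1 (Y₁ z).1 (Y₂ z).1 = 0 := by
    rw [← hjz]
    refine twistorObstruction_eq_zero (i := (T.incl z.1 : V →ₗ[ℝ] F)) hF hV hl hkl hj
      (T.injective _ hz) (T.generic _ hz j hj) (T.curvature_swap _)
      (fun x y => T.curvature_preserves hz _ _ (by rw [hjz]; exact hjm)) (T.bianchi hz) ?_ ?_
    · rw [hjz]; exact pX.horiz_eq
    · rw [hjz]; exact pY.horiz_eq
  -- The same relation is used twice: for the horizontal form, on which J acts by evaluation, and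
  -- then for the vertical form, on which it acts by left multiplication.
  have e1 := T.bracket_relation (ContinuousLinearMap.id ℝ (F →L[ℝ] F)) hs
    (fun g => by
      rw [ContinuousLinearMap.id_apply, ← mul_apply_eq_comp, hJ]; simp)
    (tX₁.self_of_nhds hs) (tX₂.self_of_nhds hs) (tY₁.self_of_nhds hs) (tY₂.self_of_nhds hs)
    (T.differentiableAt_horiz hz) dX₁ dX₂ dY₁ dY₂ (hX.mono fun x hx hxs => (hx hxs).horiz_eq)
    (hY.mono fun x hx hxs => (hx hxs).horiz_eq)
  have e2 := T.bracket_relation (ContinuousLinearMap.mul ℝ (F →L[ℝ] F)) hs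
    (fun g => by simp [hJ'])
    (tX₁.self_of_nhds hs) (tX₂.self_of_nhds hs) (tY₁.self_of_nhds hs) (tY₂.self_of_nhds hs)
    (T.differentiableAt_vert hz) dX₁ dX₂ dY₁ dY₂ (hX.mono fun x hx hxs => (hx hxs).vert_eq)
    (hY.mono fun x hx hxs => (hx hxs).vert_eq)
  set J := z.2 with hJdef
  set uX := T.vert z (X₁ z) with huX
  set uY := T.vert z (Y₁ z) with huY
  have hwX₁ : (X₁ z).2 = uX - (T.conn z.1 (X₁ z).1 * J - J * T.conn z.1 (X₁ z).1) := by
    rw [huX, vert_apply]; abel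
  have hwY₁ : (Y₁ z).2 = uY - (T.conn z.1 (Y₁ z).1 * J - J * T.conn z.1 (Y₁ z).1) := by
    rw [huY, vert_apply]; abel
  have hwX₂ : (X₂ z).2 = J * uX - (T.conn z.1 (X₂ z).1 * J - J * T.conn z.1 (X₂ z).1) := by
    rw [huX, ← pX.vert_eq, vert_apply]; abel
  have hwY₂ : (Y₂ z).2 = J * uY - (T.conn z.1 (Y₂ z).1 * J - J * T.conn z.1 (Y₂ z).1) := by
    rw [huY, ← pY.vert_eq, vert_apply]; abel
  have r1 : T.horiz z (VectorField.lieBracket ℝ X₁ Y₂ z + VectorField.lieBracket ℝ X₂ Y₁ z) =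
      J (T.horiz z (VectorField.lieBracket ℝ X₁ Y₁ z - VectorField.lieBracket ℝ X₂ Y₂ z)) := by
    rw [← sub_eq_zero]
    refine e1.trans ?_
    -- Zero torsion replaces the exterior derivative of the inclusion by connection terms, which
    -- cancel those contained in the derivatives of J.
    have tor : ∀ v w, fderiv ℝ T.incl z.1 v w - fderiv ℝ T.incl z.1 w v =
        T.conn z.1 w (T.incl z.1 v) - T.conn z.1 v (T.incl z.1 w) := fun v w => by
      linear_combination (norm := abel) T.torsion z.1 hz v w
    have iX : T.incl z.1 (X₂ z).1 = J (T.incl z.1 (X₁ z).1) := pX.horiz_eq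
    have iY : T.incl z.1 (Y₂ z).1 = J (T.incl z.1 (Y₁ z).1) := pY.horiz_eq
    have hJv : ∀ f, J (J f) = -f := fun f => by rw [← mul_apply_eq_comp, hJ]; simp
    simp only [T.fderiv_horiz hz, tor, T.horiz_apply, ContinuousLinearMap.id_apply, hwX₁, hwX₂,
      hwY₁, hwY₂, iX, iY, sub_apply, mul_apply_eq_comp, map_sub, hJv]
    abel
  have r2 : T.vert z (VectorField.lieBracket ℝ X₁ Y₂ z + VectorField.lieBracket ℝ X₂ Y₁ z) =
      J * (T.vert z (VectorField.lieBracket ℝ X₁ Y₁ z - VectorField.lieBracket ℝ X₂ Y₂ z)) := by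
    rw [← sub_eq_zero]
    refine e2.trans ?_
    -- The remaining terms assemble to exactly J times the curvature obstruction.
    rw [← mul_zero J, ← hB]
    simp only [T.fderiv_vert hz, twistorObstruction, curvature_apply, ContinuousLinearMap.mul_apply',
      hwX₁, hwX₂, hwY₁, hwY₂, ← hJdef]
    simp only [mul_add, add_mul, mul_sub, sub_mul, mul_assoc, mul_neg, hJ']
    abel
  have m1 := Submodule.sub_mem _ (T.lieBracket_snd_mem hs dX₁ dY₁ tX₁ tY₁)
    (T.lieBracket_snd_mem hs dX₂ dY₂ tX₂ tY₂)
  have m2 := Submodule.add_mem _ (T.lieBracket_snd_mem hs dX₁ dY₂ tX₁ tY₂)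
    (T.lieBracket_snd_mem hs dX₂ dY₁ tX₂ tY₁)
  have v1 : T.vert z (VectorField.lieBracket ℝ X₁ Y₁ z - VectorField.lieBracket ℝ X₂ Y₂ z) ∈
      imaginaryImage T.rep := by
    rw [vert_apply]
    exact Submodule.add_mem _ m1 (T.preserves _ hz _ _ hjm)
  have v2 : T.vert z (VectorField.lieBracket ℝ X₁ Y₂ z + VectorField.lieBracket ℝ X₂ Y₁ z) ∈
      imaginaryImage T.rep := by
    rw [vert_apply]
    exact Submodule.add_mem _ m2 (T.preserves _ hz _ _ hjm)
  refine ⟨r1, v1, ?_, r2⟩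
  -- Both vertical components are in Q and the second is J times the first, which already forces
  -- anticommutation with J.
  have := anticomm_of_mul_mem_imaginaryImage hj v1 (by rw [hjz, ← r2]; exact v2)
  rwa [hjz] at this

end QuaternionicCoordinates

end Bracket

/-! ### Smooth local sections and rank of the twistor distribution -/

section Sections

set_option maxSynthPendingDepth 3
set_option synthInstance.maxHeartbeats 200000

namespace QuaternionicCoordinates

variable {V F : Type*} [NormedAddCommGroup V] [NormedSpace ℝ V]
  [NormedAddCommGroup F] [NormedSpace ℝ F] (T : QuaternionicCoordinates V F)

lemma exists_horiz_eq {z : V × (F →L[ℝ] F)} (hz : z.1 ∈ T.domain) (hs : z ∈ T.sphere) (f : F) :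
    ∃ v : V × V, T.incl z.1 v.2 - z.2 (T.incl z.1 v.1) = f := by
  obtain ⟨j, hj, hjz⟩ := hs
  have h := T.generic _ hz j hj
  have hf : f ∈ (⊤ : Submodule ℝ F) := trivial
  rw [← h, hjz, Submodule.mem_sup] at hf
  obtain ⟨_, ⟨v, rfl⟩, _, ⟨_, ⟨w, rfl⟩, rfl⟩, hvw⟩ := hf
  exact ⟨(-w, v), by rw [← hvw]; simp⟩

/-- Any element of the twistor distribution extends to a local smooth section, in coordinates. -/
theorem exists_smooth_extension [Nontrivial F] [FiniteDimensional ℝ F] [FiniteDimensional ℝ V]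
    {z X₁ X₂ : V × (F →L[ℝ] F)} (hz : z.1 ∈ T.domain) (hs : z ∈ T.sphere)
    (hX : T.IsTwistorPair z X₁ X₂) :
    ∃ (W : Set (V × (F →L[ℝ] F))) (Y₁ Y₂ : V × (F →L[ℝ] F) → V × (F →L[ℝ] F)),
      IsOpen W ∧ z ∈ W ∧ W ⊆ Prod.fst ⁻¹' T.domain ∧
      ContDiffOn ℝ ∞ Y₁ W ∧ ContDiffOn ℝ ∞ Y₂ W ∧ Y₁ z = X₁ ∧ Y₂ z = X₂ ∧
      ∀ x ∈ W, x ∈ T.sphere → T.IsTwistorPair x (Y₁ x) (Y₂ x) := by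
  have hJs : ∀ x ∈ T.sphere, x.2 * x.2 = -1 := by
    rintro x ⟨j, hj, hjx⟩
    rw [← hjx, ← map_mul, hj]; simp
  set D : Set (V × (F →L[ℝ] F)) := Prod.fst ⁻¹' T.domain with hD
  have hDo : IsOpen D := T.isOpen_domain.preimage continuous_fst
  have hincl : ContDiffOn ℝ ∞ (fun x : V × (F →L[ℝ] F) => T.incl x.1) D :=
    T.contDiffOn_incl.comp contDiffOn_fst fun x hx => hx
  have hconn : ContDiffOn ℝ ∞ (fun x : V × (F →L[ℝ] F) => T.conn x.1) D :=
    T.contDiffOn_conn.comp contDiffOn_fst fun x hx => hx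
  have hsnd : ContDiffOn ℝ ∞ (fun x : V × (F →L[ℝ] F) => x.2) D := contDiffOn_snd
  -- The kernel of L x is the space of pairs satisfying the horizontal equation at x; genericity
  -- makes L surjective at z.
  set L : V × (F →L[ℝ] F) → V × V →L[ℝ] F := fun x =>
    (T.incl x.1).comp (ContinuousLinearMap.snd ℝ V V) -
      x.2.comp ((T.incl x.1).comp (ContinuousLinearMap.fst ℝ V V)) with hL
  have hLs : ContDiffOn ℝ ∞ L D :=
    (hincl.clm_comp contDiffOn_const).sub (hsnd.clm_comp (hincl.clm_comp contDiffOn_const))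
  have hLapp : ∀ x v, L x v = T.incl x.1 v.2 - x.2 (T.incl x.1 v.1) := fun x v => rfl
  have hsurj : LinearMap.range (L z : V × V →ₗ[ℝ] F) = ⊤ :=
    LinearMap.range_eq_top.2 fun f => T.exists_horiz_eq hz hs f
  obtain ⟨R, hR⟩ := (L z : V × V →ₗ[ℝ] F).exists_rightInverse_of_surjective hsurj
  set R' : F →L[ℝ] V × V := LinearMap.toContinuousLinearMap R
  -- The right inverse at z remains one nearby after correction by the inverse of this endomorphism,
  -- which is the identity at z.
  set Mx : V × (F →L[ℝ] F) → F →L[ℝ] F := fun x => (L x).comp R' with hM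
  have hMs : ContDiffOn ℝ ∞ Mx D := hLs.clm_comp contDiffOn_const
  have hMz : Mx z = 1 := by
    ext f; exact congrArg (fun A => A f) hR
  set W := D ∩ Mx ⁻¹' {u | IsUnit u} with hW
  have hWo : IsOpen W := hMs.continuousOn.isOpen_inter_preimage hDo Units.isOpen
  have hzW : z ∈ W := ⟨hz, by
    show IsUnit (Mx z)
    rw [hMz]; exact isUnit_one⟩
  have hWD : W ⊆ D := Set.inter_subset_left
  set N : V × (F →L[ℝ] F) → F →L[ℝ] F := fun x => Ring.inverse (Mx x) with hN
  have hNs : ContDiffOn ℝ ∞ N W := by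
    intro x hx
    obtain ⟨u, hu⟩ := hx.2
    have h1 : ContDiffAt ℝ ∞ Ring.inverse (Mx x) := by
      rw [← hu]; exact contDiffAt_ringInverse ℝ u
    exact h1.comp_contDiffWithinAt x ((hMs x hx.1).mono hWD)
  set v₀ : V × V := (X₁.1, X₂.1)
  -- This projects the constant pair v₀ onto the kernel of L x along the range of the fixed right
  -- inverse.
  set v : V × (F →L[ℝ] F) → V × V := fun x => v₀ - R' (N x (L x v₀)) with hv
  have hvs : ContDiffOn ℝ ∞ v W :=
    contDiffOn_const.sub (R'.contDiff.comp_contDiffOn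
      (hNs.clm_apply ((hLs.mono hWD).clm_apply contDiffOn_const)))
  have hLv : ∀ x ∈ W, L x (v x) = 0 := by
    intro x hx
    have h1 : L x (R' (N x (L x v₀))) = (Mx x * N x) (L x v₀) := rfl
    rw [hv, map_sub, h1, hN, Ring.mul_inverse_cancel _ hx.2]; simp
  have hvz : v z = v₀ := by
    have : L z v₀ = 0 := sub_eq_zero.2 hX.horiz_eq
    rw [hv]
    simp [this]
  set u₀ := T.vert z X₁ with hu₀
  -- For J² = -1, the map u₀ ↦ (u₀ + J u₀ J)/2 is the projection onto the endomorphisms that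
  -- anticommute with J, and it preserves Q.
  set u : V × (F →L[ℝ] F) → (F →L[ℝ] F) := fun x => (1 / 2 : ℝ) • (u₀ + x.2 * u₀ * x.2) with hu
  have hus : ContDiffOn ℝ ∞ u W :=
    (contDiffOn_const.add (((hsnd.mono hWD).mul contDiffOn_const).mul
      (hsnd.mono hWD))).const_smul (1 / 2 : ℝ)
  have huz : u z = u₀ := by
    have h1 : u₀ * z.2 = -(z.2 * u₀) := eq_neg_of_add_eq_zero_right hX.anti
    rw [hu]
    simp only [mul_assoc, h1]
    rw [mul_neg, ← mul_assoc, hJs z hs, neg_one_mul, neg_neg, ← two_smul ℝ, smul_smul]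
    norm_num
  set Y₁ : V × (F →L[ℝ] F) → V × (F →L[ℝ] F) := fun x =>
    ((v x).1, u x - (T.conn x.1 (v x).1 * x.2 - x.2 * T.conn x.1 (v x).1)) with hY₁
  set Y₂ : V × (F →L[ℝ] F) → V × (F →L[ℝ] F) := fun x =>
    ((v x).2, x.2 * u x - (T.conn x.1 (v x).2 * x.2 - x.2 * T.conn x.1 (v x).2)) with hY₂
  have hsW := hsnd.mono hWD
  have hc₁ : ContDiffOn ℝ ∞ (fun x => T.conn x.1 (v x).1) W := (hconn.mono hWD).clm_apply hvs.fst
  have hc₂ : ContDiffOn ℝ ∞ (fun x => T.conn x.1 (v x).2) W := (hconn.mono hWD).clm_apply hvs.snd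
  have hvY₁ : ∀ x, T.vert x (Y₁ x) = u x := fun x => by rw [vert_apply]; simp [hY₁]
  have hvY₂ : ∀ x, T.vert x (Y₂ x) = x.2 * u x := fun x => by rw [vert_apply]; simp [hY₂]
  refine ⟨W, Y₁, Y₂, hWo, hzW, hWD, ?_, ?_, ?_, ?_, ?_⟩
  · exact hvs.fst.prodMk (hus.sub ((hc₁.mul hsW).sub (hsW.mul hc₁)))
  · exact hvs.snd.prodMk ((hsW.mul hus).sub ((hc₂.mul hsW).sub (hsW.mul hc₂)))
  · have h1 := hvY₁ z
    rw [huz, hu₀, vert_apply, vert_apply] at h1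
    have h2 : (Y₁ z).1 = X₁.1 := by rw [hY₁]; simp [hvz, v₀]
    rw [h2] at h1
    exact Prod.ext h2 (by simpa using h1)
  · have h1 := hvY₂ z
    rw [huz, hu₀, ← hX.vert_eq, vert_apply, vert_apply] at h1
    have h2 : (Y₂ z).1 = X₂.1 := by rw [hY₂]; simp [hvz, v₀]
    rw [h2] at h1
    exact Prod.ext h2 (by simpa using h1)
  · intro x hx hxs
    have hJ := hJs x hxs
    refine ⟨sub_eq_zero.1 (hLv x hx), ?_, ?_, ?_⟩
    · rw [hvY₁]
      obtain ⟨j, hj, hjx⟩ := hxs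
      refine Submodule.smul_mem _ _ (Submodule.add_mem _ hX.mem ?_)
      rw [← hjx]; exact conj_mem_imaginaryImage hj hX.mem
    · rw [hvY₁, hu]
      simp only [mul_smul_comm, smul_mul_assoc, mul_add, add_mul]
      have h1 : x.2 * (x.2 * u₀ * x.2) = -(u₀ * x.2) := by
        rw [← mul_assoc, ← mul_assoc, hJ]; simp
      have h2 : x.2 * u₀ * x.2 * x.2 = -(x.2 * u₀) := by rw [mul_assoc, hJ]; simp
      rw [h1, h2, ← smul_add]
      simp
    · rw [hvY₁, hvY₂]

/-- The twistor distribution at `z`, in coordinates, as a real vector space of pairs. -/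
noncomputable def pairs (z : V × (F →L[ℝ] F)) :
    Submodule ℝ ((V × (F →L[ℝ] F)) × (V × (F →L[ℝ] F))) where
  carrier := {X | T.IsTwistorPair z X.1 X.2}
  zero_mem' := ⟨by simp, by simp, by simp, by simp⟩
  add_mem' := by
    rintro X Y hX hY
    refine ⟨?_, ?_, ?_, ?_⟩
    · simp only [Prod.fst_add, Prod.snd_add, map_add, hX.horiz_eq, hY.horiz_eq]
    · simp only [Prod.fst_add, map_add]; exact Submodule.add_mem _ hX.mem hY.mem
    · have := congrArg₂ (· + ·) hX.anti hY.anti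
      simp only [Prod.fst_add, map_add, mul_add, add_mul] at this ⊢
      rw [← add_zero 0, ← this]; abel
    · simp only [Prod.fst_add, Prod.snd_add, map_add, mul_add, hX.vert_eq, hY.vert_eq]
  smul_mem' := by
    rintro c X hX
    refine ⟨?_, ?_, ?_, ?_⟩
    · simp only [Prod.smul_fst, Prod.smul_snd, map_smul, hX.horiz_eq]
    · simp only [Prod.smul_fst, map_smul]; exact Submodule.smul_mem _ _ hX.mem
    · simp only [Prod.smul_fst, map_smul, mul_smul_comm, smul_mul_assoc, ← smul_add, hX.anti,
        smul_zero]
    · simp only [Prod.smul_fst, Prod.smul_snd, map_smul, mul_smul_comm, hX.vert_eq]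

lemma mem_pairs {z : V × (F →L[ℝ] F)} {X : (V × (F →L[ℝ] F)) × (V × (F →L[ℝ] F))} :
    X ∈ T.pairs z ↔ T.IsTwistorPair z X.1 X.2 := Iff.rfl

/-- A twistor pair is determined by the horizontal and vertical components of its first vector.
These range freely over im ι ∩ J⁻¹(im ι), of dimension 2 dim V - dim F, and over the tangent plane
of the sphere, of dimension 2. -/
theorem finrank_pairs [Nontrivial F] [FiniteDimensional ℝ F] [FiniteDimensional ℝ V]
    {z : V × (F →L[ℝ] F)} (hz : z.1 ∈ T.domain) (hs : z ∈ T.sphere) :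
    Module.finrank ℝ (T.pairs z) + Module.finrank ℝ F = 2 * Module.finrank ℝ V + 2 := by
  obtain ⟨j, hj, hjz⟩ := id hs
  have hJ : T.rep j * T.rep j = -1 := by rw [← map_mul, hj]; simp
  have hinj := T.injective _ hz
  have h1 := finrank_range_inf_comap (i := (T.incl z.1 : V →ₗ[ℝ] F)) hJ hinj (T.generic _ hz j hj)
  have h2 := finrank_anticomm (r := T.rep) hj
  rw [hjz] at h1 h2
  set A := LinearMap.range (T.incl z.1 : V →ₗ[ℝ] F) ⊓
    (LinearMap.range (T.incl z.1 : V →ₗ[ℝ] F)).comap (z.2 : F →ₗ[ℝ] F) with hA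
  set Q := imaginaryImage T.rep ⊓
    LinearMap.ker (LinearMap.mulLeft ℝ z.2 + LinearMap.mulRight ℝ z.2) with hQ
  have memQ : ∀ q, q ∈ Q ↔ q ∈ imaginaryImage T.rep ∧ z.2 * q + q * z.2 = 0 := fun q => by
    simp [hQ]
  set g : T.pairs z →ₗ[ℝ] F × (F →L[ℝ] F) :=
    (((T.horiz z).prod (T.vert z) : V × (F →L[ℝ] F) →ₗ[ℝ] F × (F →L[ℝ] F)) ∘ₗ
      LinearMap.fst ℝ _ _) ∘ₗ (T.pairs z).subtype with hg
  have gapp : ∀ X, g X = (T.horiz z X.1.1, T.vert z X.1.1) := fun X => rfl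
  have ginj : Function.Injective g := by
    have key : ∀ X Y : V × (F →L[ℝ] F), T.horiz z X = T.horiz z Y → T.vert z X = T.vert z Y →
        X = Y := by
      intro X Y hh hv
      have e1 : X.1 = Y.1 := hinj hh
      rw [vert_apply, vert_apply, e1] at hv
      exact Prod.ext e1 (by simpa using hv)
    rintro ⟨X, hX⟩ ⟨Y, hY⟩ hXY
    rw [gapp, gapp, Prod.mk.injEq] at hXY
    obtain ⟨e1, e2⟩ := hXY
    refine Subtype.ext (Prod.ext (key _ _ e1 e2) (key _ _ ?_ ?_))
    · rw [hX.horiz_eq, hY.horiz_eq, e1]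
    · rw [hX.vert_eq, hY.vert_eq, e2]
  have grange : LinearMap.range g = A.prod Q := by
    ext ⟨f, q⟩
    simp only [LinearMap.mem_range, Submodule.mem_prod, memQ]
    constructor
    · rintro ⟨⟨X, hX⟩, h⟩
      rw [gapp, Prod.mk.injEq] at h
      obtain ⟨rfl, rfl⟩ := h
      exact ⟨⟨⟨_, rfl⟩, ⟨X.2.1, hX.horiz_eq⟩⟩, hX.mem, hX.anti⟩
    · rintro ⟨⟨⟨v, rfl⟩, ⟨w, hw⟩⟩, hq⟩
      set a : F →L[ℝ] F := T.conn z.1 v * z.2 - z.2 * T.conn z.1 v with ha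
      set b : F →L[ℝ] F := T.conn z.1 w * z.2 - z.2 * T.conn z.1 w with hb
      have e1 : T.vert z (v, q - a) = q := by rw [vert_apply]; simp [ha]
      have e2 : T.vert z (w, z.2 * q - b) = z.2 * q := by rw [vert_apply]; simp [hb]
      refine ⟨⟨((v, q - a), (w, z.2 * q - b)), ⟨hw, ?_, ?_, ?_⟩⟩, ?_⟩
      · rw [e1]; exact hq.1
      · rw [e1]; exact hq.2
      · rw [e1, e2]
      · rw [gapp]; exact Prod.ext rfl e1
  let e : A.prod Q ≃ₗ[ℝ] A × Q :=
    { toFun := fun x => (⟨x.1.1, x.2.1⟩, ⟨x.1.2, x.2.2⟩)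
      invFun := fun x => ⟨(x.1.1, x.2.1), x.1.2, x.2.2⟩
      map_add' := fun _ _ => rfl
      map_smul' := fun _ _ => rfl }
  have h3 := LinearMap.finrank_range_of_inj ginj
  rw [grange, e.finrank_eq, Module.finrank_prod, h2] at h3
  omega

end QuaternionicCoordinates

end Sections

/-! ### Local frames of a vector bundle -/

section LinearFrame

set_option linter.unusedSectionVars false

variable {V : Type*} [NormedAddCommGroup V] [NormedSpace ℝ V]
  {M : Type*} [TopologicalSpace M] [ChartedSpace V M]

variable (V) (F : Type*) [NormedAddCommGroup F] [NormedSpace ℝ F]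
  (E : M → Type*) [TopologicalSpace (TotalSpace F E)]
  [∀ x, AddCommGroup (E x)] [∀ x, Module ℝ (E x)] [∀ x, TopologicalSpace (E x)]
  [FiberBundle F E] [VectorBundle ℝ F E]

/-- A smooth local frame of `E`: a local trivialization composed with a smooth family of
automorphisms of the typical fibre. -/
structure LinearFrame where
  /-- The point at which the trivialization is taken. -/
  base : M
  /-- The domain of the frame. -/
  source : Set M
  /-- The change of frame. -/
  change : M → F →L[ℝ] F
  /-- The inverse of the change of frame. -/
  changeInv : M → F →L[ℝ] F
  isOpen_source : IsOpen source
  source_subset : source ⊆ (trivializationAt F E base).baseSet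
  contMDiffOn_change : ContMDiffOn 𝓘(ℝ, V) 𝓘(ℝ, F →L[ℝ] F) ∞ change source
  contMDiffOn_changeInv : ContMDiffOn 𝓘(ℝ, V) 𝓘(ℝ, F →L[ℝ] F) ∞ changeInv source
  mul_inv : ∀ x ∈ source, change x * changeInv x = 1
  inv_mul : ∀ x ∈ source, changeInv x * change x = 1

namespace LinearFrame

variable {V F E} (L : LinearFrame V F E)

/-- The coordinates of the vectors of `E` with respect to the frame. -/
noncomputable def coord (x : M) : E x →L[ℝ] F :=
  (L.changeInv x).comp ((trivializationAt F E L.base).continuousLinearMapAt ℝ x)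

/-- The vectors of `E` with given coordinates with respect to the frame. -/
noncomputable def vec (x : M) : F →L[ℝ] E x :=
  ((trivializationAt F E L.base).symmL ℝ x).comp (L.change x)

variable {x : M}

lemma coord_vec (hx : x ∈ L.source) (f : F) : L.coord x (L.vec x f) = f := by
  have := congrArg (fun T => T f) (L.inv_mul x hx)
  simpa [coord, vec, Trivialization.continuousLinearMapAt_symmL _ (L.source_subset hx)] using this

lemma vec_coord (hx : x ∈ L.source) (e : E x) : L.vec x (L.coord x e) = e := by
  have := congrArg (fun T => T ((trivializationAt F E L.base).continuousLinearMapAt ℝ x e))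
    (L.mul_inv x hx)
  simp only [mul_apply_eq_comp, one_apply_eq_self] at this
  simp only [coord, vec, ContinuousLinearMap.comp_apply, this,
    Trivialization.symmL_continuousLinearMapAt _ (L.source_subset hx)]

lemma change_coord (hx : x ∈ L.source) (e : E x) :
    L.change x (L.coord x e) = (trivializationAt F E L.base).continuousLinearMapAt ℝ x e := by
  have := congrArg (fun T => T ((trivializationAt F E L.base).continuousLinearMapAt ℝ x e))
    (L.mul_inv x hx)
  exact this

lemma snd_trivializationAt (hx : x ∈ L.source) (e : E x) :
    (trivializationAt F E L.base ⟨x, e⟩).2 = L.change x (L.coord x e) := by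
  rw [L.change_coord hx, Trivialization.continuousLinearMapAt_apply,
    Trivialization.coe_linearMapAt_of_mem _ (L.source_subset hx)]

lemma coord_injective (hx : x ∈ L.source) : Function.Injective (L.coord x) :=
  Function.LeftInverse.injective (L.vec_coord hx)

variable {V' : Type*} [NormedAddCommGroup V'] [NormedSpace ℝ V']
  {H' : Type*} [TopologicalSpace H'] {J : ModelWithCorners ℝ V' H'}
  {P : Type*} [TopologicalSpace P] [ChartedSpace H' P] {p : P}

lemma contMDiffAt_change (hx : x ∈ L.source) :
    ContMDiffAt 𝓘(ℝ, V) 𝓘(ℝ, F →L[ℝ] F) ∞ L.change x :=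
  L.contMDiffOn_change.contMDiffAt (L.isOpen_source.mem_nhds hx)

lemma contMDiffAt_changeInv (hx : x ∈ L.source) :
    ContMDiffAt 𝓘(ℝ, V) 𝓘(ℝ, F →L[ℝ] F) ∞ L.changeInv x :=
  L.contMDiffOn_changeInv.contMDiffAt (L.isOpen_source.mem_nhds hx)

/-- A map to the total space of `E` is smooth if its projection and coordinates are smooth. -/
lemma contMDiffAt_iff [ContMDiffVectorBundle ∞ F E 𝓘(ℝ, V)] {f : P → TotalSpace F E}
    (hp : (f p).1 ∈ L.source) :
    ContMDiffAt J (𝓘(ℝ, V).prod 𝓘(ℝ, F)) ∞ f p ↔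
      ContMDiffAt J 𝓘(ℝ, V) ∞ (fun q => (f q).1) p ∧
        ContMDiffAt J 𝓘(ℝ, F) ∞ (fun q => L.coord (f q).1 (f q).2) p := by
  rw [(trivializationAt F E L.base).contMDiffAt_iff (IB := 𝓘(ℝ, V))
    ((Trivialization.mem_source _).2 (L.source_subset hp))]
  refine and_congr_right fun h1 => ?_
  have hmem : ∀ᶠ q in 𝓝 p, (f q).1 ∈ L.source :=
    h1.continuousAt.eventually_mem (L.isOpen_source.mem_nhds hp)
  constructor
  · intro h2
    refine (((L.contMDiffAt_changeInv hp).comp p h1).clm_apply h2).congr_of_eventuallyEq ?_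
    filter_upwards [hmem] with q hq
    have := congrArg (fun T => T (L.coord (f q).1 (f q).2)) (L.inv_mul _ hq)
    change _ = L.changeInv (f q).1 (trivializationAt F E L.base ⟨(f q).1, (f q).2⟩).2
    rw [L.snd_trivializationAt hq]
    exact this.symm
  · intro h2
    refine (((L.contMDiffAt_change hp).comp p h1).clm_apply h2).congr_of_eventuallyEq ?_
    filter_upwards [hmem] with q hq using L.snd_trivializationAt hq (f q).2

variable [∀ x, IsTopologicalAddGroup (E x)] [∀ x, ContinuousSMul ℝ (E x)]

/-- The matrix of an endomorphism of a fibre of `E` with respect to the frame. -/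
noncomputable def matrix (x : M) (T : E x →L[ℝ] E x) : F →L[ℝ] F :=
  (L.coord x).comp (T.comp (L.vec x))

/-- The endomorphism of a fibre of `E` that has a given matrix with respect to the frame. -/
noncomputable def endo (x : M) (T : F →L[ℝ] F) : E x →L[ℝ] E x :=
  (L.vec x).comp (T.comp (L.coord x))

lemma matrix_apply (T : E x →L[ℝ] E x) (f : F) :
    L.matrix x T f = L.coord x (T (L.vec x f)) := rfl

lemma endo_apply (T : F →L[ℝ] F) (e : E x) :
    L.endo x T e = L.vec x (T (L.coord x e)) := rfl

lemma matrix_endo (hx : x ∈ L.source) (T : F →L[ℝ] F) : L.matrix x (L.endo x T) = T := by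
  ext f
  simp [matrix_apply, endo_apply, L.coord_vec hx]

lemma endo_matrix (hx : x ∈ L.source) (T : E x →L[ℝ] E x) : L.endo x (L.matrix x T) = T := by
  ext f
  simp [matrix_apply, endo_apply, L.vec_coord hx]

lemma matrix_injective (hx : x ∈ L.source) : Function.Injective (L.matrix x) :=
  Function.LeftInverse.injective (L.endo_matrix hx)

lemma coord_apply (hx : x ∈ L.source) (T : E x →L[ℝ] E x) (e : E x) :
    L.coord x (T e) = L.matrix x T (L.coord x e) := by
  rw [matrix_apply, L.vec_coord hx]

lemma matrix_mul (hx : x ∈ L.source) (S T : E x →L[ℝ] E x) :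
    L.matrix x (S * T) = L.matrix x S * L.matrix x T := by
  ext f
  simp [matrix_apply, L.vec_coord hx]

lemma matrix_one (hx : x ∈ L.source) : L.matrix x 1 = 1 := by
  ext f
  simp [matrix_apply, L.coord_vec hx]

lemma matrix_add (S T : E x →L[ℝ] E x) : L.matrix x (S + T) = L.matrix x S + L.matrix x T := by
  ext f; simp [matrix_apply]

lemma matrix_smul (c : ℝ) (T : E x →L[ℝ] E x) : L.matrix x (c • T) = c • L.matrix x T := by
  ext f; simp [matrix_apply]

lemma matrix_zero : L.matrix x (0 : E x →L[ℝ] E x) = 0 := by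
  ext f; simp [matrix_apply]

lemma snd_trivializationAt_end (hx : x ∈ L.source) (T : E x →L[ℝ] E x) :
    (trivializationAt (F →L[ℝ] F) (fun x => E x →L[ℝ] E x) L.base ⟨x, T⟩).2 =
      L.change x * L.matrix x T * L.changeInv x := by
  rw [hom_trivializationAt_apply]
  ext f
  have h1 : (L.change x) (L.changeInv x f) = f := by
    simpa using congrArg (fun T => T f) (L.mul_inv x hx)
  simp only [ContinuousLinearMap.inCoordinates, mul_apply_eq_comp, matrix_apply,
    L.change_coord hx]
  simp [vec, h1]

/-- A map to the total space of `End(E)` is smooth if its projection and matrix are smooth. -/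
lemma contMDiffAt_end_iff [ContMDiffVectorBundle ∞ F E 𝓘(ℝ, V)] {f : P → EndTotal F E}
    (hp : (f p).1 ∈ L.source) :
    ContMDiffAt J (endModel 𝓘(ℝ, V) F) ∞ f p ↔
      ContMDiffAt J 𝓘(ℝ, V) ∞ (fun q => (f q).1) p ∧
        ContMDiffAt J 𝓘(ℝ, F →L[ℝ] F) ∞ (fun q => L.matrix (f q).1 (f q).2) p := by
  rw [(trivializationAt (F →L[ℝ] F) (fun x => E x →L[ℝ] E x) L.base).contMDiffAt_iff
    (IB := 𝓘(ℝ, V)) ((Trivialization.mem_source _).2 (by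
      rw [hom_trivializationAt_baseSet]
      exact ⟨L.source_subset hp, L.source_subset hp⟩))]
  refine and_congr_right fun h1 => ?_
  have hmem : ∀ᶠ q in 𝓝 p, (f q).1 ∈ L.source :=
    h1.continuousAt.eventually_mem (L.isOpen_source.mem_nhds hp)
  have h3 := (L.contMDiffAt_change hp).comp p h1
  have h4 := (L.contMDiffAt_changeInv hp).comp p h1
  constructor
  · intro h2
    refine ((h4.clm_comp h2).clm_comp h3).congr_of_eventuallyEq ?_
    filter_upwards [hmem] with q hq
    change _ = L.changeInv (f q).1 *
      (trivializationAt (F →L[ℝ] F) (fun x => E x →L[ℝ] E x) L.base ⟨(f q).1, (f q).2⟩).2 *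
      L.change (f q).1
    rw [L.snd_trivializationAt_end hq]
    simp only [mul_assoc, L.inv_mul _ hq, mul_one]
    rw [← mul_assoc, L.inv_mul _ hq, one_mul]
  · intro h2
    refine ((h3.clm_comp h2).clm_comp h4).congr_of_eventuallyEq ?_
    filter_upwards [hmem] with q hq using L.snd_trivializationAt_end hq (f q).2

end LinearFrame

end LinearFrame

/-! ### Intertwining two quaternionic representations by averaging -/

section Intertwiner

variable {D : Type*} [Ring D] [Algebra ℝ D]

/-- The quaternion `i`. -/
def Quaternion.unitI : ℍ[ℝ] := ⟨0, 1, 0, 0⟩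

/-- The quaternion `j`. -/
def Quaternion.unitJ : ℍ[ℝ] := ⟨0, 0, 1, 0⟩

/-- The quaternion `k`. -/
def Quaternion.unitK : ℍ[ℝ] := ⟨0, 0, 0, 1⟩

open Quaternion (unitI unitJ unitK)

@[simp] lemma Quaternion.unitI_components : unitI.re = 0 ∧ unitI.imI = 1 ∧ unitI.imJ = 0 ∧ unitI.imK = 0 :=
  ⟨rfl, rfl, rfl, rfl⟩

@[simp] lemma Quaternion.unitJ_components : unitJ.re = 0 ∧ unitJ.imI = 0 ∧ unitJ.imJ = 1 ∧ unitJ.imK = 0 :=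
  ⟨rfl, rfl, rfl, rfl⟩

@[simp] lemma Quaternion.unitK_components : unitK.re = 0 ∧ unitK.imI = 0 ∧ unitK.imJ = 0 ∧ unitK.imK = 1 :=
  ⟨rfl, rfl, rfl, rfl⟩

lemma Quaternion.eq_sum_units (q : ℍ[ℝ]) :
    q = q.re • 1 + q.imI • unitI + q.imJ • unitJ + q.imK • unitK := by
  apply QuaternionAlgebra.ext <;> simp

/-- The average of `r e * (s e)⁻¹` over the units `e = 1, i, j, k`. -/
noncomputable def quaternionIntertwiner (r s : ℍ[ℝ] → D) : D :=
  (4⁻¹ : ℝ) • (1 - r unitI * s unitI - r unitJ * s unitJ - r unitK * s unitK)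

lemma Quaternion.unitI_mul_unitI : unitI * unitI = -1 := by
  apply QuaternionAlgebra.ext <;> simp

lemma Quaternion.unitJ_mul_unitJ : unitJ * unitJ = -1 := by
  apply QuaternionAlgebra.ext <;> simp

lemma Quaternion.unitK_mul_unitK : unitK * unitK = -1 := by
  apply QuaternionAlgebra.ext <;> simp

lemma Quaternion.unitI_mul_unitJ : unitI * unitJ = unitK := by
  apply QuaternionAlgebra.ext <;> simp

lemma quaternionIntertwiner_self (r : ℍ[ℝ] →ₐ[ℝ] D) : quaternionIntertwiner r r = 1 := by
  simp only [quaternionIntertwiner, ← map_mul, Quaternion.unitI_mul_unitI,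
    Quaternion.unitJ_mul_unitJ, Quaternion.unitK_mul_unitK, map_neg, map_one]
  module

/-- Multiplication by a unit only permutes, up to signs that cancel, the terms r(e) s(e)⁻¹ of the
average over e = 1, i, j, k; the general case follows by linearity. The signs in the definition come
from s(e)⁻¹ = -s(e) for e = i, j, k. -/
lemma mul_quaternionIntertwiner (r s : ℍ[ℝ] →ₐ[ℝ] D) (c : ℍ[ℝ]) :
    r c * quaternionIntertwiner r s = quaternionIntertwiner r s * s c := by
  have hii := Quaternion.unitI_mul_unitI
  have hjj := Quaternion.unitJ_mul_unitJ
  have hkk := Quaternion.unitK_mul_unitK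
  have hij := Quaternion.unitI_mul_unitJ
  have hjk : unitJ * unitK = unitI := by
    apply QuaternionAlgebra.ext <;> simp
  have hki : unitK * unitI = unitJ := by
    apply QuaternionAlgebra.ext <;> simp
  have hji : unitJ * unitI = -unitK := by
    apply QuaternionAlgebra.ext <;> simp
  have hkj : unitK * unitJ = -unitI := by
    apply QuaternionAlgebra.ext <;> simp
  have hik : unitI * unitK = -unitJ := by
    apply QuaternionAlgebra.ext <;> simp
  have hm (a b : ℍ[ℝ]) (d : D) : r a * (r b * d) = r (a * b) * d := by rw [map_mul, mul_assoc]
  rw [Quaternion.eq_sum_units c]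
  simp only [quaternionIntertwiner, map_add, map_smul, map_one, add_mul, mul_add,
    smul_mul_assoc, mul_smul_comm, one_mul, mul_one, mul_sub, sub_mul, hm, mul_assoc, ← map_mul s,
    hii, hjj, hkk, hij, hjk, hki, hji, hkj, hik, map_neg, neg_mul, mul_neg]
  module

end Intertwiner

/-! ### Frames in which the quaternionic structure is constant -/

section AdaptedFrame

set_option linter.unusedSectionVars false

variable {V : Type*} [NormedAddCommGroup V] [NormedSpace ℝ V]
  {M : Type*} [TopologicalSpace M] [ChartedSpace V M]
  {F : Type*} [NormedAddCommGroup F] [NormedSpace ℝ F]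
  {E : M → Type*} [TopologicalSpace (TotalSpace F E)]
  [∀ x, AddCommGroup (E x)] [∀ x, Module ℝ (E x)] [∀ x, TopologicalSpace (E x)]
  [∀ x, IsTopologicalAddGroup (E x)] [∀ x, ContinuousSMul ℝ (E x)]
  [FiberBundle F E] [VectorBundle ℝ F E] [ContMDiffVectorBundle ∞ F E 𝓘(ℝ, V)]
  {A : M → Type*} [∀ x, Ring (A x)] [∀ x, Algebra ℝ (A x)]
  [TopologicalSpace (TotalSpace ℍ[ℝ] A)] [∀ x, TopologicalSpace (A x)]
  [FiberBundle ℍ[ℝ] A] [VectorBundle ℝ ℍ[ℝ] A]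

variable (V F) in
/-- A local frame of a quaternionic vector bundle with respect to which the quaternionic structure
is constant. -/
structure AdaptedFrame (ρ : ∀ x, A x →ₐ[ℝ] (E x →L[ℝ] E x)) extends LinearFrame V F E where
  /-- The quaternionic structure with respect to the frame. -/
  rep : ℍ[ℝ] →ₐ[ℝ] (F →L[ℝ] F)
  source_subset_chart : source ⊆ (chartAt V base).source
  exists_algEquiv : ∀ x ∈ source, ∃ φ : ℍ[ℝ] ≃ₐ[ℝ] A x,
    ∀ b, toLinearFrame.matrix x (ρ x (φ b)) = rep b

variable (V F E) in
/-- The local frame given by a trivialization. -/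
noncomputable def LinearFrame.ofTrivialization (x₀ : M) (U : Set M) (hU : IsOpen U) :
    LinearFrame V F E where
  base := x₀
  source := U ∩ (trivializationAt F E x₀).baseSet
  change _ := 1
  changeInv _ := 1
  isOpen_source := hU.inter (trivializationAt F E x₀).open_baseSet
  source_subset := Set.inter_subset_right
  contMDiffOn_change := contMDiffOn_const
  contMDiffOn_changeInv := contMDiffOn_const
  mul_inv _ _ := one_mul 1
  inv_mul _ _ := one_mul 1

/-- The change of a local frame by a smooth family of automorphisms. -/
noncomputable def LinearFrame.changeBy (L : LinearFrame V F E) (U : Set M) (hU : IsOpen U)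
    (hUL : U ⊆ L.source) (g h : M → F →L[ℝ] F) (hg : ContMDiffOn 𝓘(ℝ, V) 𝓘(ℝ, F →L[ℝ] F) ∞ g U)
    (hh : ContMDiffOn 𝓘(ℝ, V) 𝓘(ℝ, F →L[ℝ] F) ∞ h U) (hgh : ∀ x ∈ U, g x * h x = 1)
    (hhg : ∀ x ∈ U, h x * g x = 1) :
    LinearFrame V F E where
  base := L.base
  source := U
  change x := L.change x * g x
  changeInv x := h x * L.changeInv x
  isOpen_source := hU
  source_subset := hUL.trans L.source_subset
  contMDiffOn_change := (L.contMDiffOn_change.mono hUL).clm_comp hg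
  contMDiffOn_changeInv := hh.clm_comp (L.contMDiffOn_changeInv.mono hUL)
  mul_inv x hx := by
    rw [mul_assoc, ← mul_assoc (g x), hgh x hx, one_mul, L.mul_inv x (hUL hx)]
  inv_mul x hx := by
    rw [mul_assoc, ← mul_assoc (L.changeInv x), L.inv_mul x (hUL hx), one_mul, hhg x hx]

/-- Representations of ℍ are rigid: the intertwiner between r(x) and r(x₀) is smooth in x and equals
1 at x₀, so it is invertible nearby. Changing the frame by it turns r(x) into g⁻¹ r(x) g = r(x₀). -/
lemma AdaptedFrame.exists_frame [CompleteSpace F] {ρ : ∀ x, A x →ₐ[ℝ] (E x →L[ℝ] E x)}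
    (hρ : IsLinearQuaternionicStructure 𝓘(ℝ, V) F E A ρ) (x₀ : M) :
    ∃ L : AdaptedFrame V F ρ, x₀ ∈ L.source := by
  obtain ⟨U, φ, hU, hx₀, hφ⟩ := hρ.algebra_bundle x₀
  let L := LinearFrame.ofTrivialization V F E x₀ (U ∩ (chartAt V x₀).source)
    (hU.inter (chartAt V x₀).open_source)
  have hL : x₀ ∈ L.source := ⟨⟨hx₀, mem_chart_source V x₀⟩, mem_baseSet_trivializationAt F E x₀⟩
  let r (x : M) (b : ℍ[ℝ]) : F →L[ℝ] F := L.matrix x (ρ x (φ x b))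
  have hr : ∀ x ∈ L.source, ∃ R : ℍ[ℝ] →ₐ[ℝ] (F →L[ℝ] F), ⇑R = r x := fun x hx =>
    ⟨AlgHom.ofLinearMap
      { toFun := r x
        map_add' := fun a b => by simp only [r, map_add, L.matrix_add]
        map_smul' := fun c b => by simp only [r, map_smul, L.matrix_smul, RingHom.id_apply] }
      (by
        change r x 1 = 1
        simp only [r, map_one, L.matrix_one hx])
      (fun a b => by
        change r x (a * b) = r x a * r x b
        simp only [r, map_mul, L.matrix_mul hx]), rfl⟩
  have hsm : ∀ b, ContMDiffOn 𝓘(ℝ, V) 𝓘(ℝ, F →L[ℝ] F) ∞ (fun x => r x b) L.source := by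
    intro b x hx
    have h1 := (hφ b).contMDiffAt (hU.mem_nhds hx.1.1)
    have h2 := hρ.smooth.contMDiffAt.comp x h1
    exact ((L.contMDiffAt_end_iff hx).1 h2).2.contMDiffWithinAt
  obtain ⟨r₀, hr₀⟩ := hr x₀ hL
  -- The intertwiner accepts arbitrary functions because r x is known to be a representation only
  -- over the domain of the frame.
  let g (x : M) : F →L[ℝ] F := quaternionIntertwiner (r x) r₀
  have hprod (b : ℍ[ℝ]) : ContMDiffOn 𝓘(ℝ, V) 𝓘(ℝ, F →L[ℝ] F) ∞ (fun x => r x b * r₀ b) L.source :=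
    (hsm b).clm_comp contMDiffOn_const
  have hg : ContMDiffOn 𝓘(ℝ, V) 𝓘(ℝ, F →L[ℝ] F) ∞ g L.source :=
    (contDiff_const_smul (4⁻¹ : ℝ)).contMDiff.comp_contMDiffOn
      ((((contMDiffOn_const (c := (1 : F →L[ℝ] F))).sub (hprod _)).sub (hprod _)).sub (hprod _))
  have hopen : IsOpen (L.source ∩ g ⁻¹' {a | IsUnit a}) :=
    hg.continuousOn.isOpen_inter_preimage L.isOpen_source Units.isOpen
  have hg₀ : g x₀ = 1 := by
    simp only [g, ← hr₀]
    exact quaternionIntertwiner_self r₀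
  have hinv : ContMDiffOn 𝓘(ℝ, V) 𝓘(ℝ, F →L[ℝ] F) ∞ (fun x => Ring.inverse (g x))
      (L.source ∩ g ⁻¹' {a | IsUnit a}) := by
    rintro x ⟨hx, u, hu⟩
    have h1 := contDiffAt_ringInverse (n := ∞) ℝ u
    rw [hu] at h1
    exact (h1.contMDiffAt.comp x
      (hg.contMDiffAt (L.isOpen_source.mem_nhds hx))).contMDiffWithinAt
  refine ⟨{ L.changeBy _ hopen Set.inter_subset_left g (fun x => Ring.inverse (g x))
              (hg.mono Set.inter_subset_left) hinv
              (fun x hx => Ring.mul_inverse_cancel _ hx.2)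
              (fun x hx => Ring.inverse_mul_cancel _ hx.2) with
            rep := r₀
            source_subset_chart := fun x hx => hx.1.1.2
            exists_algEquiv := fun x hx => ⟨φ x, fun b => ?_⟩ }, hL, ?_⟩
  · obtain ⟨R, hR⟩ := hr x hx.1
    have h1 : Ring.inverse (g x) * (r x b * g x) = r₀ b := by
      have h2 := mul_quaternionIntertwiner R r₀ b
      rw [hR] at h2
      change r x b * g x = g x * r₀ b at h2
      rw [h2, ← mul_assoc, Ring.inverse_mul_cancel _ hx.2, one_mul]
    exact h1
  · change IsUnit (g x₀)
    rw [hg₀]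
    exact isUnit_one

end AdaptedFrame

/-! ### Vector fields in local coordinates -/

section VectorFields

variable {B : Type*} [NormedAddCommGroup B] [NormedSpace ℝ B]
  {H : Type*} [TopologicalSpace H] {I : ModelWithCorners ℝ B H}
  {N : Type*} [TopologicalSpace N] [ChartedSpace H N]
  {G : Type*} [NormedAddCommGroup G] [NormedSpace ℝ G]

variable (I) in
/-- The partial homeomorphism `e` is a smooth system of coordinates. -/
structure IsSmoothCoordinates (e : OpenPartialHomeomorph N G) : Prop where
  contMDiffOn : ContMDiffOn I 𝓘(ℝ, G) ∞ e e.source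
  contMDiffOn_symm : ContMDiffOn 𝓘(ℝ, G) I ∞ e.symm e.target

variable (I) in
/-- The coordinate expression of a vector field. -/
noncomputable def coordinateField (e : OpenPartialHomeomorph N G)
    (X : ∀ p : N, TangentSpace I p) (z : G) : G :=
  mfderiv I 𝓘(ℝ, G) e (e.symm z) (X (e.symm z))

variable (I) in
/-- The vector field with a given coordinate expression. -/
noncomputable def fieldOfCoordinates (e : OpenPartialHomeomorph N G) (Y : G → G) (p : N) :
    TangentSpace I p :=
  mfderiv 𝓘(ℝ, G) I e.symm (e p) (Y (e p))

namespace IsSmoothCoordinates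

variable {e : OpenPartialHomeomorph N G}

lemma contMDiffAt (he : IsSmoothCoordinates I e) {p : N}
    (hp : p ∈ e.source) : ContMDiffAt I 𝓘(ℝ, G) ∞ e p :=
  he.contMDiffOn.contMDiffAt (e.open_source.mem_nhds hp)

lemma contMDiffAt_symm (he : IsSmoothCoordinates I e) {z : G}
    (hz : z ∈ e.target) : ContMDiffAt 𝓘(ℝ, G) I ∞ e.symm z :=
  he.contMDiffOn_symm.contMDiffAt (e.open_target.mem_nhds hz)

lemma mdifferentiable (he : IsSmoothCoordinates I e) : e.MDifferentiable I 𝓘(ℝ, G) :=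
  ⟨he.contMDiffOn.mdifferentiableOn (by simp), he.contMDiffOn_symm.mdifferentiableOn (by simp)⟩

lemma mfderiv_symm_mfderiv (he : IsSmoothCoordinates I e) {p : N} (hp : p ∈ e.source) (X
    : TangentSpace I p) :
    mfderiv 𝓘(ℝ, G) I e.symm (e p) (mfderiv I 𝓘(ℝ, G) e p X) = X :=
  congrArg (fun T => T X) (he.mdifferentiable.symm_comp_deriv hp)

lemma mfderiv_mfderiv_symm (he : IsSmoothCoordinates I e) {z : G} (hz : z ∈ e.target) (A : G) :
    mfderiv I 𝓘(ℝ, G) e (e.symm z) (mfderiv 𝓘(ℝ, G) I e.symm z A) = A :=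
  congrArg (fun T => T A) (he.mdifferentiable.comp_symm_deriv hz)

lemma mfderiv_injective (he : IsSmoothCoordinates I e) {p : N} (hp : p ∈ e.source) :
    Function.Injective (mfderiv I 𝓘(ℝ, G) e p) :=
  he.mdifferentiable.mfderiv_injective hp

lemma coordinateField_fieldOfCoordinates (he : IsSmoothCoordinates I e) {Y : G → G} {z : G} (hz
    : z ∈ e.target) :
    coordinateField I e (fieldOfCoordinates I e Y) z = Y z := by
  unfold coordinateField fieldOfCoordinates
  rw [e.right_inv hz]
  exact he.mfderiv_mfderiv_symm hz (Y z)

lemma mpullback_symm (he : IsSmoothCoordinates I e) {X : ∀ p : N, TangentSpace I p} {z : G} (hz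
    : z ∈ e.target) :
    VectorField.mpullback 𝓘(ℝ, G) I e.symm X z = coordinateField I e X z := by
  have h1 := he.mdifferentiable.comp_symm_deriv hz
  have h2 := he.mdifferentiable.symm_comp_deriv (e.map_target hz)
  rw [e.right_inv hz] at h2
  rw [VectorField.mpullback_apply, ContinuousLinearMap.inverse_eq h2 h1]
  rfl

variable [IsManifold I 1 N]

lemma contDiffOn_coordinateField (he : IsSmoothCoordinates I e) {W : Set N}
    {X : ∀ p : N, TangentSpace I p}
    (hX : IsSmoothFieldOn I W X) :
    ContDiffOn ℝ ∞ (coordinateField I e X) (e.target ∩ e.symm ⁻¹' W) := by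
  have h1 : ContMDiffOn 𝓘(ℝ, G) I.tangent ∞
      (fun z => (⟨e.symm z, X (e.symm z)⟩ : TangentBundle I N)) (e.target ∩ e.symm ⁻¹' W) :=
    hX.comp (he.contMDiffOn_symm.mono Set.inter_subset_left) Set.inter_subset_right
  have h2 := (he.contMDiffOn.contMDiffOn_tangentMapWithin (m := ∞) (by simp)
    e.open_source.uniqueMDiffOn).comp h1 (fun z hz => e.map_target hz.1)
  have h3 := (contMDiff_snd_tangentBundle_modelSpace (n := ∞) G 𝓘(ℝ, G)).comp_contMDiffOn h2
  refine h3.contDiffOn.congr fun z hz => ?_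
  have h4 := mfderivWithin_of_isOpen (I := I) (I' := 𝓘(ℝ, G)) (f := e) e.open_source
    (e.map_target hz.1)
  change _ = mfderivWithin I 𝓘(ℝ, G) e e.source (e.symm z) (X (e.symm z))
  rw [h4]
  rfl

lemma isSmoothFieldOn_fieldOfCoordinates (he : IsSmoothCoordinates I e) {W : Set G} (hW
    : W ⊆ e.target) {Y : G → G}
    (hY : ContDiffOn ℝ ∞ Y W) :
    IsSmoothFieldOn I (e.source ∩ e ⁻¹' W) (fieldOfCoordinates I e Y) := by
  have h0 : ContMDiffOn 𝓘(ℝ, G) 𝓘(ℝ, G).tangent ∞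
      (fun z => (⟨z, Y z⟩ : TangentBundle 𝓘(ℝ, G) G)) W := fun z hz =>
    contMDiffWithinAt_vectorSpace_iff_contDiffWithinAt.2 (hY z hz)
  have h1 := h0.comp (he.contMDiffOn.mono (Set.inter_subset_left (t := e ⁻¹' W)))
    Set.inter_subset_right
  have h2 := (he.contMDiffOn_symm.contMDiffOn_tangentMapWithin (m := ∞) (by simp)
    e.open_target.uniqueMDiffOn).comp h1 (fun p hp => hW hp.2)
  refine h2.congr fun p hp => ?_
  have h4 := mfderivWithin_of_isOpen (I := 𝓘(ℝ, G)) (I' := I) (f := e.symm) e.open_target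
    (e.map_source hp.1)
  have h5 : fieldOfCoordinates I e Y p =
      mfderivWithin 𝓘(ℝ, G) I e.symm e.target (e p) (Y (e p)) := by rw [h4]; rfl
  rw [h5]
  -- The equality `e.symm (e p) = p` is only propositional while the tangent space depends on the
  -- point, so it is generalized to a variable before substitution. The same device recurs below.
  have h6 : ∀ q, q = p → ∀ w : B, (⟨p, w⟩ : TangentBundle I N) = ⟨q, w⟩ := by
    rintro q rfl w
    rfl
  exact h6 _ (e.left_inv hp.1) _

/-- The coordinate expression of a field is its pullback by the inverse coordinates, and brackets
are natural under pullback. -/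
lemma mfderiv_mlieBracket
    (he : IsSmoothCoordinates I e) [IsManifold I ∞ N] [CompleteSpace B] [CompleteSpace G] {p : N}
    (hp : p ∈ e.source) {X Y : ∀ p : N, TangentSpace I p}
    (hX : MDifferentiableAt I I.tangent (fun q => (⟨q, X q⟩ : TangentBundle I N)) p)
    (hY : MDifferentiableAt I I.tangent (fun q => (⟨q, Y q⟩ : TangentBundle I N)) p) :
    mfderiv I 𝓘(ℝ, G) e p (VectorField.mlieBracket I X Y p) =
      VectorField.lieBracket ℝ (coordinateField I e X) (coordinateField I e Y) (e p) := by
  have hz := e.map_source hp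
  have hn (k : ℕ) : minSmoothness ℝ (k : ℕ∞) ≤ (∞ : WithTop ℕ∞) := by
    rw [minSmoothness_of_isRCLikeNormedField]
    exact_mod_cast le_top
  have : IsManifold I (minSmoothness ℝ 3) N := IsManifold.of_le (hn 3)
  rw [← e.left_inv hp] at hX hY
  have h1 := VectorField.mpullback_mlieBracket (n := ∞) hX hY (he.contMDiffAt_symm hz) (hn 2)
  rw [he.mpullback_symm hz, coordinateField, e.left_inv hp] at h1
  have h2 (X : ∀ p : N, TangentSpace I p) :
      VectorField.mpullback 𝓘(ℝ, G) I e.symm X =ᶠ[𝓝 (e p)] coordinateField I e X :=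
    Filter.eventuallyEq_of_mem (e.open_target.mem_nhds hz) fun z hz => he.mpullback_symm hz
  have h3 := VectorField.mlieBracketWithin_eq_lieBracketWithin (𝕜 := ℝ) (s := Set.univ)
    (V := coordinateField I e X) (W := coordinateField I e Y)
  rw [h1, (h2 X).mlieBracket_vectorField_eq (h2 Y)]
  exact congrFun (VectorField.mlieBracketWithin_univ.symm.trans
    (h3.trans VectorField.lieBracketWithin_univ)) (e p)

end IsSmoothCoordinates

end VectorFields

/-! ### Connections in local frames -/

section Bump

variable {V : Type*} [NormedAddCommGroup V] [NormedSpace ℝ V] [FiniteDimensional ℝ V]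
  {H : Type*} [TopologicalSpace H] {I : ModelWithCorners ℝ V H}
  {M : Type*} [TopologicalSpace M] [T2Space M] [ChartedSpace H M] [IsManifold I ∞ M]

variable (I) in
-- Torsion-freeness and preservation of Q are assumed for global fields and sections; such a cut-off
-- globalizes local ones without changing their germs at x.
lemma exists_contMDiff_eventually_eq_one {U : Set M} (hU : IsOpen U) {x : M} (hx : x ∈ U) :
    ∃ χ : M → ℝ, ContMDiff I 𝓘(ℝ, ℝ) ∞ χ ∧ (∀ᶠ y in 𝓝 x, χ y = 1) ∧ tsupport χ ⊆ U := by
  obtain ⟨f, -, hf⟩ := (SmoothBumpFunction.nhds_basis_tsupport (I := I) x).mem_iff.1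
    (hU.mem_nhds hx)
  exact ⟨f, f.contMDiff, f.eventuallyEq_one, hf⟩

end Bump

section Connection

set_option linter.unusedSectionVars false
set_option maxSynthPendingDepth 3
set_option synthInstance.maxHeartbeats 200000

variable {V : Type*} [NormedAddCommGroup V] [NormedSpace ℝ V]
  {M : Type*} [TopologicalSpace M] [ChartedSpace V M]
  {F : Type*} [NormedAddCommGroup F] [NormedSpace ℝ F] [FiniteDimensional ℝ F]
  {E : M → Type*} [TopologicalSpace (TotalSpace F E)]
  [∀ x, AddCommGroup (E x)] [∀ x, Module ℝ (E x)] [∀ x, TopologicalSpace (E x)]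
  [∀ x, IsTopologicalAddGroup (E x)] [∀ x, ContinuousSMul ℝ (E x)]
  [FiberBundle F E] [VectorBundle ℝ F E]

lemma CovariantDerivative.sum_section (D : CovariantDerivative 𝓘(ℝ, V) F E) {ι : Type*}
    (s : Finset ι) {t : ι → ∀ x, E x} {x : M}
    (ht : ∀ i ∈ s, MDifferentiableAt 𝓘(ℝ, V) (𝓘(ℝ, V).prod 𝓘(ℝ, F))
      (fun y => (⟨y, t i y⟩ : TotalSpace F E)) x) :
    D (fun y => ∑ i ∈ s, t i y) x = ∑ i ∈ s, D (t i) x := by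
  classical
  induction s using Finset.induction_on with
  | empty =>
    simp only [Finset.sum_empty]
    exact congrFun D.zero x
  | insert i s hi h =>
    rw [Finset.sum_insert hi, ← h fun j hj => ht j (Finset.mem_insert_of_mem hj),
      ← D.isCovariantDerivativeOnUniv.add (ht i (Finset.mem_insert_self i s))
        (.sum_section fun j hj => ht j (Finset.mem_insert_of_mem hj))]
    congr 1
    funext y
    simp [Finset.sum_insert hi]

namespace LinearFrame

variable (L : LinearFrame V F E) (D : CovariantDerivative 𝓘(ℝ, V) F E)

/-- The chart of the base of a local frame. -/
noncomputable def chart : OpenPartialHomeomorph M V := chartAt V L.base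

/-- The derivative of the chart of the base. -/
noncomputable def chartDeriv (x : M) : TangentSpace 𝓘(ℝ, V) x →L[ℝ] V :=
  mfderiv 𝓘(ℝ, V) 𝓘(ℝ, V) L.chart x

/-- The derivative of the inverse of the chart of the base. -/
noncomputable def chartDerivSymm (y : V) : V →L[ℝ] TangentSpace 𝓘(ℝ, V) (L.chart.symm y) :=
  mfderiv 𝓘(ℝ, V) 𝓘(ℝ, V) L.chart.symm y

/-- The connection form with respect to a local frame, in the coordinates of the base. -/
noncomputable def connectionForm (y : V) : V →L[ℝ] F →L[ℝ] F :=
  ∑ i, (ContinuousLinearMap.smulRightL ℝ F F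
      (LinearMap.toContinuousLinearMap ((Module.finBasis ℝ F).coord i))).comp
    ((L.coord (L.chart.symm y)).comp
      ((D (fun x => L.vec x (Module.finBasis ℝ F i)) (L.chart.symm y)).comp
        (L.chartDerivSymm y)))

lemma connectionForm_apply (y v : V) (f : F) : L.connectionForm D y v f =
    ∑ i, (Module.finBasis ℝ F).coord i f • L.coord (L.chart.symm y)
      (D (fun x => L.vec x (Module.finBasis ℝ F i)) (L.chart.symm y)
        (L.chartDerivSymm y v)) := by
  simp only [connectionForm, sum_apply]
  rfl

lemma isSmoothCoordinates_chart [IsManifold 𝓘(ℝ, V) ∞ M] :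
    IsSmoothCoordinates 𝓘(ℝ, V) L.chart :=
  ⟨contMDiffOn_chart, contMDiffOn_chart_symm⟩

lemma chartDerivSymm_chartDeriv [IsManifold 𝓘(ℝ, V) ∞ M] {x : M} (hx : x ∈ L.chart.source)
    (X : TangentSpace 𝓘(ℝ, V) x) :
    (L.chartDerivSymm (L.chart x) (L.chartDeriv x X) : V) = X :=
  L.isSmoothCoordinates_chart.mfderiv_symm_mfderiv hx X

lemma chartDeriv_chartDerivSymm [IsManifold 𝓘(ℝ, V) ∞ M] {y : V} (hy : y ∈ L.chart.target)
    (v : V) : L.chartDeriv (L.chart.symm y) (L.chartDerivSymm y v) = v :=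
  L.isSmoothCoordinates_chart.mfderiv_mfderiv_symm hy v

lemma connectionForm_chart [IsManifold 𝓘(ℝ, V) ∞ M] {x : M} (hx : x ∈ L.chart.source)
    (X : TangentSpace 𝓘(ℝ, V) x) (f : F) :
    L.connectionForm D (L.chart x) (L.chartDeriv x X) f =
      ∑ i, (Module.finBasis ℝ F).coord i f •
        L.coord x (D (fun x => L.vec x (Module.finBasis ℝ F i)) x X) := by
  rw [L.connectionForm_apply]
  refine Finset.sum_congr rfl fun i _ => ?_
  have h1 : ∀ (t : ∀ y, E y) (x' : M) (w : TangentSpace 𝓘(ℝ, V) x'), x' = x → (w : V) = X →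
      L.coord x' (D t x' w) = L.coord x (D t x X) := by
    rintro t x' w rfl h
    exact congrArg (fun w => L.coord x' (D t x' w)) h
  rw [h1 _ _ _ (L.chart.left_inv hx) (L.chartDerivSymm_chartDeriv hx X)]

variable [ContMDiffVectorBundle ∞ F E 𝓘(ℝ, V)]

lemma contMDiffAt_vec {x : M} (hx : x ∈ L.source) {f : M → F}
    (hf : ContMDiffAt 𝓘(ℝ, V) 𝓘(ℝ, F) ∞ f x) :
    ContMDiffAt 𝓘(ℝ, V) (𝓘(ℝ, V).prod 𝓘(ℝ, F)) ∞
      (fun y => (⟨y, L.vec y (f y)⟩ : TotalSpace F E)) x := by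
  refine (L.contMDiffAt_iff hx).2 ⟨contMDiffAt_id, hf.congr_of_eventuallyEq ?_⟩
  filter_upwards [L.isOpen_source.mem_nhds hx] with y hy using L.coord_vec hy (f y)

/-- Near x the section is a combination of the frame fields with its coordinates as coefficients.
The Leibniz rule gives the derivative of the coordinates plus the connection form. -/
lemma coord_covariantDerivative [IsManifold 𝓘(ℝ, V) ∞ M] {x : M} (hx : x ∈ L.source)
    (hxc : x ∈ L.chart.source) {e : ∀ y, E y}
    (he : ContMDiffAt 𝓘(ℝ, V) (𝓘(ℝ, V).prod 𝓘(ℝ, F)) ∞ (fun y => (⟨y, e y⟩ : TotalSpace F E)) x)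
    (X : TangentSpace 𝓘(ℝ, V) x) :
    L.coord x (D e x X) = mvfderiv 𝓘(ℝ, V) (fun y => L.coord y (e y)) x X +
      L.connectionForm D (L.chart x) (L.chartDeriv x X) (L.coord x (e x)) := by
  set b := Module.finBasis ℝ F
  have hc := ((L.contMDiffAt_iff hx).1 he).2
  have ha (i) : ContMDiffAt 𝓘(ℝ, V) 𝓘(ℝ, ℝ) ∞ (fun y => b.coord i (L.coord y (e y))) x :=
    (LinearMap.toContinuousLinearMap (b.coord i)).contDiff.contMDiff.contMDiffAt.comp x hc
  have hv (i) := L.contMDiffAt_vec hx (contMDiffAt_const (c := b i))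
  have hsum : ∀ᶠ y in 𝓝 x, e y =
      ∑ i, ((fun y => b.coord i (L.coord y (e y))) • fun y => L.vec y (b i)) y := by
    filter_upwards [L.isOpen_source.mem_nhds hx] with y hy
    conv_lhs => rw [← L.vec_coord hy (e y), ← b.sum_repr (L.coord y (e y)), map_sum]
    simp
  have hs (i) := ((ha i).smul_section (hv i)).mdifferentiableAt (by simp)
  have h1 := D.isCovariantDerivativeOnUniv.congr_of_eventuallyEq
    (he.mdifferentiableAt (by simp)) (.sum_section fun i _ => hs i) Filter.univ_mem hsum
  have h2 := D.sum_section Finset.univ fun i _ => hs i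
  have h3 : D e x = ∑ i, (b.coord i (L.coord x (e x)) • D (fun y => L.vec y (b i)) x +
      (mvfderiv 𝓘(ℝ, V) (fun y => b.coord i (L.coord y (e y))) x).smulRight (L.vec x (b i))) := by
    refine h1.trans (h2.trans (Finset.sum_congr rfl fun i _ => ?_))
    exact D.isCovariantDerivativeOnUniv.leibniz ((hv i).mdifferentiableAt (by simp))
      ((ha i).mdifferentiableAt (by simp))
  have h4 (i) : mvfderiv 𝓘(ℝ, V) (fun y => b.coord i (L.coord y (e y))) x X =
      b.coord i (mvfderiv 𝓘(ℝ, V) (fun y => L.coord y (e y)) x X) :=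
    congrArg (fun T => T X) (((LinearMap.toContinuousLinearMap (b.coord i)).hasMFDerivAt.comp x
      (hc.mdifferentiableAt (by simp)).hasMFDerivAt).mfderiv)
  rw [h3, L.connectionForm_chart D hxc]
  simp only [sum_apply, add_apply, smul_apply,
    ContinuousLinearMap.smulRight_apply, map_sum, map_add, map_smul, h4, L.coord_vec hx,
    Finset.sum_add_distrib]
  rw [add_comm]
  congr 1
  exact b.sum_repr _

end LinearFrame

end Connection

section ConnectionCalculus

set_option linter.unusedSectionVars false
set_option maxSynthPendingDepth 3
set_option synthInstance.maxHeartbeats 200000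

variable {V : Type*} [NormedAddCommGroup V] [NormedSpace ℝ V]
  {M : Type*} [TopologicalSpace M] [ChartedSpace V M] [IsManifold 𝓘(ℝ, V) ∞ M]
  {F : Type*} [NormedAddCommGroup F] [NormedSpace ℝ F] [FiniteDimensional ℝ F]
  {E : M → Type*} [TopologicalSpace (TotalSpace F E)]
  [∀ x, AddCommGroup (E x)] [∀ x, Module ℝ (E x)] [∀ x, TopologicalSpace (E x)]
  [∀ x, IsTopologicalAddGroup (E x)] [∀ x, ContinuousSMul ℝ (E x)]
  [FiberBundle F E] [VectorBundle ℝ F E] [ContMDiffVectorBundle ∞ F E 𝓘(ℝ, V)]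

lemma mvfderiv_clm_apply {G : Type*} [NormedAddCommGroup G] [NormedSpace ℝ G]
    {m : M → F →L[ℝ] G} {f : M → F} {x : M}
    (hm : MDifferentiableAt 𝓘(ℝ, V) 𝓘(ℝ, F →L[ℝ] G) m x)
    (hf : MDifferentiableAt 𝓘(ℝ, V) 𝓘(ℝ, F) f x) (X : TangentSpace 𝓘(ℝ, V) x) :
    mvfderiv 𝓘(ℝ, V) (fun q => m q (f q)) x X =
      mvfderiv 𝓘(ℝ, V) m x X (f x) + m x (mvfderiv 𝓘(ℝ, V) f x X) := by
  have h1 := HasFDerivWithinAt.clm_apply hm.hasMFDerivAt.2 hf.hasMFDerivAt.2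
  have h2 : HasMFDerivAt 𝓘(ℝ, V) 𝓘(ℝ, G) (fun q => m q (f q)) x _ :=
    ⟨hm.continuousAt.clm_apply hf.continuousAt, h1⟩
  have h3 := congrArg (fun T => T X) h2.mfderiv
  refine h3.trans ((add_comm _ _).trans ?_)
  have h4 := extChartAt_to_inv (I := 𝓘(ℝ, V)) x
  have h5 : ∀ y, y = x → mvfderiv 𝓘(ℝ, V) m x X (f y) + m y (mvfderiv 𝓘(ℝ, V) f x X) =
      mvfderiv 𝓘(ℝ, V) m x X (f x) + m x (mvfderiv 𝓘(ℝ, V) f x X) := by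
    rintro y rfl
    rfl
  exact h5 _ h4

lemma mvfderiv_congr_of_eventuallyEq {G : Type*} [NormedAddCommGroup G] [NormedSpace ℝ G]
    {f g : M → G} {x : M} (h : f =ᶠ[𝓝 x] g) (X : TangentSpace 𝓘(ℝ, V) x) :
    mvfderiv 𝓘(ℝ, V) f x X = mvfderiv 𝓘(ℝ, V) g x X := by
  have h1 : mfderiv 𝓘(ℝ, V) 𝓘(ℝ, G) f x = mfderiv 𝓘(ℝ, V) 𝓘(ℝ, G) g x := h.mfderiv_eq
  exact congrArg (fun T : V →L[ℝ] G => T X) h1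

lemma mvfderiv_eq_zero_of_eventually_eq {G : Type*} [NormedAddCommGroup G] [NormedSpace ℝ G]
    {f : M → G} {x : M} {c : G} (h : ∀ᶠ q in 𝓝 x, f q = c) (X : TangentSpace 𝓘(ℝ, V) x) :
    mvfderiv 𝓘(ℝ, V) f x X = 0 := by
  rw [mvfderiv_congr_of_eventuallyEq (g := fun _ => c) h, mvfderiv_const]
  rfl

namespace LinearFrame

variable (L : LinearFrame V F E) (D : CovariantDerivative 𝓘(ℝ, V) F E)

lemma mvfderiv_comp_chart {G : Type*} [NormedAddCommGroup G] [NormedSpace ℝ G] {g : V → G} {x : M}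
    (hx : x ∈ L.chart.source) (hg : DifferentiableAt ℝ g (L.chart x))
    (X : TangentSpace 𝓘(ℝ, V) x) :
    mvfderiv 𝓘(ℝ, V) (fun q => g (L.chart q)) x X =
      fderiv ℝ g (L.chart x) (L.chartDeriv x X) := by
  have h1 := hg.hasFDerivAt.hasMFDerivAt.comp x
    ((L.isSmoothCoordinates_chart.contMDiffAt hx).mdifferentiableAt (by simp)).hasMFDerivAt
  exact congrArg (fun T => T X) h1.mfderiv

/-- The coordinate expression of the connection induced on the bundle of endomorphisms. -/
lemma coord_covariantDerivative_end {x : M} (hx : x ∈ L.source)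
    (hxc : x ∈ L.chart.source) {s : ∀ y, E y →L[ℝ] E y} {e : ∀ y, E y}
    (hs : ContMDiffAt 𝓘(ℝ, V) (endModel 𝓘(ℝ, V) F) ∞ (fun y => (⟨y, s y⟩ : EndTotal F E)) x)
    (he : ContMDiffAt 𝓘(ℝ, V) (𝓘(ℝ, V).prod 𝓘(ℝ, F)) ∞ (fun y => (⟨y, e y⟩ : TotalSpace F E)) x)
    (X : TangentSpace 𝓘(ℝ, V) x) :
    L.coord x (D (fun y => s y (e y)) x X - s x (D e x X)) =
      (mvfderiv 𝓘(ℝ, V) (fun y => L.matrix y (s y)) x X +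
        (L.connectionForm D (L.chart x) (L.chartDeriv x X) * L.matrix x (s x) -
          L.matrix x (s x) * L.connectionForm D (L.chart x) (L.chartDeriv x X)))
      (L.coord x (e x)) := by
  have h1 := hs.clm_bundle_apply he
  have h2 := L.coord_covariantDerivative D hx hxc h1 X
  have h3 := L.coord_covariantDerivative D hx hxc he X
  have hm := ((L.contMDiffAt_end_iff hx).1 hs).2.mdifferentiableAt (by simp)
  have hc := ((L.contMDiffAt_iff hx).1 he).2.mdifferentiableAt (by simp)
  have h4 : (fun y => L.coord y (s y (e y))) =ᶠ[𝓝 x] fun y => L.matrix y (s y) (L.coord y (e y)) := by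
    filter_upwards [L.isOpen_source.mem_nhds hx] with y hy using L.coord_apply hy _ _
  have h5 : mvfderiv 𝓘(ℝ, V) (fun y => L.coord y (s y (e y))) x X =
      mvfderiv 𝓘(ℝ, V) (fun y => L.matrix y (s y)) x X (L.coord x (e x)) +
        L.matrix x (s x) (mvfderiv 𝓘(ℝ, V) (fun y => L.coord y (e y)) x X) :=
    (mvfderiv_congr_of_eventuallyEq h4 X).trans (mvfderiv_clm_apply hm hc X)
  rw [map_sub, h2, L.coord_apply hx (s x) (D e x X), h3, h5, L.coord_apply hx (s x) (e x)]
  simp only [map_add, add_apply, sub_apply, mul_apply_eq_comp]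
  abel

variable [T2Space M] [FiniteDimensional ℝ V]

lemma exists_section {x : M} (hx : x ∈ L.source) (f : F) :
    ∃ e : ∀ y, E y, IsSmoothSection 𝓘(ℝ, V) F E e ∧ ∀ᶠ y in 𝓝 x, e y = L.vec y f := by
  obtain ⟨χ, hχ, h1, ht⟩ := exists_contMDiff_eventually_eq_one 𝓘(ℝ, V) L.isOpen_source hx
  refine ⟨χ • fun y => L.vec y f, hχ.contMDiffOn.smul_section_of_tsupport L.isOpen_source ht
    fun y hy => (L.contMDiffAt_vec hy contMDiffAt_const).contMDiffWithinAt, ?_⟩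
  filter_upwards [h1] with y hy
  simp [hy]

lemma contMDiffAt_endo {x : M} (hx : x ∈ L.source) {u : M → F →L[ℝ] F}
    (hu : ContMDiffAt 𝓘(ℝ, V) 𝓘(ℝ, F →L[ℝ] F) ∞ u x) :
    ContMDiffAt 𝓘(ℝ, V) (endModel 𝓘(ℝ, V) F) ∞
      (fun y => (⟨y, L.endo y (u y)⟩ : EndTotal F E)) x := by
  refine (L.contMDiffAt_end_iff hx).2 ⟨contMDiffAt_id, hu.congr_of_eventuallyEq ?_⟩
  filter_upwards [L.isOpen_source.mem_nhds hx] with y hy using L.matrix_endo hy (u y)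

/-- The last two conclusions ensure that the cut-off of a local section of Q is everywhere a section
of Q. -/
lemma exists_end_section {U : Set M} (hU : IsOpen U) (hUL : U ⊆ L.source) {x : M} (hx : x ∈ U)
    {u : M → F →L[ℝ] F} (hu : ContMDiffOn 𝓘(ℝ, V) 𝓘(ℝ, F →L[ℝ] F) ∞ u U) :
    ∃ s : ∀ y, E y →L[ℝ] E y, IsSmoothEndSection 𝓘(ℝ, V) F E s ∧
      (∀ᶠ y in 𝓝 x, s y = L.endo y (u y)) ∧ (∀ y, ∃ c : ℝ, s y = c • L.endo y (u y)) ∧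
      ∀ y ∉ U, s y = 0 := by
  obtain ⟨χ, hχ, h1, ht⟩ := exists_contMDiff_eventually_eq_one 𝓘(ℝ, V) hU hx
  refine ⟨χ • fun y => L.endo y (u y), hχ.contMDiffOn.smul_section_of_tsupport hU ht
    fun y hy => (L.contMDiffAt_endo (hUL hy) (hu.contMDiffAt (hU.mem_nhds hy))).contMDiffWithinAt,
    ?_, fun y => ⟨χ y, rfl⟩, fun y hy => ?_⟩
  · filter_upwards [h1] with y hy
    simp [hy]
  · have : χ y = 0 := image_eq_zero_of_notMem_tsupport fun h => hy (ht h)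
    simp [this]

lemma contMDiffAt_chartDerivSymm {y : V} (hy : y ∈ L.chart.target) (v : V) :
    ContMDiffAt 𝓘(ℝ, V) 𝓘(ℝ, V).tangent ∞
      (fun y => (⟨L.chart.symm y, L.chartDerivSymm y v⟩ : TangentBundle 𝓘(ℝ, V) M)) y := by
  have h0 : ContMDiffOn 𝓘(ℝ, V) 𝓘(ℝ, V).tangent ∞
      (fun z => (⟨z, v⟩ : TangentBundle 𝓘(ℝ, V) V)) L.chart.target := fun z hz =>
    contMDiffWithinAt_vectorSpace_iff_contDiffWithinAt.2 contDiffWithinAt_const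
  have h1 := (L.isSmoothCoordinates_chart.contMDiffOn_symm.contMDiffOn_tangentMapWithin (m := ∞)
    (by simp) L.chart.open_target.uniqueMDiffOn).comp h0 (fun p hp => hp)
  refine (h1.contMDiffAt (L.chart.open_target.mem_nhds hy)).congr_of_eventuallyEq ?_
  filter_upwards [L.chart.open_target.mem_nhds hy] with z hz
  have h4 := mfderivWithin_of_isOpen (I := 𝓘(ℝ, V)) (I' := 𝓘(ℝ, V)) (f := L.chart.symm)
    L.chart.open_target hz
  have h5 : L.chartDerivSymm z v =
      mfderivWithin 𝓘(ℝ, V) 𝓘(ℝ, V) L.chart.symm L.chart.target z v := by rw [h4]; rfl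
  rw [h5]
  rfl

/-- The domain of the coordinates of the base. -/
def domain : Set V := L.chart.target ∩ L.chart.symm ⁻¹' L.source

lemma isOpen_domain : IsOpen L.domain :=
  L.chart.isOpen_inter_preimage_symm L.isOpen_source

/-- Smoothness of the connection is applied to cut-off frame fields, which have the same covariant
derivatives near the given point because D is local. -/
lemma contDiffOn_connectionForm (hD : D.ContMDiffCovariantDerivative ∞) :
    ContDiffOn ℝ ∞ (L.connectionForm D) L.domain := by
  unfold connectionForm
  refine ContDiffOn.sum fun i _ => contDiffOn_const.clm_comp (contDiffOn_clm_apply.2 fun v => ?_)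
  intro y hy
  obtain ⟨e, he, hee⟩ := L.exists_section hy.2 (Module.finBasis ℝ F i)
  have h1 : ContMDiffAt 𝓘(ℝ, V) (𝓘(ℝ, V).prod 𝓘(ℝ, V →L[ℝ] F)) ∞
      (fun x => (⟨x, D e x⟩ : TotalSpace (V →L[ℝ] F)
        fun x => TangentSpace 𝓘(ℝ, V) x →L[ℝ] E x)) (L.chart.symm y) :=
    (hD.contMDiff.contMDiff (σ := e) (by simpa using he.contMDiffOn)).contMDiffAt Filter.univ_mem
  have h2 := L.isSmoothCoordinates_chart.contMDiffAt_symm hy.1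
  have h3 := (h1.comp y h2).clm_bundle_apply (L.contMDiffAt_chartDerivSymm hy.1 v)
  have h4 := ((L.contMDiffAt_iff (p := y)
    (f := fun z => ⟨L.chart.symm z, D e (L.chart.symm z) (L.chartDerivSymm z v)⟩) hy.2).1 h3).2
  refine (h4.contDiffAt.congr_of_eventuallyEq ?_).contDiffWithinAt
  have h5 : ∀ᶠ z in 𝓝 y, D e (L.chart.symm z) =
      D (fun x => L.vec x (Module.finBasis ℝ F i)) (L.chart.symm z) := by
    have h6 : ∀ᶠ q in 𝓝 (L.chart.symm y), q ∈ L.source ∧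
        ∀ᶠ x in 𝓝 q, e x = L.vec x (Module.finBasis ℝ F i) :=
      
      (L.isOpen_source.eventually_mem hy.2).and hee.eventually_nhds
    filter_upwards [h2.continuousAt.eventually h6] with z hz
    exact D.isCovariantDerivativeOnUniv.congr_of_eventuallyEq
      (he.contMDiffAt.mdifferentiableAt (by simp))
      ((L.contMDiffAt_vec hz.1 contMDiffAt_const).mdifferentiableAt (by simp))
      Filter.univ_mem hz.2
  filter_upwards [h5] with z hz
  exact (congrArg (fun T : TangentSpace 𝓘(ℝ, V) (L.chart.symm z) →L[ℝ] E (L.chart.symm z) =>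
    L.coord (L.chart.symm z) (T (L.chartDerivSymm z v))) hz).symm

end LinearFrame

end ConnectionCalculus

/-! ### Coordinate expression of the quaternionic structure and connection -/

section QuaternionicCoordinates

set_option linter.unusedSectionVars false
set_option maxSynthPendingDepth 3
set_option synthInstance.maxHeartbeats 200000

variable {V : Type*} [NormedAddCommGroup V] [NormedSpace ℝ V] [FiniteDimensional ℝ V]
  {M : Type*} [TopologicalSpace M] [T2Space M] [ChartedSpace V M] [IsManifold 𝓘(ℝ, V) ∞ M]
  {F : Type*} [NormedAddCommGroup F] [NormedSpace ℝ F] [FiniteDimensional ℝ F]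
  {E : M → Type*} [TopologicalSpace (TotalSpace F E)]
  [∀ x, AddCommGroup (E x)] [∀ x, Module ℝ (E x)] [∀ x, TopologicalSpace (E x)]
  [∀ x, IsTopologicalAddGroup (E x)] [∀ x, ContinuousSMul ℝ (E x)]
  [FiberBundle F E] [VectorBundle ℝ F E] [ContMDiffVectorBundle ∞ F E 𝓘(ℝ, V)]
  {A : M → Type*} [∀ x, Ring (A x)] [∀ x, Algebra ℝ (A x)]
  [TopologicalSpace (TotalSpace ℍ[ℝ] A)] [∀ x, TopologicalSpace (A x)]
  [FiberBundle ℍ[ℝ] A] [VectorBundle ℝ ℍ[ℝ] A]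
  {ρ : ∀ x, A x →ₐ[ℝ] (E x →L[ℝ] E x)}

namespace LinearFrame

variable (L : LinearFrame V F E) (D : CovariantDerivative 𝓘(ℝ, V) F E)
  (ι : ∀ x, TangentSpace 𝓘(ℝ, V) x →ₗ[ℝ] E x)

/-- The coordinate expression of a morphism `TM → E`. -/
noncomputable def inclusionForm (y : V) : V →L[ℝ] F :=
  LinearMap.toContinuousLinearMap ((L.coord (L.chart.symm y)).toLinearMap ∘ₗ
    ι (L.chart.symm y) ∘ₗ (L.chartDerivSymm y).toLinearMap)

lemma inclusionForm_apply (y v : V) : L.inclusionForm ι y v =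
    L.coord (L.chart.symm y) (ι (L.chart.symm y) (L.chartDerivSymm y v)) := rfl

lemma inclusionForm_chart {x : M} (hx : x ∈ L.chart.source) (X : TangentSpace 𝓘(ℝ, V) x) :
    L.inclusionForm ι (L.chart x) (L.chartDeriv x X) = L.coord x (ι x X) := by
  rw [inclusionForm_apply]
  have h1 : ∀ (x' : M) (w : TangentSpace 𝓘(ℝ, V) x'), x' = x → (w : V) = X →
      L.coord x' (ι x' w) = L.coord x (ι x X) := by
    rintro x' w rfl h
    exact congrArg (fun w => L.coord x' (ι x' w)) h
  exact h1 _ _ (L.chart.left_inv hx) (L.chartDerivSymm_chartDeriv hx X)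

lemma contDiffOn_inclusionForm
    (hι : ContMDiff 𝓘(ℝ, V).tangent (𝓘(ℝ, V).prod 𝓘(ℝ, F)) ∞
      (fun v : TangentBundle 𝓘(ℝ, V) M => (⟨v.1, ι v.1 v.2⟩ : TotalSpace F E))) :
    ContDiffOn ℝ ∞ (L.inclusionForm ι) L.domain := by
  refine contDiffOn_clm_apply.2 fun v y hy => ?_
  have h1 := hι.contMDiffAt.comp y (L.contMDiffAt_chartDerivSymm hy.1 v)
  exact ((L.contMDiffAt_iff (p := y)
    (f := fun z => ⟨L.chart.symm z, ι _ (L.chartDerivSymm z v)⟩)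
    hy.2).1 h1).2.contDiffAt.contDiffWithinAt

lemma exists_constant_field {x : M} (hx : x ∈ L.chart.source) (v : V) :
    ∃ X : ∀ q : M, TangentSpace 𝓘(ℝ, V) q, IsSmoothFieldOn 𝓘(ℝ, V) Set.univ X ∧
      ∀ᶠ q in 𝓝 x, L.chartDeriv q (X q) = v := by
  obtain ⟨χ, hχ, h1, ht⟩ := exists_contMDiff_eventually_eq_one 𝓘(ℝ, V) L.chart.open_source hx
  let Y : ∀ q : M, TangentSpace 𝓘(ℝ, V) q := fieldOfCoordinates 𝓘(ℝ, V) L.chart fun _ => v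
  have hY : IsSmoothFieldOn 𝓘(ℝ, V) L.chart.source Y := by
    have := L.isSmoothCoordinates_chart.isSmoothFieldOn_fieldOfCoordinates subset_rfl
      (contDiffOn_const (c := v))
    exact ContMDiffOn.mono this fun q hq => ⟨hq, L.chart.map_source hq⟩
  refine ⟨χ • Y, (hχ.contMDiffOn.smul_section_of_tsupport L.chart.open_source ht
    hY).contMDiffOn, ?_⟩
  filter_upwards [h1, L.chart.open_source.mem_nhds hx] with q hq hqs
  have h2 : (χ • Y) q = Y q := by
    change χ q • Y q = Y q
    rw [hq, one_smul]
  rw [h2]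
  have h3 := L.isSmoothCoordinates_chart.coordinateField_fieldOfCoordinates (Y := fun _ => v)
    (L.chart.map_source hqs)
  rw [coordinateField, L.chart.left_inv hqs] at h3
  exact h3

/-- The torsion is evaluated on fields that are constant in the chart near the point, so that their
bracket vanishes there. -/
lemma torsion_coordinates (hι : ContMDiff 𝓘(ℝ, V).tangent (𝓘(ℝ, V).prod 𝓘(ℝ, F)) ∞
      (fun v : TangentBundle 𝓘(ℝ, V) M => (⟨v.1, ι v.1 v.2⟩ : TotalSpace F E)))
    (hT : IsTorsionFree ι D) {y : V} (hy : y ∈ L.domain) (v w : V) :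
    fderiv ℝ (L.inclusionForm ι) y v w - fderiv ℝ (L.inclusionForm ι) y w v +
      L.connectionForm D y v (L.inclusionForm ι y w) -
        L.connectionForm D y w (L.inclusionForm ι y v) = 0 := by
  obtain ⟨x, hxc, rfl⟩ : ∃ x ∈ L.chart.source, L.chart x = y :=
    ⟨_, L.chart.map_target hy.1, L.chart.right_inv hy.1⟩
  have hx : x ∈ L.source := by simpa [L.chart.left_inv hxc] using hy.2
  obtain ⟨X, hX, hXv⟩ := L.exists_constant_field hxc v
  obtain ⟨Y, hY, hYw⟩ := L.exists_constant_field hxc w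
  have hd : DifferentiableAt ℝ (L.inclusionForm ι) (L.chart x) :=
    ((L.contDiffOn_inclusionForm ι hι).contDiffAt
      (L.isOpen_domain.mem_nhds hy)).differentiableAt (by simp)
  have hform : ∀ (Y : ∀ q : M, TangentSpace 𝓘(ℝ, V) q) (w : V),
      IsSmoothFieldOn 𝓘(ℝ, V) Set.univ Y → (∀ᶠ q in 𝓝 x, L.chartDeriv q (Y q) = w) →
      ∀ X : TangentSpace 𝓘(ℝ, V) x, L.coord x (D (fun q => ι q (Y q)) x X) =
        fderiv ℝ (L.inclusionForm ι) (L.chart x) (L.chartDeriv x X) w +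
        L.connectionForm D (L.chart x) (L.chartDeriv x X) (L.inclusionForm ι (L.chart x) w) := by
    intro Y w hY hYw X
    have h1 : ContMDiffAt 𝓘(ℝ, V) (𝓘(ℝ, V).prod 𝓘(ℝ, F)) ∞
        (fun q => (⟨q, ι q (Y q)⟩ : TotalSpace F E)) x :=
      hι.contMDiffAt.comp x (hY.contMDiffAt Filter.univ_mem)
    have h2 : (fun q => L.coord q (ι q (Y q))) =ᶠ[𝓝 x]
        fun q => (fun z => L.inclusionForm ι z w) (L.chart q) := by
      filter_upwards [hYw, L.chart.open_source.mem_nhds hxc] with q hq hqc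
      rw [← hq]
      exact (L.inclusionForm_chart ι hqc (Y q)).symm
    have h3 : DifferentiableAt ℝ (fun z => L.inclusionForm ι z w) (L.chart x) :=
      hd.clm_apply (differentiableAt_const w)
    rw [L.coord_covariantDerivative D hx hxc h1 X, mvfderiv_congr_of_eventuallyEq h2,
      L.mvfderiv_comp_chart hxc h3, fderiv_clm_apply_const hd,
      ← L.inclusionForm_chart ι hxc (Y x), hYw.self_of_nhds]
  have hbr : VectorField.mlieBracket 𝓘(ℝ, V) X Y x = 0 := by
    apply L.isSmoothCoordinates_chart.mfderiv_injective hxc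
    have hc : ∀ (X : ∀ q : M, TangentSpace 𝓘(ℝ, V) q) (v : V),
        (∀ᶠ q in 𝓝 x, L.chartDeriv q (X q) = v) →
        coordinateField 𝓘(ℝ, V) L.chart X =ᶠ[𝓝 (L.chart x)] fun _ => v := by
      intro X v hX
      have h4 : Filter.Tendsto L.chart.symm (𝓝 (L.chart x)) (𝓝 x) := by
        have := L.chart.continuousAt_symm (L.chart.map_source hxc)
        rwa [ContinuousAt, L.chart.left_inv hxc] at this
      filter_upwards [h4.eventually hX] with z hz using hz
    have h5 := (hc X v hXv).lieBracket_vectorField_eq (𝕜 := ℝ) (hc Y w hYw)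
    rw [L.isSmoothCoordinates_chart.mfderiv_mlieBracket hxc
      ((hX.contMDiffAt Filter.univ_mem).mdifferentiableAt (by simp))
      ((hY.contMDiffAt Filter.univ_mem).mdifferentiableAt (by simp)), map_zero]
    refine h5.trans ?_
    simp [VectorField.lieBracket]
    rfl
  have h6 := congrArg (L.coord x) (hT X Y hX hY x)
  rw [hbr, map_zero, sub_zero, map_sub, hform Y w hY hYw, hform X v hX hXv, map_zero,
    hXv.self_of_nhds, hYw.self_of_nhds] at h6
  rw [← h6]
  abel

end LinearFrame

namespace AdaptedFrame

variable (L : AdaptedFrame V F ρ)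

lemma source_subset_chart_source : L.source ⊆ L.chart.source := L.source_subset_chart

/-- The imaginary part is defined from the algebra alone, so any algebra isomorphism between ℍ and A
x preserves it. -/
lemma matrix_mem_imaginaryImage {x : M} (hx : x ∈ L.source) {T : E x →L[ℝ] E x} :
    L.matrix x T ∈ imaginaryImage L.rep ↔ T ∈ imaginaryBundle ρ x := by
  obtain ⟨φ, hφ⟩ := L.exists_algEquiv x hx
  rw [imaginaryBundle, ← map_quaternionImaginaryPart φ, mem_imaginaryImage]
  constructor
  · rintro ⟨b, hb, h⟩
    refine ⟨φ b, ⟨b, mem_quaternionImaginaryPart.2 hb, rfl⟩, ?_⟩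
    apply L.matrix_injective hx
    rw [← h, ← hφ]
    rfl
  · rintro ⟨-, ⟨b, hb, rfl⟩, rfl⟩
    exact ⟨b, mem_quaternionImaginaryPart.1 hb, (hφ b).symm⟩

lemma mem_sphereBundle {p : EndTotal F E} (hp : p.1 ∈ L.source) :
    p ∈ sphereBundle F ρ ↔ ∃ j, j * j = -1 ∧ L.rep j = L.matrix p.1 p.2 := by
  obtain ⟨φ, hφ⟩ := L.exists_algEquiv p.1 hp
  constructor
  · rintro ⟨a, ha, h⟩
    refine ⟨φ.symm a, by rw [← map_mul, ha, map_neg, map_one], ?_⟩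
    rw [← hφ, φ.apply_symm_apply, h]
  · rintro ⟨j, hj, h⟩
    refine ⟨φ j, by rw [← map_mul, hj, map_neg, map_one], ?_⟩
    apply L.matrix_injective hp
    rw [hφ, h]

lemma generic_coordinates {ι : ∀ x, TangentSpace 𝓘(ℝ, V) x →ₗ[ℝ] E x}
    (hι : IsAlmostCRQuaternionicStructure 𝓘(ℝ, V) F E ρ ι) {y : V} (hy : y ∈ L.domain) {j : ℍ[ℝ]}
    (hj : j * j = -1) :
    LinearMap.range (L.inclusionForm ι y : V →ₗ[ℝ] F) ⊔
      (LinearMap.range (L.inclusionForm ι y : V →ₗ[ℝ] F)).map (L.rep j : F →ₗ[ℝ] F) = ⊤ := by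
  obtain ⟨x, hxc, rfl⟩ : ∃ x ∈ L.chart.source, L.chart x = y :=
    ⟨_, L.chart.map_target hy.1, L.chart.right_inv hy.1⟩
  have hx : x ∈ L.source := by simpa [L.chart.left_inv hxc] using hy.2
  have hp : (⟨x, L.endo x (L.rep j)⟩ : EndTotal F E) ∈ sphereBundle F ρ :=
    (L.mem_sphereBundle hx).2 ⟨j, hj, (L.matrix_endo hx _).symm⟩
  have h1 := hι.generic _ hp
  rw [eq_top_iff]
  intro f _
  have h2 : L.vec x f ∈ LinearMap.range (ι x) ⊔ (LinearMap.range (ι x)).map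
      (L.endo x (L.rep j) : E x →ₗ[ℝ] E x) := by
    rw [h1]
    trivial
  obtain ⟨-, ⟨X, rfl⟩, -, ⟨-, ⟨Y, rfl⟩, rfl⟩, h3⟩ := Submodule.mem_sup.1 h2
  refine Submodule.mem_sup.2 ⟨_, ⟨L.chartDeriv x X, rfl⟩, _, ⟨_, ⟨L.chartDeriv x Y, rfl⟩, rfl⟩, ?_⟩
  have h4 := congrArg (L.coord x) h3
  rw [L.coord_vec hx, map_add] at h4
  have h5 : L.coord x (L.endo x (L.rep j) (ι x Y)) = L.rep j (L.coord x (ι x Y)) := by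
    rw [L.coord_apply hx, L.matrix_endo hx]
  have h6 (X) := L.inclusionForm_chart ι hxc X
  refine Eq.trans ?_ h4
  refine congrArg₂ (· + ·) (h6 X) (Eq.trans ?_ h5.symm)
  exact congrArg (L.rep j) (h6 Y)

/-- A section of Q with constant matrix u near x has covariant derivative with matrix [Γ(v), u],
where Γ is the connection form. -/
lemma preserves_coordinates {D : CovariantDerivative 𝓘(ℝ, V) F E}
    (hD : PreservesImaginaryBundle ρ D) {y : V} (hy : y ∈ L.domain) (v : V) {u : F →L[ℝ] F}
    (hu : u ∈ imaginaryImage L.rep) :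
    L.connectionForm D y v * u - u * L.connectionForm D y v ∈ imaginaryImage L.rep := by
  obtain ⟨x, hxc, rfl⟩ : ∃ x ∈ L.chart.source, L.chart x = y :=
    ⟨_, L.chart.map_target hy.1, L.chart.right_inv hy.1⟩
  have hx : x ∈ L.source := by simpa [L.chart.left_inv hxc] using hy.2
  obtain ⟨X, rfl⟩ : ∃ X : TangentSpace 𝓘(ℝ, V) x, L.chartDeriv x X = v := by
    have := L.chartDeriv_chartDerivSymm hy.1 v
    rw [L.chart.left_inv hxc] at this
    exact ⟨_, this⟩
  obtain ⟨s, hs, hsu, hs1, hs2⟩ := L.exists_end_section L.isOpen_source subset_rfl hx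
    (contMDiffOn_const (c := u))
  have hsQ : ∀ q, s q ∈ imaginaryBundle ρ q := by
    intro q
    by_cases hq : q ∈ L.source
    · obtain ⟨c, hc⟩ := hs1 q
      rw [hc]
      refine Submodule.smul_mem _ _ ((L.matrix_mem_imaginaryImage hq).1 ?_)
      rwa [L.matrix_endo hq]
    · rw [hs2 q hq]
      exact Submodule.zero_mem _
  obtain ⟨T, hT, hTe⟩ := hD s hs hsQ x X
  rw [← L.matrix_mem_imaginaryImage hx] at hT
  convert hT using 1
  ext f
  obtain ⟨e, he, hef⟩ := L.exists_section hx f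
  have h1 := congrArg (L.coord x) (hTe e he)
  have h2 : mvfderiv 𝓘(ℝ, V) (fun q => L.matrix q (s q)) x X = 0 := by
    refine mvfderiv_eq_zero_of_eventually_eq (c := u) ?_ X
    filter_upwards [hsu, L.isOpen_source.mem_nhds hx] with q hq hqs
    rw [hq, L.matrix_endo hqs]
  rw [L.coord_covariantDerivative_end D hx hxc hs.contMDiffAt he.contMDiffAt, h2, zero_add,
    hsu.self_of_nhds, L.matrix_endo hx, hef.self_of_nhds, L.coord_vec hx] at h1
  exact h1.symm

/-- The coordinate expression of an almost CR quaternionic structure with a quaternionic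
connection. -/
noncomputable def coordinates {ι : ∀ x, TangentSpace 𝓘(ℝ, V) x →ₗ[ℝ] E x}
    (L : AdaptedFrame V F ρ)
    (hι : IsAlmostCRQuaternionicStructure 𝓘(ℝ, V) F E ρ ι) {D : CovariantDerivative 𝓘(ℝ, V) F E}
    (hD : IsQuaternionicConnection ρ ι D) : QuaternionicCoordinates V F where
  domain := L.domain
  incl := L.inclusionForm ι
  conn := L.connectionForm D
  rep := L.rep
  isOpen_domain := L.isOpen_domain
  contDiffOn_incl := L.contDiffOn_inclusionForm ι hι.smooth
  contDiffOn_conn := L.contDiffOn_connectionForm D hD.smooth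
  injective y hy := by
    intro v w h
    have h1 := hι.injective _ (L.coord_injective hy.2 h)
    have h2 := congrArg (L.chartDeriv (L.chart.symm y)) h1
    exact (L.chartDeriv_chartDerivSymm hy.1 v).symm.trans
      (h2.trans (L.chartDeriv_chartDerivSymm hy.1 w))
  generic y hy j hj := L.generic_coordinates hι hy hj
  torsion y hy v w := L.torsion_coordinates D ι hι.smooth hD.torsion_free hy v w
  preserves y hy v u hu := L.preserves_coordinates hD.preserves hy v hu

end AdaptedFrame

end QuaternionicCoordinates

/-! ### Coordinates on the bundle of endomorphisms -/

section EndCoordinates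

set_option linter.unusedSectionVars false
set_option maxSynthPendingDepth 3
set_option synthInstance.maxHeartbeats 200000

variable {V : Type*} [NormedAddCommGroup V] [NormedSpace ℝ V] [FiniteDimensional ℝ V]
  {M : Type*} [TopologicalSpace M] [T2Space M] [ChartedSpace V M] [IsManifold 𝓘(ℝ, V) ∞ M]
  {F : Type*} [NormedAddCommGroup F] [NormedSpace ℝ F] [FiniteDimensional ℝ F]
  {E : M → Type*} [TopologicalSpace (TotalSpace F E)]
  [∀ x, AddCommGroup (E x)] [∀ x, Module ℝ (E x)] [∀ x, TopologicalSpace (E x)]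
  [∀ x, IsTopologicalAddGroup (E x)] [∀ x, ContinuousSMul ℝ (E x)]
  [FiberBundle F E] [VectorBundle ℝ F E] [ContMDiffVectorBundle ∞ F E 𝓘(ℝ, V)]
  {A : M → Type*} [∀ x, Ring (A x)] [∀ x, Algebra ℝ (A x)]
  [TopologicalSpace (TotalSpace ℍ[ℝ] A)] [∀ x, TopologicalSpace (A x)]
  [FiberBundle ℍ[ℝ] A] [VectorBundle ℝ ℍ[ℝ] A]
  {ρ : ∀ x, A x →ₐ[ℝ] (E x →L[ℝ] E x)}

namespace AdaptedFrame

variable (L : AdaptedFrame V F ρ)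

lemma contMDiffOn_endChart :
    ContMDiffOn (endModel 𝓘(ℝ, V) F) 𝓘(ℝ, V × (F →L[ℝ] F)) ∞
      (fun p : EndTotal F E => (L.chart p.1, L.matrix p.1 p.2)) {p | p.1 ∈ L.source} := by
  intro p hp
  have h1 := (L.contMDiffAt_end_iff (J := endModel 𝓘(ℝ, V) F) (f := fun p : EndTotal F E => p)
    (p := p) hp).1 contMDiffAt_id
  exact (((L.isSmoothCoordinates_chart.contMDiffAt (L.source_subset_chart_source hp)).comp p
    h1.1).prodMk_space h1.2).contMDiffWithinAt

lemma contMDiffOn_endChart_symm :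
    ContMDiffOn 𝓘(ℝ, V × (F →L[ℝ] F)) (endModel 𝓘(ℝ, V) F) ∞
      (fun z : V × (F →L[ℝ] F) => (⟨L.chart.symm z.1, L.endo _ z.2⟩ : EndTotal F E))
      {z | z.1 ∈ L.domain} := by
  intro z hz
  have h1 := (L.isSmoothCoordinates_chart.contMDiffAt_symm hz.1).comp z
    (contDiff_fst (𝕜 := ℝ) (n := ∞) (E := V) (F := F →L[ℝ] F)).contMDiff.contMDiffAt
  refine ((L.contMDiffAt_end_iff (J := 𝓘(ℝ, V × (F →L[ℝ] F))) (p := z)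
    (f := fun z : V × (F →L[ℝ] F) => (⟨L.chart.symm z.1, L.endo _ z.2⟩ : EndTotal F E)) hz.2).2
    ⟨h1, ?_⟩).contMDiffWithinAt
  refine (contDiff_snd (𝕜 := ℝ) (n := ∞) (E := V)
    (F := F →L[ℝ] F)).contMDiff.contMDiffAt.congr_of_eventuallyEq ?_
  filter_upwards [h1.continuousAt.eventually_mem (L.isOpen_source.mem_nhds hz.2)] with w hw
  exact L.matrix_endo hw _

/-- The coordinates on `End(E)` that are given by an adapted frame of `E`. -/
noncomputable def endChart : OpenPartialHomeomorph (EndTotal F E) (V × (F →L[ℝ] F)) where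
  toFun p := (L.chart p.1, L.matrix p.1 p.2)
  invFun z := ⟨L.chart.symm z.1, L.endo _ z.2⟩
  source := {p | p.1 ∈ L.source}
  target := {z | z.1 ∈ L.domain}
  map_source' p hp := by
    have hc := L.source_subset_chart_source hp
    refine ⟨L.chart.map_source hc, ?_⟩
    change L.chart.symm (L.chart p.1) ∈ L.source
    rwa [L.chart.left_inv hc]
  map_target' z hz := hz.2
  left_inv' p hp := by
    have h1 : ∀ x, x = p.1 → (⟨x, L.endo x (L.matrix p.1 p.2)⟩ : EndTotal F E) = p := by
      rintro x rfl
      rw [L.endo_matrix hp]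
    exact h1 _ (L.chart.left_inv (L.source_subset_chart_source hp))
  right_inv' z hz := Prod.ext (L.chart.right_inv hz.1) (L.matrix_endo hz.2 _)
  open_source := L.isOpen_source.preimage (FiberBundle.continuous_proj (F →L[ℝ] F) _)
  open_target := L.isOpen_domain.preimage continuous_fst
  continuousOn_toFun := L.contMDiffOn_endChart.continuousOn
  continuousOn_invFun := L.contMDiffOn_endChart_symm.continuousOn

lemma isSmoothCoordinates_endChart : IsSmoothCoordinates (endModel 𝓘(ℝ, V) F) L.endChart :=
  ⟨L.contMDiffOn_endChart, L.contMDiffOn_endChart_symm⟩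

/-- The derivative of the coordinates on `End(E)`. -/
noncomputable def endDeriv (p : EndTotal F E) :
    TangentSpace (endModel 𝓘(ℝ, V) F) p →L[ℝ] V × (F →L[ℝ] F) :=
  mfderiv (endModel 𝓘(ℝ, V) F) 𝓘(ℝ, V × (F →L[ℝ] F)) L.endChart p

/-- The derivative of the inverse of the coordinates on `End(E)`. -/
noncomputable def endDerivSymm (p : EndTotal F E) :
    V × (F →L[ℝ] F) →L[ℝ] TangentSpace (endModel 𝓘(ℝ, V) F) p :=
  mfderiv 𝓘(ℝ, V × (F →L[ℝ] F)) (endModel 𝓘(ℝ, V) F) L.endChart.symm (L.endChart p)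

variable {p : EndTotal F E}

lemma endDeriv_injective (hp : p.1 ∈ L.source) : Function.Injective (L.endDeriv p) :=
  L.isSmoothCoordinates_endChart.mfderiv_injective hp

lemma endDeriv_endDerivSymm (hp : p.1 ∈ L.source) (B : V × (F →L[ℝ] F)) :
    L.endDeriv p (L.endDerivSymm p B) = B := by
  have h1 := L.isSmoothCoordinates_endChart.mfderiv_mfderiv_symm (L.endChart.map_source hp) B
  rw [L.endChart.left_inv hp] at h1
  exact h1

lemma mdifferentiableAt_endChart (hp : p.1 ∈ L.source) :
    MDifferentiableAt (endModel 𝓘(ℝ, V) F) 𝓘(ℝ, V × (F →L[ℝ] F)) L.endChart p :=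
  (L.isSmoothCoordinates_endChart.contMDiffAt hp).mdifferentiableAt (by simp)

lemma endDeriv_fst (hp : p.1 ∈ L.source) (X : TangentSpace (endModel 𝓘(ℝ, V) F) p) :
    (L.endDeriv p X).1 = L.chartDeriv p.1
      (mfderiv (endModel 𝓘(ℝ, V) F) 𝓘(ℝ, V) (fun q : EndTotal F E => q.1) p X) := by
  have h1 := (hasFDerivAt_fst (𝕜 := ℝ) (E := V) (F := F →L[ℝ] F)
    (p := L.endChart p)).hasMFDerivAt.comp p (L.mdifferentiableAt_endChart hp).hasMFDerivAt
  have h2 := ((L.isSmoothCoordinates_chart.contMDiffAt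
    (L.source_subset_chart_source hp)).mdifferentiableAt (by simp)).hasMFDerivAt.comp p
    ((contMDiff_proj (n := ∞) (fun x : M => E x →L[ℝ] E x)).contMDiffAt (x := p)
      |>.mdifferentiableAt (by simp)).hasMFDerivAt
  exact congrArg (fun T => T X) (hasMFDerivAt_unique h1 h2)

/-- The coordinates of the velocity of a curve, or of the derivative of a section. -/
lemma endDeriv_mfderiv {W : Type*} [NormedAddCommGroup W] [NormedSpace ℝ W]
    {P : Type*} [TopologicalSpace P] [ChartedSpace W P] {g : P → EndTotal F E} {t : P}
    (hg : MDifferentiableAt 𝓘(ℝ, W) (endModel 𝓘(ℝ, V) F) g t) (hp : (g t).1 ∈ L.source)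
    (w : TangentSpace 𝓘(ℝ, W) t) :
    L.endDeriv (g t) (mfderiv 𝓘(ℝ, W) (endModel 𝓘(ℝ, V) F) g t w) =
      mvfderiv 𝓘(ℝ, W) (fun t => L.endChart (g t)) t w :=
  (congrArg (fun T => T w)
    ((L.mdifferentiableAt_endChart hp).hasMFDerivAt.comp t hg.hasMFDerivAt).mfderiv).symm

lemma endDeriv_section {x : M} (hx : x ∈ L.source) {s : ∀ y, E y →L[ℝ] E y}
    (hs : ContMDiffAt 𝓘(ℝ, V) (endModel 𝓘(ℝ, V) F) ∞ (fun y => (⟨y, s y⟩ : EndTotal F E)) x)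
    (v : TangentSpace 𝓘(ℝ, V) x) :
    L.endDeriv ⟨x, s x⟩ (mfderiv 𝓘(ℝ, V) (endModel 𝓘(ℝ, V) F)
      (fun y => (⟨y, s y⟩ : EndTotal F E)) x v) =
      (L.chartDeriv x v, mvfderiv 𝓘(ℝ, V) (fun y => L.matrix y (s y)) x v) := by
  have h1 := L.endDeriv_mfderiv (hs.mdifferentiableAt (by simp)) hx v
  have h2 := ((L.isSmoothCoordinates_chart.contMDiffAt
    (L.source_subset_chart_source hx)).mdifferentiableAt (by simp)).hasMFDerivAt
  have h3 := (((L.contMDiffAt_end_iff hx).1 hs).2.mdifferentiableAt (by simp)).hasMFDerivAt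
  refine h1.trans ?_
  have h4 : HasMFDerivAt 𝓘(ℝ, V) 𝓘(ℝ, V × (F →L[ℝ] F))
      (fun y => L.endChart (⟨y, s y⟩ : EndTotal F E)) x _ :=
    ⟨h2.1.prodMk h3.1, HasFDerivWithinAt.prodMk h2.2 h3.2⟩
  exact congrArg (fun T => T v) h4.mfderiv

lemma endDeriv_verticalLift (hp : p.1 ∈ L.source) (T : E p.1 →L[ℝ] E p.1) :
    L.endDeriv p (verticalLift 𝓘(ℝ, V) p T) = (0, L.matrix p.1 T) := by
  have h0 : (fun t : ℝ => L.matrix p.1 (p.2 + t • T)) =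
      fun t => L.matrix p.1 p.2 + t • L.matrix p.1 T := by
    funext t
    rw [L.matrix_add, L.matrix_smul]
  have h1 : ContMDiffAt 𝓘(ℝ, ℝ) (endModel 𝓘(ℝ, V) F) ∞
      (fun t : ℝ => (⟨p.1, p.2 + t • T⟩ : EndTotal F E)) 0 := by
    refine (L.contMDiffAt_end_iff (J := 𝓘(ℝ, ℝ)) (p := (0 : ℝ))
      (f := fun t : ℝ => (⟨p.1, p.2 + t • T⟩ : EndTotal F E)) hp).2 ⟨contMDiffAt_const, ?_⟩
    change ContMDiffAt 𝓘(ℝ, ℝ) _ ∞ (fun t : ℝ => L.matrix p.1 (p.2 + t • T)) 0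
    rw [h0]
    exact (contDiff_const.add (contDiff_id.smul contDiff_const)).contMDiff.contMDiffAt
  have h2 := L.endDeriv_mfderiv (h1.mdifferentiableAt (by simp)) hp (1 : ℝ)
  have h3 : HasDerivAt (fun t : ℝ => L.endChart (⟨p.1, p.2 + t • T⟩ : EndTotal F E))
      ((0 : V), L.matrix p.1 T) 0 := by
    have h4 : (fun t : ℝ => L.endChart (⟨p.1, p.2 + t • T⟩ : EndTotal F E)) =
        fun t => (L.chart p.1, L.matrix p.1 p.2 + t • L.matrix p.1 T) := by
      funext t
      exact Prod.ext rfl (congrFun h0 t)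
    rw [h4]
    refine (hasDerivAt_const _ _).prodMk ?_
    simpa using ((hasDerivAt_id (0 : ℝ)).smul_const (L.matrix p.1 T)).const_add (L.matrix p.1 p.2)
  have h5 : mvfderiv 𝓘(ℝ, ℝ) (fun t : ℝ => L.endChart (⟨p.1, p.2 + t • T⟩ : EndTotal F E)) 0
      (1 : ℝ) = ((0 : V), L.matrix p.1 T) := by
    have := congrArg (fun T => T (1 : ℝ)) h3.hasFDerivAt.hasMFDerivAt.mfderiv
    refine Eq.trans this ?_
    exact one_smul ℝ _
  rw [← h5, ← h2]
  have h6 : ∀ J, J = p.2 → L.endDeriv p (verticalLift 𝓘(ℝ, V) p T) =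
      L.endDeriv ⟨p.1, J⟩ (verticalLift 𝓘(ℝ, V) p T) := by
    rintro J rfl
    rfl
  exact h6 _ (by simp)

end AdaptedFrame

end EndCoordinates

/-! ### The twistor distribution in coordinates -/

section TwistorDistribution

set_option linter.unusedSectionVars false
set_option maxSynthPendingDepth 3
set_option synthInstance.maxHeartbeats 200000

variable {V : Type*} [NormedAddCommGroup V] [NormedSpace ℝ V] [FiniteDimensional ℝ V]
  {M : Type*} [TopologicalSpace M] [T2Space M] [ChartedSpace V M] [IsManifold 𝓘(ℝ, V) ∞ M]
  {F : Type*} [NormedAddCommGroup F] [NormedSpace ℝ F] [FiniteDimensional ℝ F]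
  {E : M → Type*} [TopologicalSpace (TotalSpace F E)]
  [∀ x, AddCommGroup (E x)] [∀ x, Module ℝ (E x)] [∀ x, TopologicalSpace (E x)]
  [∀ x, IsTopologicalAddGroup (E x)] [∀ x, ContinuousSMul ℝ (E x)]
  [FiberBundle F E] [VectorBundle ℝ F E] [ContMDiffVectorBundle ∞ F E 𝓘(ℝ, V)]
  {A : M → Type*} [∀ x, Ring (A x)] [∀ x, Algebra ℝ (A x)]
  [TopologicalSpace (TotalSpace ℍ[ℝ] A)] [∀ x, TopologicalSpace (A x)]
  [FiberBundle ℍ[ℝ] A] [VectorBundle ℝ ℍ[ℝ] A]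
  {ρ : ∀ x, A x →ₐ[ℝ] (E x →L[ℝ] E x)}
  {ι : ∀ x, TangentSpace 𝓘(ℝ, V) x →ₗ[ℝ] E x}
  {D : CovariantDerivative 𝓘(ℝ, V) F E}

lemma complexVector_mem_eigenbundle {x : M} {J : E x →L[ℝ] E x} {u w : E x} :
    complexVector u w ∈ eigenbundle J ↔ J u = w ∧ J w = -u := by
  rw [eigenbundle, Module.End.mem_eigenspace_iff, baseChange_complexVector, smul_complexVector,
    complexVector_inj]
  simp

namespace AdaptedFrame

variable (L : AdaptedFrame V F ρ) (hι : IsAlmostCRQuaternionicStructure 𝓘(ℝ, V) F E ρ ι)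
  (hD : IsQuaternionicConnection ρ ι D) {p : EndTotal F E}

lemma endChart_mem_sphere (hp : p.1 ∈ L.source) :
    L.endChart p ∈ (L.coordinates hι hD).sphere ↔ p ∈ sphereBundle F ρ :=
  (L.mem_sphereBundle hp).symm

lemma vert_endDeriv (X : TangentSpace (endModel 𝓘(ℝ, V) F) p) :
    (L.coordinates hι hD).vert (L.endChart p) (L.endDeriv p X) = (L.endDeriv p X).2 +
      (L.connectionForm D (L.chart p.1) (L.endDeriv p X).1 * L.matrix p.1 p.2 -
        L.matrix p.1 p.2 * L.connectionForm D (L.chart p.1) (L.endDeriv p X).1) :=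
  (L.coordinates hι hD).vert_apply _ _

lemma horiz_endDeriv (hp : p.1 ∈ L.source) (X : TangentSpace (endModel 𝓘(ℝ, V) F) p) :
    (L.coordinates hι hD).horiz (L.endChart p) (L.endDeriv p X) = L.coord p.1 (ι p.1
      (mfderiv (endModel 𝓘(ℝ, V) F) 𝓘(ℝ, V) (fun q : EndTotal F E => q.1) p X)) := by
  have h1 := L.inclusionForm_chart ι (L.source_subset_chart_source hp)
    (mfderiv (endModel 𝓘(ℝ, V) F) 𝓘(ℝ, V) (fun q : EndTotal F E => q.1) p X)
  rw [← h1, ← L.endDeriv_fst hp]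
  rfl

/-- A section with matrix s is parallel in the direction v iff ds(v) + [Γ(v), s] = 0, where Γ is the
connection form; the left side is the vertical component of its derivative. Conversely, a vector
with zero vertical component is realized by a section with affine matrix. -/
lemma mem_horizontalSpace (hp : p.1 ∈ L.source) (X : TangentSpace (endModel 𝓘(ℝ, V) F) p) :
    X ∈ horizontalSpace D p ↔
      (L.coordinates hι hD).vert (L.endChart p) (L.endDeriv p X) = 0 := by
  obtain ⟨x, J⟩ := p
  change x ∈ L.source at hp
  have hxc := L.source_subset_chart_source hp
  constructor
  · intro hX
    have hle : horizontalSpace D ⟨x, J⟩ ≤ LinearMap.ker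
        (((L.coordinates hι hD).vert (L.endChart ⟨x, J⟩)).toLinearMap ∘ₗ
          (L.endDeriv (⟨x, J⟩ : EndTotal F E)).toLinearMap) := by
      refine Submodule.span_le.2 ?_
      rintro - ⟨s, v, hs, hsx, hpar, rfl⟩
      change s x = J at hsx
      subst hsx
      change (L.coordinates hι hD).vert _ (L.endDeriv (⟨x, s x⟩ : EndTotal F E) _) = 0
      rw [L.endDeriv_section hp hs.contMDiffAt, QuaternionicCoordinates.vert_apply]
      ext f
      obtain ⟨e, he, hef⟩ := L.exists_section hp f
      have h1 := L.coord_covariantDerivative_end D hp hxc hs.contMDiffAt he.contMDiffAt v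
      rw [hpar e he, sub_self, map_zero, hef.self_of_nhds, L.coord_vec hp] at h1
      exact h1.symm
    exact hle hX
  · intro hX
    rw [vert_endDeriv] at hX
    set v : TangentSpace 𝓘(ℝ, V) x :=
      mfderiv (endModel 𝓘(ℝ, V) F) 𝓘(ℝ, V) (fun q : EndTotal F E => q.1) ⟨x, J⟩ X with hv
    have hX1 : (L.endDeriv ⟨x, J⟩ X).1 = L.chartDeriv x v := L.endDeriv_fst (p := ⟨x, J⟩) hp X
    rw [hX1] at hX
    set m := L.matrix x J with hm
    set Γ := L.connectionForm D (L.chart x) with hΓ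
    let k : V →L[ℝ] (F →L[ℝ] F) := ((ContinuousLinearMap.mul ℝ (F →L[ℝ] F)).flip m -
      ContinuousLinearMap.mul ℝ (F →L[ℝ] F) m).comp Γ
    have hk (w : V) : k w = Γ w * m - m * Γ w := rfl
    -- This affine function has value m at the point and derivative -[Γ, m], so that the resulting
    -- section is parallel there in every direction.
    let g (z : V) : F →L[ℝ] F := m - k (z - L.chart x)
    have hg : HasFDerivAt g (-k) (L.chart x) := by
      have h2 : HasFDerivAt g (-(k.comp (ContinuousLinearMap.id ℝ V))) (L.chart x) :=
        (k.hasFDerivAt.comp (L.chart x) ((hasFDerivAt_id (𝕜 := ℝ) (L.chart x)).sub_const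
          (L.chart x))).const_sub m
      rwa [ContinuousLinearMap.comp_id] at h2
    have hgs : ContDiff ℝ ∞ g :=
      contDiff_const.sub (k.contDiff.comp (contDiff_id.sub contDiff_const))
    obtain ⟨s, hs, hsu, -, -⟩ := L.exists_end_section L.isOpen_source subset_rfl hp
      (u := fun q => g (L.chart q)) (hgs.contMDiff.comp_contMDiffOn
        (L.isSmoothCoordinates_chart.contMDiffOn.mono L.source_subset_chart_source))
    have hsx : s x = J := by
      rw [hsu.self_of_nhds]
      simp only [g, sub_self, map_zero, sub_zero, hm]
      exact L.endo_matrix hp J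
    subst hsx
    have hds : mvfderiv 𝓘(ℝ, V) (fun q => L.matrix q (s q)) x v = -k (L.chartDeriv x v) := by
      have h3 : (fun q => L.matrix q (s q)) =ᶠ[𝓝 x] fun q => g (L.chart q) := by
        filter_upwards [hsu, L.isOpen_source.mem_nhds hp] with q hq hqs
        rw [hq, L.matrix_endo hqs]
      rw [mvfderiv_congr_of_eventuallyEq h3, L.mvfderiv_comp_chart hxc hg.differentiableAt,
        hg.fderiv]
      rfl
    refine Submodule.subset_span ⟨s, v, hs, rfl, fun e he => ?_, ?_⟩
    · rw [← sub_eq_zero]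
      apply L.coord_injective hp
      refine (L.coord_covariantDerivative_end D hp hxc hs.contMDiffAt he.contMDiffAt v).trans ?_
      rw [hds, hk, neg_add_cancel, map_zero]
      rfl
    · apply L.endDeriv_injective (p := ⟨x, s x⟩) hp
      refine Eq.trans ?_ (L.endDeriv_section hp hs.contMDiffAt v).symm
      rw [hds, hk]
      exact Prod.ext hX1 (eq_neg_of_add_eq_zero_left hX)

lemma complexVector_mem_horizontalPart (hp : p.1 ∈ L.source) (hs : p ∈ sphereBundle F ρ)
    {X₁ X₂ : TangentSpace (endModel 𝓘(ℝ, V) F) p} :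
    complexVector X₁ X₂ ∈ horizontalPart ι D p ↔
      (L.coordinates hι hD).vert (L.endChart p) (L.endDeriv p X₁) = 0 ∧
      (L.coordinates hι hD).vert (L.endChart p) (L.endDeriv p X₂) = 0 ∧
      (L.coordinates hι hD).horiz (L.endChart p) (L.endDeriv p X₂) =
        L.matrix p.1 p.2 ((L.coordinates hι hD).horiz (L.endChart p) (L.endDeriv p X₁)) := by
  rw [horizontalPart, Submodule.mem_inf, complexVector_mem_baseChange,
    L.mem_horizontalSpace hι hD hp, L.mem_horizontalSpace hι hD hp, and_assoc]
  refine and_congr_right fun _ => and_congr_right fun _ => ?_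
  rw [Submodule.mem_comap, Submodule.mem_comap, baseChange_complexVector, baseChange_complexVector,
    complexVector_mem_eigenbundle, L.horiz_endDeriv hι hD hp, L.horiz_endDeriv hι hD hp,
    ← L.coord_apply hp, (L.coord_injective hp).eq_iff]
  constructor
  · rintro ⟨h, -⟩
    exact h.symm
  -- The eigenvalue equation consists of two real equations; the second follows from the first
  -- because J² = -1.
  · intro h
    refine ⟨h.symm, ?_⟩
    obtain ⟨a, ha, hap⟩ := hs
    have h2 : p.2 * p.2 = -1 := by rw [← hap, ← map_mul, ha, map_neg, map_one]
    exact (congrArg p.2 h).trans (congrArg (fun T : E p.1 →L[ℝ] E p.1 => T (ι p.1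
      (mfderiv (endModel 𝓘(ℝ, V) F) 𝓘(ℝ, V) (fun q : EndTotal F E => q.1) p X₁))) h2)

lemma mul_mem_imaginaryBundle [Nontrivial F] (hp : p.1 ∈ L.source) (hs : p ∈ sphereBundle F ρ)
    {q : E p.1 →L[ℝ] E p.1} (hq : q ∈ imaginaryBundle ρ p.1) (hqa : p.2 * q + q * p.2 = 0) :
    p.2 * q ∈ imaginaryBundle ρ p.1 := by
  obtain ⟨j, -, hjp⟩ := (L.mem_sphereBundle hp).1 hs
  rw [← L.matrix_mem_imaginaryImage hp] at hq ⊢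
  rw [L.matrix_mul hp, ← hjp]
  apply mul_mem_imaginaryImage hq
  rw [hjp, ← L.matrix_mul hp, ← L.matrix_mul hp, ← L.matrix_add, hqa, L.matrix_zero]

/-- The spanning set is already a complex subspace: multiplying q + iJq by i amounts to replacing q
by -Jq. -/
lemma mem_verticalPart [Nontrivial F] (hp : p.1 ∈ L.source) (hs : p ∈ sphereBundle F ρ)
    {ξ : ℂ ⊗[ℝ] TangentSpace (endModel 𝓘(ℝ, V) F) p} :
    ξ ∈ verticalPart 𝓘(ℝ, V) ρ p ↔ ∃ q ∈ imaginaryBundle ρ p.1, p.2 * q + q * p.2 = 0 ∧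
      ξ = complexVector (verticalLift 𝓘(ℝ, V) p q) (verticalLift 𝓘(ℝ, V) p (p.2 * q)) := by
  refine ⟨fun h => ?_, fun h => Submodule.subset_span h⟩
  have hlift (q) := L.endDeriv_verticalLift hp q
  have hinj := L.endDeriv_injective hp
  obtain ⟨a, ha, hap⟩ := hs
  have hJ : p.2 * p.2 = -1 := by rw [← hap, ← map_mul, ha, map_neg, map_one]
  refine Submodule.span_induction (fun _ h => h) ?_ ?_ ?_ h
  · refine ⟨0, Submodule.zero_mem _, by simp, ?_⟩
    have h0 : verticalLift 𝓘(ℝ, V) p 0 = 0 := hinj (by rw [hlift, L.matrix_zero, map_zero]; rfl)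
    rw [mul_zero, h0]
    simp [complexVector]
  · rintro - - - - ⟨q, hq, hqa, rfl⟩ ⟨q', hq', hqa', rfl⟩
    have hadd (q q') : verticalLift 𝓘(ℝ, V) p (q + q') =
        verticalLift 𝓘(ℝ, V) p q + verticalLift 𝓘(ℝ, V) p q' :=
      hinj (by rw [map_add, hlift, hlift, hlift, L.matrix_add, Prod.mk_add_mk, add_zero])
    refine ⟨q + q', Submodule.add_mem _ hq hq', ?_, ?_⟩
    · rw [mul_add, add_mul, add_add_add_comm, hqa, hqa', add_zero]
    · rw [mul_add, hadd, hadd, complexVector_add]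
  · rintro c - - ⟨q, hq, hqa, rfl⟩
    have hqJ := L.mul_mem_imaginaryBundle hp ⟨a, ha, hap⟩ hq hqa
    have hcomb (s t : ℝ) (q q') : s • verticalLift 𝓘(ℝ, V) p q + t • verticalLift 𝓘(ℝ, V) p q' =
        verticalLift 𝓘(ℝ, V) p (s • q + t • q') :=
      hinj (by rw [map_add, map_smul, map_smul, hlift, hlift, hlift, L.matrix_add, L.matrix_smul,
        L.matrix_smul, Prod.smul_mk, Prod.smul_mk, Prod.mk_add_mk, smul_zero, smul_zero, add_zero])
    have hqJ' : q * p.2 = -(p.2 * q) := eq_neg_of_add_eq_zero_right hqa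
    refine ⟨c.re • q + (-c.im) • (p.2 * q), Submodule.add_mem _ (Submodule.smul_mem _ _ hq)
      (Submodule.smul_mem _ _ hqJ), ?_, ?_⟩
    · simp only [mul_add, add_mul, mul_smul_comm, smul_mul_assoc, hqJ', mul_assoc, mul_neg]
      module
    · rw [smul_complexVector, hcomb, sub_eq_add_neg, ← neg_smul, hcomb]
      congr 2
      rw [mul_add, mul_smul_comm, mul_smul_comm, ← mul_assoc, hJ, neg_one_mul]
      module

lemma complexVector_mem_twistorDistribution [Nontrivial F] (hp : p.1 ∈ L.source)
    (hs : p ∈ sphereBundle F ρ) {X₁ X₂ : TangentSpace (endModel 𝓘(ℝ, V) F) p} :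
    complexVector X₁ X₂ ∈ twistorDistribution ρ ι D p ↔
      (L.coordinates hι hD).IsTwistorPair (L.endChart p) (L.endDeriv p X₁) (L.endDeriv p X₂) := by
  have hlift (q) := L.endDeriv_verticalLift hp q
  have hvert (q) : (L.coordinates hι hD).vert (L.endChart p)
      (L.endDeriv p (verticalLift 𝓘(ℝ, V) p q)) = L.matrix p.1 q := by
    rw [hlift, QuaternionicCoordinates.vert_apply]
    simp
  have hhoriz (q) : (L.coordinates hι hD).horiz (L.endChart p)
      (L.endDeriv p (verticalLift 𝓘(ℝ, V) p q)) = 0 := by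
    rw [hlift, QuaternionicCoordinates.horiz_apply, map_zero]
  rw [twistorDistribution]
  constructor
  · intro h
    obtain ⟨η, hη, ζ, hζ, hsum⟩ := Submodule.mem_sup.1 h
    obtain ⟨q, hq, hqa, rfl⟩ := (L.mem_verticalPart hp hs).1 hζ
    rw [← complexVector_re_im η] at hη hsum
    obtain ⟨h1, h2, h3⟩ := (L.complexVector_mem_horizontalPart hι hD hp hs).1 hη
    rw [← complexVector_add, complexVector_inj] at hsum
    rw [← hsum.1, ← hsum.2]
    refine ⟨?_, ?_, ?_, ?_⟩
    · rw [map_add, map_add, hhoriz, add_zero, map_add, map_add, hhoriz, add_zero]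
      exact h3
    · rw [map_add, map_add, h1, zero_add, hvert]
      exact (L.matrix_mem_imaginaryImage hp).2 hq
    · rw [map_add, map_add, h1, zero_add, hvert]
      change L.matrix p.1 p.2 * _ + _ * L.matrix p.1 p.2 = 0
      rw [← L.matrix_mul hp, ← L.matrix_mul hp, ← L.matrix_add, hqa, L.matrix_zero]
    · rw [map_add, map_add, h2, zero_add, hvert, map_add, map_add, h1, zero_add, hvert]
      exact L.matrix_mul hp _ _
  · rintro ⟨h1, h2, h3, h4⟩
    set u := (L.coordinates hι hD).vert (L.endChart p) (L.endDeriv p X₁) with hu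
    have hmq : L.matrix p.1 (L.endo p.1 u) = u := L.matrix_endo hp u
    have hqa : p.2 * L.endo p.1 u + L.endo p.1 u * p.2 = 0 := by
      apply L.matrix_injective hp
      rw [L.matrix_add, L.matrix_mul hp, L.matrix_mul hp, hmq, L.matrix_zero]
      exact h3
    -- Subtracting the vertical lift of the vertical component leaves a horizontal vector with the
    -- same projection to M.
    refine Submodule.mem_sup.2 ⟨complexVector (X₁ - verticalLift 𝓘(ℝ, V) p (L.endo p.1 u))
      (X₂ - verticalLift 𝓘(ℝ, V) p (p.2 * L.endo p.1 u)), ?_, _,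
      (L.mem_verticalPart hp hs).2 ⟨L.endo p.1 u, ?_, hqa, rfl⟩, ?_⟩
    · refine (L.complexVector_mem_horizontalPart hι hD hp hs).2 ⟨?_, ?_, ?_⟩
      · rw [map_sub, map_sub, hvert, hmq, ← hu, sub_self]
      · rw [map_sub, map_sub, hvert, L.matrix_mul hp, hmq, h4]
        exact sub_self _
      · rw [map_sub, map_sub, hhoriz, sub_zero, map_sub, map_sub, hhoriz, sub_zero]
        exact h1
    · rw [← L.matrix_mem_imaginaryImage hp, hmq]
      exact h2
    · rw [← complexVector_add, sub_add_cancel, sub_add_cancel]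

/-- The curve built in coordinates is carried back to End(E), where it stays in the sphere bundle
near time 0. -/
lemma mem_submanifoldTangent [Nontrivial F] (hp : p.1 ∈ L.source) (hs : p ∈ sphereBundle F ρ)
    {X : TangentSpace (endModel 𝓘(ℝ, V) F) p}
    (hX : (L.coordinates hι hD).IsTangent (L.endChart p) (L.endDeriv p X)) :
    X ∈ submanifoldTangent (endModel 𝓘(ℝ, V) F) (sphereBundle F ρ) p := by
  obtain ⟨c, hc, hc0, hcd, hcs⟩ :=
    (L.coordinates hι hD).exists_curve ((L.endChart_mem_sphere hι hD hp).2 hs) hX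
  have hsymm := L.isSmoothCoordinates_endChart.contMDiffAt_symm (L.endChart.map_source hp)
  rw [← hc0] at hsymm
  refine Submodule.subset_span ⟨fun t => L.endChart.symm (c t),
    hsymm.comp 0 hc.contMDiff.contMDiffAt, ?_, ?_, ?_⟩
  · have h1 : ∀ᶠ t in 𝓝 (0 : ℝ), c t ∈ L.endChart.target := by
      refine hc.continuous.continuousAt.eventually_mem (L.endChart.open_target.mem_nhds ?_)
      rw [hc0]
      exact L.endChart.map_source hp
    filter_upwards [h1] with t ht
    rw [← L.endChart_mem_sphere hι hD (L.endChart.map_target ht), L.endChart.right_inv ht]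
    exact hcs t
  · change L.endChart.symm (c 0) = p
    rw [hc0, L.endChart.left_inv hp]
  · have h2 := congrArg (fun T => T (1 : ℝ)) ((hsymm.mdifferentiableAt (by simp)).hasMFDerivAt.comp
      (0 : ℝ) hcd.hasFDerivAt.hasMFDerivAt).mfderiv
    have h3 : ∀ z, z = L.endChart p → (X : V × (F →L[ℝ] F)) =
        mfderiv 𝓘(ℝ, V × (F →L[ℝ] F)) (endModel 𝓘(ℝ, V) F) L.endChart.symm z
          (L.endDeriv p X) := by
      rintro z rfl
      exact (L.isSmoothCoordinates_endChart.mfderiv_symm_mfderiv hp X).symm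
    refine (h3 _ hc0).trans (Eq.trans ?_ h2.symm)
    exact congrArg (mfderiv 𝓘(ℝ, V × (F →L[ℝ] F)) (endModel 𝓘(ℝ, V) F) L.endChart.symm (c 0))
      (one_smul ℝ (L.endDeriv p X)).symm

end AdaptedFrame

end TwistorDistribution

/-! ### The CR structure on the sphere bundle -/

section Integrability

set_option linter.unusedSectionVars false
set_option maxSynthPendingDepth 3
set_option synthInstance.maxHeartbeats 200000

variable {V : Type*} [NormedAddCommGroup V] [NormedSpace ℝ V]
  {F : Type*} [NormedAddCommGroup F] [NormedSpace ℝ F]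

namespace QuaternionicCoordinates

variable (T : QuaternionicCoordinates V F)

lemma eq_zero_of_horiz_vert {z X : V × (F →L[ℝ] F)} (hz : z.1 ∈ T.domain) (h : T.horiz z X = 0)
    (hv : T.vert z X = 0) : X = 0 := by
  have h1 : X.1 = 0 := T.injective z.1 hz (h.trans (map_zero _).symm)
  rw [vert_apply, h1] at hv
  simp at hv
  exact Prod.ext h1 hv

/-- Both components of X₂ equal J times those of X₁ and also minus this, so they vanish, and then
those of X₁ vanish too. Injectivity of ι makes a vector with zero components zero. -/
lemma IsTwistorPair.eq_zero {z X₁ X₂ : V × (F →L[ℝ] F)} (hz : z.1 ∈ T.domain)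
    (hs : z ∈ T.sphere) (h : T.IsTwistorPair z X₁ X₂) (h' : T.IsTwistorPair z X₁ (-X₂)) :
    X₁ = 0 ∧ X₂ = 0 := by
  obtain ⟨j, hj, hjz⟩ := hs
  have hJ : z.2 * z.2 = -1 := by rw [← hjz, ← map_mul, hj, map_neg, map_one]
  have e1 := h'.horiz_eq
  have e2 := h'.vert_eq
  rw [map_neg, ← h.horiz_eq, neg_eq_iff_add_eq_zero, ← two_smul ℝ, smul_eq_zero_iff_right two_ne_zero] at e1
  rw [map_neg, ← h.vert_eq, neg_eq_iff_add_eq_zero, ← two_smul ℝ, smul_eq_zero_iff_right two_ne_zero] at e2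
  refine ⟨T.eq_zero_of_horiz_vert hz ?_ ?_, T.eq_zero_of_horiz_vert hz e1 e2⟩
  · have h3 := congrArg (fun S : F →L[ℝ] F => S (T.horiz z X₁)) hJ
    have h4 := h.horiz_eq
    rw [e1] at h4
    simpa [← h4] using h3.symm
  · have h3 := congrArg (fun S : F →L[ℝ] F => S * T.vert z X₁) hJ
    have h4 := h.vert_eq
    rw [e2] at h4
    simpa [mul_assoc, ← h4] using h3.symm

end QuaternionicCoordinates

variable [FiniteDimensional ℝ V] [FiniteDimensional ℝ F]
  {M : Type*} [TopologicalSpace M] [T2Space M] [ChartedSpace V M] [IsManifold 𝓘(ℝ, V) ∞ M]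
  {E : M → Type*} [TopologicalSpace (TotalSpace F E)]
  [∀ x, AddCommGroup (E x)] [∀ x, Module ℝ (E x)] [∀ x, TopologicalSpace (E x)]
  [∀ x, IsTopologicalAddGroup (E x)] [∀ x, ContinuousSMul ℝ (E x)]
  [FiberBundle F E] [VectorBundle ℝ F E] [ContMDiffVectorBundle ∞ F E 𝓘(ℝ, V)]
  {A : M → Type*} [∀ x, Ring (A x)] [∀ x, Algebra ℝ (A x)]
  [TopologicalSpace (TotalSpace ℍ[ℝ] A)] [∀ x, TopologicalSpace (A x)]
  [FiberBundle ℍ[ℝ] A] [VectorBundle ℝ ℍ[ℝ] A]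
  {ρ : ∀ x, A x →ₐ[ℝ] (E x →L[ℝ] E x)}
  {ι : ∀ x, TangentSpace 𝓘(ℝ, V) x →ₗ[ℝ] E x}
  {D : CovariantDerivative 𝓘(ℝ, V) F E}

namespace AdaptedFrame

variable (L : AdaptedFrame V F ρ) {p : EndTotal F E}

/-- Real and imaginary parts, read in the coordinates, identify the underlying real space of 𝒞 with
`pairs`, whose dimension is known. -/
lemma finrank_twistorDistribution
    (hι : IsAlmostCRQuaternionicStructure 𝓘(ℝ, V) F E ρ ι)
    (hD : IsQuaternionicConnection ρ ι D) [Nontrivial F] (hp : p.1 ∈ L.source)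
    (hs : p ∈ sphereBundle F ρ) :
    2 * Module.finrank ℂ (twistorDistribution ρ ι D p) + Module.finrank ℝ F =
      2 * Module.finrank ℝ V + 2 := by
  rw [← (L.coordinates hι hD).finrank_pairs (L.endChart.map_source hp)
    ((L.endChart_mem_sphere hι hD hp).2 hs), Nat.add_right_cancel_iff]
  have h0 : Module.finrank ℝ ((twistorDistribution ρ ι D p).restrictScalars ℝ) =
      2 * Module.finrank ℂ (twistorDistribution ρ ι D p) := by
    rw [← Complex.finrank_real_complex]
    exact (Module.finrank_mul_finrank ℝ ℂ (twistorDistribution ρ ι D p)).symm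
  rw [← h0]
  let g : ℂ ⊗[ℝ] TangentSpace (endModel 𝓘(ℝ, V) F) p →ₗ[ℝ]
      (V × (F →L[ℝ] F)) × (V × (F →L[ℝ] F)) :=
    ((L.endDeriv p).toLinearMap ∘ₗ realPartVector).prod
      ((L.endDeriv p).toLinearMap ∘ₗ imaginaryPartVector)
  have hg1 (X₁ X₂) : g (complexVector X₁ X₂) = (L.endDeriv p X₁, L.endDeriv p X₂) := by
    have h1 := complexVector_inj.1 (complexVector_re_im (complexVector X₁ X₂))
    exact Prod.ext (congrArg (L.endDeriv p) h1.1) (congrArg (L.endDeriv p) h1.2)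
  have hg : Function.Injective g := by
    intro ξ η h
    rw [← complexVector_re_im ξ, ← complexVector_re_im η] at h ⊢
    rw [hg1, hg1] at h
    have h2 := Prod.ext_iff.1 h
    rw [L.endDeriv_injective hp h2.1, L.endDeriv_injective hp h2.2]
  rw [(Submodule.equivMapOfInjective g hg _).finrank_eq]
  suffices h : Submodule.map g ((twistorDistribution ρ ι D p).restrictScalars ℝ) =
      (L.coordinates hι hD).pairs (L.endChart p) by rw [h]
  ext Y
  rw [QuaternionicCoordinates.mem_pairs]
  constructor
  · rintro ⟨ξ, hξ, rfl⟩
    rw [← complexVector_re_im ξ] at hξ ⊢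
    rw [hg1]
    exact (L.complexVector_mem_twistorDistribution hι hD hp hs).1 hξ
  · intro hY
    refine ⟨complexVector (L.endDerivSymm p Y.1) (L.endDerivSymm p Y.2), ?_, ?_⟩
    · refine (L.complexVector_mem_twistorDistribution hι hD hp hs).2 ?_
      rwa [L.endDeriv_endDerivSymm hp, L.endDeriv_endDerivSymm hp]
    · rw [hg1, L.endDeriv_endDerivSymm hp, L.endDeriv_endDerivSymm hp]

lemma endDeriv_fieldOfCoordinates (hp : p.1 ∈ L.source)
    (Y : V × (F →L[ℝ] F) → V × (F →L[ℝ] F)) :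
    L.endDeriv p (fieldOfCoordinates (endModel 𝓘(ℝ, V) F) L.endChart Y p) = Y (L.endChart p) :=
  L.endDeriv_endDerivSymm hp _

end AdaptedFrame

theorem isCRStructure_twistorDistribution {k l : ℕ}
    (hF : Module.finrank ℝ F = 4 * k) (hV : Module.finrank ℝ V + l = 4 * k) (hl : l < 2 * k)
    (hkl : 2 * k ≠ l + 2)
    (hι : IsAlmostCRQuaternionicStructure 𝓘(ℝ, V) F E ρ ι)
    (hD : IsQuaternionicConnection ρ ι D) :
    IsCRStructure (endModel 𝓘(ℝ, V) F) (sphereBundle F ρ) (twistorDistribution ρ ι D) := by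
  have hnt : Nontrivial F := Module.nontrivial_of_finrank_pos (R := ℝ) (by omega)
  have hcs : CompleteSpace V := FiniteDimensional.complete ℝ V
  have hcF : CompleteSpace F := FiniteDimensional.complete ℝ F
  have hframe := AdaptedFrame.exists_frame hι.quaternionic
  refine { le_tangent := ?_, inter_conj := ?_, constant_rank := ?_, smooth := ?_,
           bracket_closed := ?_ }
  · intro p hs ξ hξ
    obtain ⟨L, hp⟩ := hframe p.1
    have hz := L.endChart.map_source hp
    have hsz := (L.endChart_mem_sphere hι hD hp).2 hs
    rw [← complexVector_re_im ξ] at hξ ⊢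
    have h1 := (L.complexVector_mem_twistorDistribution hι hD hp hs).1 hξ
    exact complexVector_mem_baseChange.2
      ⟨L.mem_submanifoldTangent hι hD hp hs (h1.isTangent hz hsz),
        L.mem_submanifoldTangent hι hD hp hs ((h1.snd hsz).isTangent hz hsz)⟩
  · intro p hs ξ hξ hξ'
    obtain ⟨L, hp⟩ := hframe p.1
    rw [← complexVector_re_im ξ] at hξ hξ' ⊢
    rw [conjVector_complexVector] at hξ'
    have h1 := (L.complexVector_mem_twistorDistribution hι hD hp hs).1 hξ
    have h2 := (L.complexVector_mem_twistorDistribution hι hD hp hs).1 hξ'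
    rw [map_neg] at h2
    obtain ⟨h3, h4⟩ := h1.eq_zero _ (L.endChart.map_source hp)
      ((L.endChart_mem_sphere hι hD hp).2 hs) h2
    rw [L.endDeriv_injective hp (h3.trans (map_zero _).symm),
      L.endDeriv_injective hp (h4.trans (map_zero _).symm)]
    simp [complexVector]
  -- The rank is 2k - l for the horizontal part plus 1 for the (0,1)-line of the sphere; the
  -- subtraction is not truncated because l < 2k.
  · refine ⟨2 * k - l + 1, fun p hs => ?_⟩
    obtain ⟨L, hp⟩ := hframe p.1
    have := L.finrank_twistorDistribution hι hD hp hs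
    omega
  · intro p hs ξ hξ
    obtain ⟨L, hp⟩ := hframe p.1
    rw [← complexVector_re_im ξ] at hξ ⊢
    have h1 := (L.complexVector_mem_twistorDistribution hι hD hp hs).1 hξ
    obtain ⟨W, Y₁, Y₂, hW, hzW, hWd, hY₁, hY₂, e₁, e₂, hY⟩ :=
      (L.coordinates hι hD).exists_smooth_extension (L.endChart.map_source hp)
        ((L.endChart_mem_sphere hι hD hp).2 hs) h1
    have he := L.isSmoothCoordinates_endChart
    refine ⟨L.endChart.source ∩ L.endChart ⁻¹' W, fieldOfCoordinates _ L.endChart Y₁,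
      fieldOfCoordinates _ L.endChart Y₂, L.endChart.isOpen_inter_preimage hW, ⟨hp, hzW⟩,
      he.isSmoothFieldOn_fieldOfCoordinates hWd hY₁, he.isSmoothFieldOn_fieldOfCoordinates hWd hY₂,
      ?_, ?_⟩
    · rintro q ⟨⟨hq, hqW⟩, hqs⟩
      refine (L.complexVector_mem_twistorDistribution hι hD hq hqs).2 ?_
      rw [L.endDeriv_fieldOfCoordinates hq, L.endDeriv_fieldOfCoordinates hq]
      exact hY _ hqW ((L.endChart_mem_sphere hι hD hq).2 hqs)
    · refine complexVector_inj.2 ⟨L.endDeriv_injective hp ?_, L.endDeriv_injective hp ?_⟩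
      · rw [L.endDeriv_fieldOfCoordinates hp, e₁]
      · rw [L.endDeriv_fieldOfCoordinates hp, e₂]
  · rintro W X₁ X₂ Y₁ Y₂ hW hX₁ hX₂ hY₁ hY₂ hX hY p ⟨hpW, hs⟩
    obtain ⟨L, hp⟩ := hframe p.1
    have hz := L.endChart.map_source hp
    have hsz := (L.endChart_mem_sphere hι hD hp).2 hs
    have he := L.isSmoothCoordinates_endChart
    have hO : L.endChart.target ∩ L.endChart.symm ⁻¹' W ∈ 𝓝 (L.endChart p) :=
      (L.endChart.isOpen_inter_preimage_symm hW).mem_nhds ⟨hz, by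
        change L.endChart.symm (L.endChart p) ∈ W
        rwa [L.endChart.left_inv hp]⟩
    have hd {X : ∀ q, TangentSpace (endModel 𝓘(ℝ, V) F) q}
        (hX : IsSmoothFieldOn (endModel 𝓘(ℝ, V) F) W X) :
        DifferentiableAt ℝ (coordinateField (endModel 𝓘(ℝ, V) F) L.endChart X) (L.endChart p) :=
      ((he.contDiffOn_coordinateField hX).contDiffAt hO).differentiableAt (by simp)
    have hm {X : ∀ q, TangentSpace (endModel 𝓘(ℝ, V) F) q}
        (hX : IsSmoothFieldOn (endModel 𝓘(ℝ, V) F) W X) :=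
      (ContMDiffOn.contMDiffAt hX (hW.mem_nhds hpW)).mdifferentiableAt (by simp)
    -- Sections of 𝒞 become fields that are twistor pairs at the nearby points of the sphere bundle
    -- only, which is the form that the coordinate theorem requires.
    have hpair {X Y : ∀ q, TangentSpace (endModel 𝓘(ℝ, V) F) q}
        (h : ∀ q ∈ W ∩ sphereBundle F ρ, complexVector (X q) (Y q) ∈ twistorDistribution ρ ι D q) :
        ∀ᶠ w in 𝓝 (L.endChart p), w ∈ (L.coordinates hι hD).sphere →
          (L.coordinates hι hD).IsTwistorPair w
            (coordinateField (endModel 𝓘(ℝ, V) F) L.endChart X w)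
            (coordinateField (endModel 𝓘(ℝ, V) F) L.endChart Y w) := by
      filter_upwards [hO] with w hw hws
      have hq := L.endChart.map_target hw.1
      have hqs : L.endChart.symm w ∈ sphereBundle F ρ := by
        rw [← L.endChart_mem_sphere hι hD hq, L.endChart.right_inv hw.1]
        exact hws
      have h1 := (L.complexVector_mem_twistorDistribution hι hD hq hqs).1 (h _ ⟨hw.2, hqs⟩)
      rw [L.endChart.right_inv hw.1] at h1
      exact h1
    refine (L.complexVector_mem_twistorDistribution hι hD hp hs).2 ?_
    have hbr {X Y : ∀ q, TangentSpace (endModel 𝓘(ℝ, V) F) q}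
        (hX : IsSmoothFieldOn (endModel 𝓘(ℝ, V) F) W X)
        (hY : IsSmoothFieldOn (endModel 𝓘(ℝ, V) F) W Y) :
        L.endDeriv p (VectorField.mlieBracket (endModel 𝓘(ℝ, V) F) X Y p) =
          VectorField.lieBracket ℝ (coordinateField (endModel 𝓘(ℝ, V) F) L.endChart X)
            (coordinateField (endModel 𝓘(ℝ, V) F) L.endChart Y) (L.endChart p) :=
      he.mfderiv_mlieBracket hp (hm hX) (hm hY)
    rw [map_sub, map_add, hbr hX₁ hY₁, hbr hX₂ hY₂, hbr hX₁ hY₂, hbr hX₂ hY₁]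
    exact (L.coordinates hι hD).isTwistorPair_lieBracket hF hV hl hkl hz hsz (hd hX₁) (hd hX₂)
      (hd hY₁) (hd hY₂) (hpair hX) (hpair hY)

end Integrability

theorem theorem5p7 {k l n : ℕ}
    {M : Type*} [TopologicalSpace M] [T2Space M] [ChartedSpace (EuclideanSpace ℝ (Fin n)) M]
    [IsManifold (𝓡 n) ∞ M]
    {F : Type*} [NormedAddCommGroup F] [NormedSpace ℝ F] [FiniteDimensional ℝ F]
    {E : M → Type*} [TopologicalSpace (TotalSpace F E)]
    [∀ x, AddCommGroup (E x)] [∀ x, Module ℝ (E x)] [∀ x, TopologicalSpace (E x)]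
    [∀ x, IsTopologicalAddGroup (E x)] [∀ x, ContinuousSMul ℝ (E x)]
    [FiberBundle F E] [VectorBundle ℝ F E] [ContMDiffVectorBundle ∞ F E (𝓡 n)]
    {A : M → Type*} [∀ x, Ring (A x)] [∀ x, Algebra ℝ (A x)]
    [TopologicalSpace (TotalSpace ℍ[ℝ] A)] [∀ x, TopologicalSpace (A x)]
    [FiberBundle ℍ[ℝ] A] [VectorBundle ℝ ℍ[ℝ] A] [ContMDiffVectorBundle ∞ ℍ[ℝ] A (𝓡 n)]
    (hE : Module.finrank ℝ F = 4 * k) (hM : n + l = 4 * k) (hl : l < 2 * k)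
    (hkl : 2 * k ≠ l + 2)
    (ρ : ∀ x, A x →ₐ[ℝ] (E x →L[ℝ] E x)) (ι : ∀ x : M, TangentSpace (𝓡 n) x →ₗ[ℝ] E x)
    (hι : IsAlmostCRQuaternionicStructure (𝓡 n) F E ρ ι)
    (D : CovariantDerivative (𝓡 n) F E) (hD : IsQuaternionicConnection ρ ι D) :
    IsCRStructure (endModel (𝓡 n) F) (sphereBundle F ρ) (twistorDistribution ρ ι D) := by
  have hV : Module.finrank ℝ (EuclideanSpace ℝ (Fin n)) + l = 4 * k := by
    rw [finrank_euclideanSpace_fin, hM]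
  exact isCRStructure_twistorDistribution hE hV hl hkl hι hD
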